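/- **Theorem (Palatini variation).** Let $M$ be an oriented smooth $n$-dimensional manifold (Hausdorff, second countable, possibly with boundary) and let $(E,\rho,\langle\cdot,\cdot\rangle_E,[\cdot,\cdot]_E)$ be a Courant algebroid over $M$: a smooth real vector bundle $E\to M$ with a bundle map $\rho:E\to TM$, a fibrewise nondegenerate symmetric form $g_E=\langle\cdot,\cdot\rangle_E$ and an $\mathbb R$-bilinear bracket on $\Gamma(E)$ such that $[\psi,f\psi']=f[\psi,\psi']+(\rho(\psi)f)\psi'$, $\rho(\psi)\langle\psi',\psi''\rangle=\langle[\psi,\psi'],\psi''\rangle+\langle\psi',[\psi,\psi'']\rangle$, $[\psi,[\psi',\psi'']]=[[\psi,\psi'],\psi'']+[\psi',[\psi,\psi'']]$ and $\langle[\psi,\psi],\psi'\rangle=\tfrac12\rho(\psi')\langle\psi,\psi\rangle$. Suppose that $\langle\cdot,\cdot\rangle_E$ has signature $(p,q)$ with $p\neq1$ and $q\neq1$. *Fields.* A generalized metric is a maximal positive subbundle $V_+\subseteq E$; put $V_-=V_+^\perp$, so that $E=V_+\oplus V_-$, and $G(\psi,\psi')=\langle\psi_+,\psi'_+\rangle-\langle\psi_-,\psi'_-\rangle$.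 A volume form is a nowhere vanishing $\omega\in\Omega^n(M)$. A Courant algebroid connection is an $\mathbb R$-bilinear map $\nabla:\Gamma(E)\times\Gamma(E)\to\Gamma(E)$ that is $C^\infty(M)$-linear in the first argument and satisfies $\nabla_\psi(f\psi')=f\nabla_\psi\psi'+(\rho(\psi)f)\psi'$ and $\rho(\psi)\langle\psi',\psi''\rangle=\langle\nabla_\psi\psi',\psi''\rangle+\langle\psi',\nabla_\psi\psi''\rangle$. Its torsion is $T(\psi,\psi',\psi'')=\langle\nabla_\psi\psi'-\nabla_{\psi'}\psi-[\psi,\psi'],\psi''\rangle+\langle\nabla_{\psi''}\psi,\psi'\rangle$, its divergence is $\mathrm{Div}_\nabla(\psi)=\mathrm{Tr}(\nabla_{(\cdot)}\psi)$, and its curvature is $$R(\phi',\phi,\psi,\psi')=\tfrac12\{R^0(\phi',\phi,\psi,\psi')+R^0(\psi',\psi,\phi,\phi')+\langle K(\psi,\psi'),K(\phi,\phi')\rangle\},$$ where $R^0(\phi',\phi,\psi,\psi')=\langle\nabla_\psi\nabla_{\psi'}\phi-\nabla_{\psi'}\nabla_\psi\phi-\nabla_{[\psi,\psi']}\phi,\phi'\rangle$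 and $\langle K(\psi,\psi'),\phi\rangle=\langle\nabla_\phi\psi,\psi'\rangle$. Further $\mathrm{Ric}_\nabla(\psi,\psi')=\mathrm{Tr}_{g_E}R(\cdot,\psi,\cdot,\psi')$, $\mathcal R^{g}_\nabla=\mathrm{Tr}_{g}\mathrm{Ric}_\nabla$ for a fibrewise metric $g$, and $\mathrm{Div}_\omega(\psi)=(\mathcal L_{\rho(\psi)}\omega)\,\omega^{-1}$. The connection is Levi-Civita with respect to $V_+$ if $T=0$ and $\nabla_\psi\Gamma(V_+)\subseteq\Gamma(V_+)$ for all $\psi$. Finally, $\mathcal R_E$ denotes the canonical function $\mathcal R^{g_E}_{\nabla^0}$ on $M$, where $\nabla^0$ is any connection that is Levi-Civita with respect to some generalized metric and has $\mathrm{Div}_{\nabla^0}=\mathrm{Div}_{\omega_0}$ for some volume form $\omega_0$ (it does not depend on these choices). *Action.* For a compact set $K\subseteq M$ let $S_K[V_+,\omega,\nabla]=\int_K(\mathcal R^G_\nabla+\mathcal R_E)\,\omega$; if $M$ is compact, $S_M=S_P$ is the generalized Palatini action. The fields $(V_+,\omega,\nabla)$ are called extremal if for every compact $K$ and all smooth $\varphi:V_+\to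 V_-$, $f\in C^\infty(M)$, $\mathcal N\in\Gamma(E^*\otimes\Lambda^2E^*)$ that vanish outside $K$ and on $\partial M$, $$\frac{d}{d\varepsilon}\Big|_{\varepsilon=0}S_K\big[\mathrm{gr}(\varepsilon\varphi),\,e^{\varepsilon f}\omega,\,\nabla+\varepsilon\mathcal N\big]=0,$$ where $\mathrm{gr}(\varepsilon\varphi)=\{v+\varepsilon\varphi(v):v\in V_+\}$ (a generalized metric for small $\varepsilon$) and $\langle(\nabla+\varepsilon\mathcal N)_\psi\psi',\psi''\rangle=\langle\nabla_\psi\psi',\psi''\rangle+\varepsilon\,\mathcal N(\psi,\psi',\psi'')$. *Claim.* $(V_+,\omega,\nabla)$ is extremal if and only if the following three conditions hold: (i) $\mathrm{Ric}_\nabla(V_+,V_-)=0$; (ii) $\mathcal R^G_\nabla+\mathcal R_E=0$; (iii) $\nabla$ is Levi-Civita with respect to $V_+$, and $\mathrm{Div}_\nabla=\mathrm{Div}_\omega$. More precisely, (i) is equivalent to extremality under the variations of $V_+$ alone ($f=0$, $\mathcal N=0$), (ii) to extremality under the variations of $\omega$ alone ($\varphi=0$, $\mathcal N=0$), and (iii)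 to extremality under the variations of $\nabla$ alone ($\varphi=0$, $f=0$). In particular, torsion-freeness and the fixing of the divergence follow from the equation of motion of the connection. -/

import Mathlib

open scoped Manifold ContDiff Topology
open Bundle Set

noncomputable section

namespace Palatini

section Manifold

variable {n : ℕ} {H : Type*} [TopologicalSpace H]
  (I : ModelWithCorners ℝ (EuclideanSpace ℝ (Fin n)) H)
  (M : Type*) [TopologicalSpace M] [ChartedSpace H M]

/-- The derivative `X f` of a function `f` at `x` along a tangent vector `X`. -/
def dirDeriv {I : ModelWithCorners ℝ (EuclideanSpace ℝ (Fin n)) H} {M : Type*}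
    [TopologicalSpace M] [ChartedSpace H M] (f : M → ℝ) (x : M) (X : TangentSpace I x) : ℝ :=
  (mfderiv I 𝓘(ℝ, ℝ) f x : TangentSpace I x → ℝ) X

/-- The `j`-th coordinate vector field `∂/∂yʲ` of the preferred chart at `c`, evaluated at a point
`z` of the domain of that chart. -/
def coordField {M : Type*} [TopologicalSpace M] [ChartedSpace H M]
    (c : M) (j : Fin n) (z : M) : TangentSpace I z :=
  (mfderivWithin 𝓘(ℝ, EuclideanSpace ℝ (Fin n)) I (extChartAt I c).symm (range I)
    (extChartAt I c z) : EuclideanSpace ℝ (Fin n) → EuclideanSpace ℝ (Fin n))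
    (EuclideanSpace.single j (1 : ℝ))

/-- A volume form on the `n`-dimensional manifold `M`: a smooth nowhere vanishing `n`-form. -/
structure VolumeForm [IsManifold I ∞ M] where
  /-- the alternating form on each tangent space -/
  form : ∀ x : M, (TangentSpace I x) [⋀^Fin n]→ₗ[ℝ] ℝ
  smooth : ∀ X : Fin n → Cₛ^∞⟮I; EuclideanSpace ℝ (Fin n), (TangentSpace I : M → Type _)⟯,
    ContMDiff I 𝓘(ℝ, ℝ) ∞ (fun x => form x (fun j => X j x))
  ne_zero : ∀ x, form x ≠ 0

variable {M}

/-- The Lie derivative of an `n`-form along the vector field `X`, evaluated on vector fields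
`Y₁, …, Yₙ`: `(L_X η)(Y₁, …, Yₙ) = X (η(Y₁, …, Yₙ)) - ∑ⱼ η(Y₁, …, [X, Yⱼ], …, Yₙ)`. -/
def lieDerivForm (X : ∀ x : M, TangentSpace I x)
    (η : ∀ x : M, (TangentSpace I x) [⋀^Fin n]→ₗ[ℝ] ℝ)
    (Y : Fin n → ∀ x : M, TangentSpace I x) (x : M) : ℝ :=
  dirDeriv (I := I) (fun z => η z (fun j => Y j z)) x (X x)
    - ∑ j, η x (Function.update (fun k => Y k x) j (VectorField.mlieBracket I X (Y j) x))

/-- The function `L_X Ω · Ω⁻¹`, computed at `x` on the coordinate frame of the chart at `x`. -/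
def volumeDiv [IsManifold I ∞ M] (Ω : VolumeForm I M) (X : ∀ x : M, TangentSpace I x)
    (x : M) : ℝ :=
  lieDerivForm I X Ω.form (coordField I x) x / Ω.form x (fun j => coordField I x j x)

variable [IsManifold I ∞ M] [T2Space M] [SigmaCompactSpace M]

variable (M) in
/-- A smooth partition of unity subordinate to the cover of `M` by the preferred charts. -/
def chartPartition : SmoothPartitionOfUnity M I M univ :=
  Classical.choose (SmoothPartitionOfUnity.exists_isSubordinate_chartAt_source I M)

/-- The integral `∫_K η` of an `n`-form `η` over a compact set `K ⊆ M`, where `M` carries the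
orientation given by the volume form `o` (only its class up to positive functions matters).
On each chart, `η` is weighted by the partition of unity, its coefficient is integrated with
respect to the Lebesgue measure, and the sign corrects for charts that are not oriented. -/
def integralForm (o : VolumeForm I M) (η : ∀ x : M, (TangentSpace I x) [⋀^Fin n]→ₗ[ℝ] ℝ)
    (K : Set M) : ℝ :=
  ∑ᶠ c : M, ∫ y in (extChartAt I c).target ∩ (extChartAt I c).symm ⁻¹' K,
    chartPartition I M c ((extChartAt I c).symm y)
      * (SignType.sign (o.form ((extChartAt I c).symm y)
          (fun j => coordField I c j ((extChartAt I c).symm y))) : ℝ)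
      * η ((extChartAt I c).symm y) (fun j => coordField I c j ((extChartAt I c).symm y))

end Manifold

section LinearAlgebra

variable {V : Type*} [AddCommGroup V] [Module ℝ V]

open Classical in
/-- The trace `Tr_g A = ∑ A(e_λ, e^λ)` of a bilinear form `A` with respect to a nondegenerate
symmetric form `g`, where `(e_λ)` is a basis and `(e^λ)` its `g`-dual basis. -/
def metricTrace [FiniteDimensional ℝ V] (g : LinearMap.BilinForm ℝ V) (A : V → V → ℝ) : ℝ :=
  if h : g.Nondegenerate then
    ∑ i, A (Module.finBasis ℝ V i) (g.dualBasis h (Module.finBasis ℝ V) i)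
  else 0

end LinearAlgebra

section Bundle

variable {n : ℕ} {H : Type*} [TopologicalSpace H]
  (I : ModelWithCorners ℝ (EuclideanSpace ℝ (Fin n)) H)
  {M : Type*} [TopologicalSpace M] [ChartedSpace H M] [IsManifold I ∞ M]
  (F : Type*) [NormedAddCommGroup F] [NormedSpace ℝ F]
  (E : M → Type*) [TopologicalSpace (TotalSpace F E)] [∀ x, AddCommGroup (E x)]
  [∀ x, Module ℝ (E x)] [∀ x, TopologicalSpace (E x)] [FiberBundle F E] [VectorBundle ℝ F E]

/-- `Γ(E)`, the smooth sections of `E`. -/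
abbrev Sec : Type _ := Cₛ^∞⟮I; F, E⟯

variable {I F E}

/-- The product `f ψ` of a smooth function and a smooth section. -/
def fsmul (f : C^∞⟮I, M; ℝ⟯) (ψ : Sec I F E) : Sec I F E where
  toFun x := f x • ψ x
  contMDiff_toFun := f.contMDiff.smul_section ψ.contMDiff

variable (I F E) in
/-- Evaluation `ψ ↦ ψ(x)` of sections at a point. -/
def evalAt (x : M) : Sec I F E →ₗ[ℝ] E x where
  toFun ψ := ψ x
  map_add' _ _ := rfl
  map_smul' _ _ := rfl

variable (I F E) in
/-- Smooth subbundles `V ⊆ E`: families of subspaces that locally admit smooth frames. -/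
def IsSmoothSubbundle (V : ∀ x, Submodule ℝ (E x)) : Prop :=
  ∀ x₀, ∃ (k : ℕ) (s : Fin k → Sec I F E), ∀ᶠ x in 𝓝 x₀,
    LinearIndependent ℝ (fun i => s i x) ∧ Submodule.span ℝ (range fun i => s i x) = V x

variable (I F E) in
/-- A Courant algebroid structure on `E`. -/
structure CourantAlgebroid where
  /-- the anchor `ρ : E → TM` -/
  anchor : ∀ x, E x →ₗ[ℝ] TangentSpace I x
  anchor_smooth : ∀ ψ : Sec I F E,
    ContMDiff I I.tangent ∞ (fun x => (⟨x, anchor x (ψ x)⟩ : TangentBundle I M))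
  /-- the fibrewise metric `⟨·,·⟩_E` -/
  pairing : ∀ x, LinearMap.BilinForm ℝ (E x)
  pairing_symm : ∀ x u v, pairing x u v = pairing x v u
  pairing_nondegenerate : ∀ x, (pairing x).Nondegenerate
  pairing_smooth : ∀ ψ ψ' : Sec I F E,
    ContMDiff I 𝓘(ℝ, ℝ) ∞ (fun x => pairing x (ψ x) (ψ' x))
  /-- the bracket `[·,·]_E` -/
  bracket : Sec I F E →ₗ[ℝ] Sec I F E →ₗ[ℝ] Sec I F E
  bracket_fsmul : ∀ (f : C^∞⟮I, M; ℝ⟯) (ψ ψ' : Sec I F E) (x : M),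
    bracket ψ (fsmul f ψ') x
      = f x • bracket ψ ψ' x + dirDeriv (I := I) f x (anchor x (ψ x)) • ψ' x
  anchor_pairing : ∀ (ψ ψ' ψ'' : Sec I F E) (x : M),
    dirDeriv (I := I) (fun z => pairing z (ψ' z) (ψ'' z)) x (anchor x (ψ x))
      = pairing x (bracket ψ ψ' x) (ψ'' x) + pairing x (ψ' x) (bracket ψ ψ'' x)
  jacobi : ∀ ψ ψ' ψ'' : Sec I F E,
    bracket ψ (bracket ψ' ψ'') = bracket (bracket ψ ψ') ψ'' + bracket ψ' (bracket ψ ψ'')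
  bracket_self : ∀ (ψ ψ' : Sec I F E) (x : M),
    pairing x (bracket ψ ψ x) (ψ' x)
      = (1 / 2) * dirDeriv (I := I) (fun z => pairing z (ψ z) (ψ z)) x (anchor x (ψ' x))

/-- `⟨·,·⟩_E` has signature `(p, q)` on every fibre. -/
def CourantAlgebroid.HasSignature (C : CourantAlgebroid I F E) (p q : ℕ) : Prop :=
  ∀ x, sigPos (C.pairing x).toQuadraticMap = p ∧ sigNeg (C.pairing x).toQuadraticMap = q

/-- A Courant algebroid connection. -/
structure Connection (C : CourantAlgebroid I F E) where
  /-- the covariant derivative `∇(ψ, ψ') = ∇_ψ ψ'` -/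
  cov : Sec I F E →ₗ[ℝ] Sec I F E →ₗ[ℝ] Sec I F E
  cov_fsmul_left : ∀ (f : C^∞⟮I, M; ℝ⟯) (ψ ψ' : Sec I F E),
    cov (fsmul f ψ) ψ' = fsmul f (cov ψ ψ')
  cov_fsmul_right : ∀ (f : C^∞⟮I, M; ℝ⟯) (ψ ψ' : Sec I F E) (x : M),
    cov ψ (fsmul f ψ') x
      = f x • cov ψ ψ' x + dirDeriv (I := I) f x (C.anchor x (ψ x)) • ψ' x
  cov_pairing : ∀ (ψ ψ' ψ'' : Sec I F E) (x : M),
    dirDeriv (I := I) (fun z => C.pairing z (ψ' z) (ψ'' z)) x (C.anchor x (ψ x))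
      = C.pairing x (cov ψ ψ' x) (ψ'' x) + C.pairing x (ψ' x) (cov ψ ψ'' x)

/-- A generalized metric: a maximal positive subbundle `V₊` of `E`. -/
structure GeneralizedMetric (C : CourantAlgebroid I F E) where
  /-- the fibres of `V₊` -/
  plus : ∀ x, Submodule ℝ (E x)
  smooth : IsSmoothSubbundle I F E plus
  pos : ∀ x, ∀ v ∈ plus x, v ≠ 0 → 0 < C.pairing x v v
  maximal : ∀ x (W : Submodule ℝ (E x)), (∀ v ∈ W, v ≠ 0 → 0 < C.pairing x v v) →
    plus x ≤ W → W = plus x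

section Extension

variable [ContMDiffVectorBundle ∞ F E I] [T2Space M] [SigmaCompactSpace M]

variable (I F) in
/-- Every vector of a fibre is the value of a smooth section. -/
lemma evalAt_surjective (x : M) : Function.Surjective (evalAt I F E x) := by
  classical
  intro v
  obtain ⟨s, hs⟩ := exists_contMDiffSection_forall_mem_convex_of_local (n := (⊤ : ℕ∞)) I E
    (F_fiber := F) (t := fun y => {w : E y | ∀ h : x = y, w = h ▸ v})
    (by
      intro y
      by_cases h : x = y
      · subst h
        intro a ha b hb s t _ _ hst
        simp only [forall_true_left, mem_ofPred_eq] at ha hb ⊢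
        rw [ha, hb, ← add_smul, hst, one_smul]
      · intro a _ b _ s t _ _ _ h'
        exact absurd h' h)
    (by
      intro y
      by_cases h : x = y
      · subst h
        obtain ⟨u, hu, hs⟩ := FiberBundle.exists_contMDiffOn_extend I F (k := ∞) v
        refine ⟨u, hu, FiberBundle.extend F v, hs, ?_⟩
        intro z _ h
        subst h
        exact FiberBundle.extend_apply_self F v
      · refine ⟨{x}ᶜ, isOpen_compl_singleton.mem_nhds (fun h' => h h'.symm), fun _ => 0, ?_, ?_⟩
        · exact (Bundle.contMDiff_zeroSection ℝ E).contMDiffOn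
        · intro z hz h'
          exact absurd h'.symm hz)
  exact ⟨s, hs x rfl⟩

variable (I F) in
/-- A linear choice of smooth sections with prescribed value at `x`; tensorial expressions do not
depend on this choice. -/
def ext (x : M) : E x →ₗ[ℝ] Sec I F E :=
  Classical.choose
    ((evalAt I F E x).exists_rightInverse_of_surjective
      (LinearMap.range_eq_top.2 (evalAt_surjective I F x)))

lemma ext_apply (x : M) (v : E x) : ext I F x v x = v :=
  LinearMap.congr_fun (Classical.choose_spec
    ((evalAt I F E x).exists_rightInverse_of_surjective
      (LinearMap.range_eq_top.2 (evalAt_surjective I F x)))) v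

end Extension

section Pointwise

variable [FiniteDimensional ℝ F] {C : CourantAlgebroid I F E}

/-- `V₋`, the orthogonal complement of `V₊`. -/
def GeneralizedMetric.minus (V : GeneralizedMetric C) (x : M) : Submodule ℝ (E x) :=
  (C.pairing x).orthogonal (V.plus x)

lemma GeneralizedMetric.isCompl (V : GeneralizedMetric C) (x : M) :
    IsCompl (V.plus x) (V.minus x) := by
  have : FiniteDimensional ℝ (E x) := VectorBundle.finiteDimensional ℝ F E x
  have hrefl : (C.pairing x).IsRefl := fun u v h => by rw [C.pairing_symm]; exact h
  refine LinearMap.BilinForm.isCompl_orthogonal_of_restrict_nondegenerate hrefl ?_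
  have key : ∀ v : V.plus x, (C.pairing x) (v : E x) (v : E x) = 0 → v = 0 := by
    intro v hv
    by_contra hne
    have := V.pos x v v.2 (fun h => hne (Subtype.ext h))
    linarith
  exact ⟨fun v hv => key v (hv v), fun v hv => key v (hv v)⟩

/-- The component `v ↦ v₊` along the decomposition `E = V₊ ⊕ V₋`. -/
def GeneralizedMetric.projPlus (V : GeneralizedMetric C) (x : M) : E x →ₗ[ℝ] E x :=
  (V.plus x).projection (V.minus x) (V.isCompl x)

/-- The fibrewise metric `G(u, v) = ⟨u₊, v₊⟩ - ⟨u₋, v₋⟩`. -/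
def GeneralizedMetric.G (V : GeneralizedMetric C) (x : M) : LinearMap.BilinForm ℝ (E x) :=
  (C.pairing x).comp (V.projPlus x) (V.projPlus x)
    - (C.pairing x).comp (LinearMap.id - V.projPlus x) (LinearMap.id - V.projPlus x)

variable [ContMDiffVectorBundle ∞ F E I] [T2Space M] [SigmaCompactSpace M]

namespace Connection

variable (D : Connection C)

/-- The torsion `T(ψ, ψ', ψ'')`, as a function on `M`. -/
def torsion (ψ ψ' ψ'' : Sec I F E) (x : M) : ℝ :=
  C.pairing x ((D.cov ψ ψ' - D.cov ψ' ψ - C.bracket ψ ψ') x) (ψ'' x)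
    + C.pairing x (D.cov ψ'' ψ x) (ψ' x)

/-- `∇` is torsion-free. -/
def IsTorsionFree : Prop := ∀ (ψ ψ' ψ'' : Sec I F E) (x : M), D.torsion ψ ψ' ψ'' x = 0

/-- The endomorphism `v ↦ ∇_v ψ` of the fibre over `x`. -/
def covAt (ψ : Sec I F E) (x : M) : E x →ₗ[ℝ] E x :=
  evalAt I F E x ∘ₗ D.cov.flip ψ ∘ₗ ext I F x

/-- The divergence `Div_∇(ψ) = Tr(∇(·, ψ))`. -/
def div (ψ : Sec I F E) (x : M) : ℝ := LinearMap.trace ℝ (E x) (D.covAt ψ x)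

/-- `R⁰(φ', φ, ψ, ψ') = ⟨∇_ψ ∇_ψ' φ - ∇_ψ' ∇_ψ φ - ∇_[ψ,ψ'] φ, φ'⟩`. -/
def curv₀ (φ' φ ψ ψ' : Sec I F E) (x : M) : ℝ :=
  C.pairing x
    ((D.cov ψ (D.cov ψ' φ) - D.cov ψ' (D.cov ψ φ) - D.cov (C.bracket ψ ψ') φ) x) (φ' x)

/-- The vector `K(ψ, ψ')` at `x`, determined by `⟨K(ψ, ψ'), v⟩ = ⟨∇_v ψ, ψ'⟩`. -/
def kVec (ψ ψ' : Sec I F E) (x : M) : E x :=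
  haveI : FiniteDimensional ℝ (E x) := VectorBundle.finiteDimensional ℝ F E x
  ((C.pairing x).toDual (C.pairing_nondegenerate x)).symm
    ((C.pairing x).flip (ψ' x) ∘ₗ D.covAt ψ x)

/-- The curvature tensor `R(φ', φ, ψ, ψ')`, as a function on `M`. -/
def curv (φ' φ ψ ψ' : Sec I F E) (x : M) : ℝ :=
  (1 / 2) * (D.curv₀ φ' φ ψ ψ' x + D.curv₀ ψ' ψ φ φ' x
    + C.pairing x (D.kVec ψ ψ' x) (D.kVec φ φ' x))

/-- The Ricci tensor `Ric(u, v) = Tr_{g_E} R(·, u, ·, v)` at `x`. -/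
def ric (x : M) (u v : E x) : ℝ :=
  haveI : FiniteDimensional ℝ (E x) := VectorBundle.finiteDimensional ℝ F E x
  metricTrace (C.pairing x)
    (fun a b => D.curv (ext I F x a) (ext I F x u) (ext I F x b) (ext I F x v) x)

/-- The scalar curvature `Tr_g(Ric)` with respect to a fibrewise metric `g`. -/
def scalar (g : ∀ x, LinearMap.BilinForm ℝ (E x)) (x : M) : ℝ :=
  haveI : FiniteDimensional ℝ (E x) := VectorBundle.finiteDimensional ℝ F E x
  metricTrace (g x) (D.ric x)

variable (V : GeneralizedMetric C) (Ω : VolumeForm I M)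

/-- `∇` is compatible with `V₊`: `∇_ψ Γ(V₊) ⊆ Γ(V₊)`. -/
def IsMetricCompatible : Prop :=
  ∀ ψ ψ' : Sec I F E, (∀ x, ψ' x ∈ V.plus x) → ∀ x, D.cov ψ ψ' x ∈ V.plus x

/-- `∇` is Levi-Civita with respect to `V₊`. -/
def IsLeviCivita : Prop := D.IsMetricCompatible V ∧ D.IsTorsionFree

/-- `Div_∇ = Div_Ω`, where `Div_Ω(ψ) = L_{ρ(ψ)} Ω · Ω⁻¹`. -/
def HasVolumeDiv : Prop :=
  ∀ (ψ : Sec I F E) (x : M), D.div ψ x = volumeDiv I Ω (fun z => C.anchor z (ψ z)) x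

/-- `∇` is Ricci compatible with `V₊`: `Ric(V₊, V₋) = 0`. -/
def IsRicciCompatible : Prop :=
  ∀ x, ∀ u ∈ V.plus x, ∀ v ∈ V.minus x, D.ric x u v = 0

end Connection

open Classical in
variable (C) in
/-- The canonical scalar `R_E`: the scalar curvature `Tr_{g_E}(Ric_∇)` of any connection `∇` that
is Levi-Civita with respect to some `V₊` and satisfies `Div_∇ = Div_Ω` for some volume form `Ω`.
(The value does not depend on `V₊`, `Ω` and `∇`.) -/
def canonicalScalar : M → ℝ :=
  if h : ∃ t : GeneralizedMetric C × VolumeForm I M × Connection C,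
      t.2.2.IsLeviCivita t.1 ∧ t.2.2.HasVolumeDiv t.2.1 then
    (Classical.choose h).2.2.scalar C.pairing
  else fun _ => 0

/-- The generalized Palatini action `∫_K (Tr_G(Ric_∇) + R_E) Ω` over a compact set `K`, with
respect to the orientation given by `o`. -/
def action (o : VolumeForm I M) (K : Set M) (V : GeneralizedMetric C) (Ω : VolumeForm I M)
    (D : Connection C) : ℝ :=
  integralForm I o (fun x => (D.scalar V.G x + canonicalScalar C x) • Ω.form x) K

/-- A variation of the fields `(V₊, Ω, ∇)` supported in `K` and vanishing on `∂M`: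
`V₊(ε)` is the graph of `ε φ` for small `ε`, `Ω(ε) = exp(ε f) Ω`, and `∇(ε) = ∇ + ε N`, for a
smooth bundle map `φ : V₊ → V₋` (smoothly extended to `E`), a smooth function `f`, and a smooth
section `N` of `E* ⊗ Λ² E*`. -/
structure Variation (V : GeneralizedMetric C) (Ω : VolumeForm I M) (D : Connection C)
    (K : Set M) where
  /-- the direction `φ` of the variation of `V₊` -/
  φ : ∀ x, E x →ₗ[ℝ] E x
  φ_smooth : ∀ ψ : Sec I F E, ∃ ψ' : Sec I F E, ∀ x, φ x (ψ x) = ψ' x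
  φ_mem : ∀ x, ∀ v ∈ V.plus x, φ x v ∈ V.minus x
  φ_zero : ∀ x, x ∉ K ∨ x ∈ I.boundary M → φ x = 0
  /-- the direction `f` of the variation of `Ω` -/
  f : M → ℝ
  f_smooth : ContMDiff I 𝓘(ℝ, ℝ) ∞ f
  f_zero : ∀ x, x ∉ K ∨ x ∈ I.boundary M → f x = 0
  /-- the direction `N` of the variation of `∇` -/
  N : ∀ x, E x →ₗ[ℝ] E x →ₗ[ℝ] E x →ₗ[ℝ] ℝ
  N_smooth : ∀ ψ ψ' ψ'' : Sec I F E,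
    ContMDiff I 𝓘(ℝ, ℝ) ∞ (fun x => N x (ψ x) (ψ' x) (ψ'' x))
  N_skew : ∀ x u v w, N x u v w = - N x u w v
  N_zero : ∀ x, x ∉ K ∨ x ∈ I.boundary M → N x = 0
  /-- the varied generalized metrics -/
  metric : ℝ → GeneralizedMetric C
  metric_eq : ∀ᶠ ε in 𝓝 (0 : ℝ), ∀ x,
    (metric ε).plus x = (V.plus x).map (LinearMap.id + ε • φ x)
  /-- the varied volume forms -/
  vol : ℝ → VolumeForm I M
  vol_eq : ∀ ε x, (vol ε).form x = Real.exp (ε * f x) • Ω.form x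
  /-- the varied connections -/
  conn : ℝ → Connection C
  conn_eq : ∀ ε (ψ ψ' ψ'' : Sec I F E) (x : M),
    C.pairing x ((conn ε).cov ψ ψ' x) (ψ'' x)
      = C.pairing x (D.cov ψ ψ' x) (ψ'' x) + ε * N x (ψ x) (ψ' x) (ψ'' x)

section Extremal

variable (o : VolumeForm I M) (V : GeneralizedMetric C) (Ω : VolumeForm I M) (D : Connection C)

/-- The first variation of the action along the variation `v` supported in `K` vanishes. -/
def FirstVariationVanishes {V : GeneralizedMetric C} {Ω : VolumeForm I M} {D : Connection C}
    {K : Set M} (v : Variation V Ω D K) : Prop :=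
  HasDerivAt (fun ε => action o K (v.metric ε) (v.vol ε) (v.conn ε)) 0 0

/-- `(V₊, Ω, ∇)` extremalizes the action with respect to all three independent fields. -/
def IsExtremal : Prop :=
  ∀ K : Set M, IsCompact K → ∀ v : Variation V Ω D K, FirstVariationVanishes o v

/-- Extremality under variations of the generalized metric only. -/
def IsExtremalMetric : Prop :=
  ∀ K : Set M, IsCompact K → ∀ v : Variation V Ω D K,
    v.f = 0 → v.N = 0 → FirstVariationVanishes o v

/-- Extremality under variations of the volume form only. -/
def IsExtremalVolume : Prop :=
  ∀ K : Set M, IsCompact K → ∀ v : Variation V Ω D K,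
    v.φ = 0 → v.N = 0 → FirstVariationVanishes o v

/-- Extremality under variations of the connection only. -/
def IsExtremalConnection : Prop :=
  ∀ K : Set M, IsCompact K → ∀ v : Variation V Ω D K,
    v.φ = 0 → v.f = 0 → FirstVariationVanishes o v

end Extremal

end Pointwise

end Bundle

end Palatini

end

set_option linter.unusedSectionVars false

noncomputable section

namespace Palatini


/-! ### Derivatives of functions, cut-offs, and globalisation of local data. -/

section Functions

variable {n : ℕ} {H : Type*} [TopologicalSpace H]
  {I : ModelWithCorners ℝ (EuclideanSpace ℝ (Fin n)) H}
  {M : Type*} [TopologicalSpace M] [ChartedSpace H M]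

/-! Along a variation in the directions `φ`, `f`, `N` the integrand is expanded to first order in
`ε`, with an error `O(ε²)` that is locally uniform in the point (`HasJet`). Compactness of `K` makes
the error uniform, so the derivative of the action is the integral over `K` of a continuous function
`lagrangianVariation` (`Variation.hasDerivAt_action`), which is a sum of one term linear in `φ`, one
linear in `N`, and `f (R^G + R_E)`. The function `R_E` does not involve the fields; only its
continuity matters. The three equations can therefore be treated separately, each by the fundamental
lemma `eq_zero_of_volInt`. Test functions vanish on the boundary, which is harmless because the
interior is dense.

The volume equation is then immediate. For the metric, the trace of `R^G` against a graph changes by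
four times the trace over `V₊` of `Ric(·, φ ·)`; rank one maps `φ` show that its integral vanishes
for all `φ` exactly when `Ric(V₊, V₋) = 0`.

For the connection one works in an orthonormal frame adapted to `V₊ ⊕ V₋`, with signs `η`. The
linear part of `R^G` is `Div_∇ Y` plus terms algebraic in `N`, where `Y` is a contraction of `N`
(`AdaptedFrame.scalarLin_eq_div_add`). Writing `Div_∇ = Div_Ω + δ`, the integral of `Div_Ω Y`
vanishes by the divergence theorem `volInt_volumeDiv`, and `δ` is tensorial because both divergences
satisfy the same Leibniz rule. What is left is linear over functions in `N`, with frame coefficients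
`variationCoeff`. As `N` is skew in its last two slots, the equation of motion says that these
coefficients are symmetric there.

The symmetry is solved in `variationCoeff_symm_iff`. If `i`, `k` have one sign and `j` the other, it
says that the connection coefficient `Γ i k j` is zero off the diagonal `i = k` and equals `S` on
it, where `S` is the sum of these diagonal entries over the block of that sign. Hence `r S = S` for
a block of size `r`, and `r ≠ 1` gives `S = 0`: the connection preserves `V₊`. If all three signs
agree, the torsion is a combination of components of `δ`; repeating an index that differs from `j`
but has its sign kills the torsion and leaves `δ j = 0`. Such an index exists because, again, no
block has size one. Then the torsion vanishes too. This is where `p ≠ 1` and `q ≠ 1` enter. -/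

lemma dirDeriv_congr {f g : M → ℝ} {x : M} (h : f =ᶠ[𝓝 x] g) (X : TangentSpace I x) :
    dirDeriv (I := I) f x X = dirDeriv (I := I) g x X := by
  unfold dirDeriv
  have := h.mfderiv_eq (I := I) (I' := 𝓘(ℝ, ℝ))
  exact congrArg (fun L : EuclideanSpace ℝ (Fin n) →L[ℝ] ℝ => L X) this

lemma dirDeriv_add_right (f : M → ℝ) (x : M) (X Y : TangentSpace I x) :
    dirDeriv (I := I) f x (X + Y) = dirDeriv (I := I) f x X + dirDeriv (I := I) f x Y :=
  map_add (mfderiv I 𝓘(ℝ, ℝ) f x) X Y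

lemma dirDeriv_smul_right (f : M → ℝ) (x : M) (c : ℝ) (X : TangentSpace I x) :
    dirDeriv (I := I) f x (c • X) = c * dirDeriv (I := I) f x X :=
  map_smul (mfderiv I 𝓘(ℝ, ℝ) f x) c X

lemma dirDeriv_const (c : ℝ) (x : M) (X : TangentSpace I x) :
    dirDeriv (I := I) (fun _ : M => c) x X = 0 := by
  unfold dirDeriv
  rw [mfderiv_const]
  rfl

lemma dirDeriv_add {f g : M → ℝ} {x : M} (hf : MDifferentiableAt I 𝓘(ℝ, ℝ) f x)
    (hg : MDifferentiableAt I 𝓘(ℝ, ℝ) g x) (X : TangentSpace I x) :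
    dirDeriv (I := I) (fun z => f z + g z) x X
      = dirDeriv (I := I) f x X + dirDeriv (I := I) g x X :=
  congrArg (fun L : EuclideanSpace ℝ (Fin n) →L[ℝ] ℝ => L X)
    (hf.hasMFDerivAt.add hg.hasMFDerivAt).mfderiv

lemma dirDeriv_mul {f g : M → ℝ} {x : M} (hf : MDifferentiableAt I 𝓘(ℝ, ℝ) f x)
    (hg : MDifferentiableAt I 𝓘(ℝ, ℝ) g x) (X : TangentSpace I x) :
    dirDeriv (I := I) (fun z => f z * g z) x X
      = f x * dirDeriv (I := I) g x X + g x * dirDeriv (I := I) f x X :=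
  congrArg (fun L : EuclideanSpace ℝ (Fin n) →L[ℝ] ℝ => L X)
    (hf.hasMFDerivAt.mul hg.hasMFDerivAt).mfderiv

lemma dirDeriv_const_mul {f : M → ℝ} {x : M} (hf : MDifferentiableAt I 𝓘(ℝ, ℝ) f x) (c : ℝ)
    (X : TangentSpace I x) :
    dirDeriv (I := I) (fun z => c * f z) x X = c * dirDeriv (I := I) f x X := by
  rw [dirDeriv_mul mdifferentiableAt_const hf, dirDeriv_const]
  ring

lemma mdifferentiableAt_finset_sum {ι : Type*} {s : Finset ι} {f : ι → M → ℝ} {x : M}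
    (hf : ∀ i ∈ s, MDifferentiableAt I 𝓘(ℝ, ℝ) (f i) x) :
    MDifferentiableAt I 𝓘(ℝ, ℝ) (fun z => ∑ i ∈ s, f i z) x := by
  classical
  induction s using Finset.induction_on with
  | empty => simpa using mdifferentiableAt_const
  | insert a s ha ih =>
    simp only [Finset.sum_insert ha]
    exact (hf a (Finset.mem_insert_self a s)).add
      (ih fun i hi => hf i (Finset.mem_insert_of_mem hi))

lemma dirDeriv_sum {ι : Type*} (s : Finset ι) {f : ι → M → ℝ} {x : M}
    (hf : ∀ i ∈ s, MDifferentiableAt I 𝓘(ℝ, ℝ) (f i) x) (X : TangentSpace I x) :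
    dirDeriv (I := I) (fun z => ∑ i ∈ s, f i z) x X
      = ∑ i ∈ s, dirDeriv (I := I) (f i) x X := by
  classical
  induction s using Finset.induction_on with
  | empty => simpa using dirDeriv_const 0 x X
  | insert a s ha ih =>
    simp only [Finset.sum_insert ha]
    rw [← ih fun i hi => hf i (Finset.mem_insert_of_mem hi)]
    refine dirDeriv_add (hf a (Finset.mem_insert_self a s)) ?_ X
    exact mdifferentiableAt_finset_sum fun i hi => hf i (Finset.mem_insert_of_mem hi)

variable [IsManifold I ∞ M] [T2Space M]

variable (I) in
/-- A smooth cut-off function at `x₀` supported in a given neighbourhood. -/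
lemma exists_cutoff {x₀ : M} {U : Set M} (hU : U ∈ 𝓝 x₀) :
    ∃ χ : C^∞⟮I, M; ℝ⟯, HasCompactSupport χ ∧ tsupport χ ⊆ U ∧ (∀ᶠ x in 𝓝 x₀, χ x = 1) ∧
      ∀ x, 0 ≤ χ x := by
  obtain ⟨b, -, hb⟩ := (SmoothBumpFunction.nhds_basis_tsupport (I := I) x₀).mem_iff.1 hU
  exact ⟨⟨b, b.contMDiff⟩, b.hasCompactSupport, hb, b.eventuallyEq_one, fun x => b.nonneg⟩

/-- Multiply by a cut-off. Brackets and connections act on global sections and smoothness of forms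
is tested on global fields, so coordinate expressions and local frames enter later arguments through
global representatives that agree near the point. -/
lemma exists_global_function {x₀ : M} {U : Set M} (hU : U ∈ 𝓝 x₀) {f : M → ℝ}
    (hf : ContMDiffOn I 𝓘(ℝ, ℝ) ∞ f U) :
    ∃ g : C^∞⟮I, M; ℝ⟯, ∀ᶠ x in 𝓝 x₀, g x = f x := by
  obtain ⟨χ, -, hχU, hχ, -⟩ := exists_cutoff I (interior_mem_nhds.2 hU)
  refine ⟨⟨fun x => χ x * f x, contMDiff_of_tsupport fun x hx => ?_⟩, ?_⟩
  · have hx' : x ∈ interior U := hχU (closure_mono (Function.support_mul_subset_left _ _) hx)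
    exact (χ.contMDiff x).mul (hf.contMDiffAt (mem_interior_iff_mem_nhds.1 hx'))
  · filter_upwards [hχ] with x hx
    show χ x * f x = f x
    rw [hx, one_mul]

variable {F : Type*} [NormedAddCommGroup F] [NormedSpace ℝ F]
  {E : M → Type*} [TopologicalSpace (TotalSpace F E)] [∀ x, AddCommGroup (E x)]
  [∀ x, Module ℝ (E x)] [∀ x, TopologicalSpace (E x)] [FiberBundle F E] [VectorBundle ℝ F E]

lemma exists_global_section {x₀ : M} {U : Set M} (hU : U ∈ 𝓝 x₀) {s : ∀ x, E x}
    (hs : ContMDiffOn I (I.prod 𝓘(ℝ, F)) ∞ (fun x => (⟨x, s x⟩ : TotalSpace F E)) U) :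
    ∃ ψ : Sec I F E, ∀ᶠ x in 𝓝 x₀, ψ x = s x := by
  obtain ⟨χ, -, hχU, hχ, -⟩ := exists_cutoff I (interior_mem_nhds.2 hU)
  refine ⟨⟨fun x => χ x • s x, ContMDiffOn.smul_section_of_tsupport χ.contMDiff.contMDiffOn
    isOpen_interior hχU (hs.mono interior_subset)⟩, ?_⟩
  filter_upwards [hχ] with x hx
  show χ x • s x = s x
  rw [hx, one_smul]

omit [IsManifold I ∞ M] [T2Space M] in
@[simp] lemma fsmul_apply (f : C^∞⟮I, M; ℝ⟯) (ψ : Sec I F E) (x : M) :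
    fsmul f ψ x = f x • ψ x := rfl

end Functions
-- Orthonormal families of an indefinite form, and metric traces.
section Linear

variable {V : Type*} [AddCommGroup V] [Module ℝ V]

/-- `b` is an orthonormal family for `g` with signs `η`. -/
structure IsOrthoFrame (g : LinearMap.BilinForm ℝ V) {m : ℕ} (η : Fin m → ℝ) (b : Fin m → V) :
    Prop where
  sign : ∀ i, η i = 1 ∨ η i = -1
  ortho : ∀ i j, g (b i) (b j) = if i = j then η i else 0

namespace IsOrthoFrame

variable {g : LinearMap.BilinForm ℝ V} {m : ℕ} {η : Fin m → ℝ} {b : Fin m → V}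

lemma mul_self (h : IsOrthoFrame g η b) (i : Fin m) : η i * η i = 1 := by
  rcases h.sign i with h | h <;> rw [h] <;> norm_num

lemma ne_zero (h : IsOrthoFrame g η b) (i : Fin m) : η i ≠ 0 := by
  rcases h.sign i with h | h <;> rw [h] <;> norm_num

lemma linearIndependent (h : IsOrthoFrame g η b) : LinearIndependent ℝ b := by
  rw [Fintype.linearIndependent_iff]
  intro c hc i
  have := congrArg (fun v => g v (b i)) hc
  simp only [map_sum, map_smul, LinearMap.sum_apply, LinearMap.smul_apply, h.ortho, smul_eq_mul,
    mul_ite, mul_zero, Finset.sum_ite_eq', Finset.mem_univ, if_true, map_zero,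
    LinearMap.zero_apply] at this
  exact (mul_eq_zero.1 this).resolve_right (h.ne_zero i)

lemma sum_coord [FiniteDimensional ℝ V] (h : IsOrthoFrame g η b) (hm : m = Module.finrank ℝ V) (v : V) :
    ∑ i, (η i * g v (b i)) • b i = v := by
  have hcard : Fintype.card (Fin m) = Module.finrank ℝ V := by simpa using hm
  let B : Module.Basis (Fin m) ℝ V := Module.Basis.mk h.linearIndependent
    (h.linearIndependent.span_eq_top_of_card_eq_finrank' hcard).ge
  have hB : ∀ i, B i = b i := fun i => by simp [B]
  have hv : v = ∑ i, B.repr v i • b i := by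
    conv_lhs => rw [← B.sum_repr v]
    simp only [hB]
  have hr : ∀ j, g v (b j) = B.repr v j * η j := by
    intro j
    conv_lhs => rw [hv]
    simp [h.ortho]
  conv_rhs => rw [hv]
  refine Finset.sum_congr rfl fun i _ => ?_
  rw [hr, mul_comm (B.repr v i), ← mul_assoc, h.mul_self, one_mul]

end IsOrthoFrame

/-- The metric trace computed with a pair of dual families. -/
lemma metricTrace_eq_sum [FiniteDimensional ℝ V] {g : LinearMap.BilinForm ℝ V}
    (hg : g.Nondegenerate) (hsymm : ∀ u v, g u v = g v u) {ι : Type*} [Fintype ι] {b b' : ι → V}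
    (hb : ∀ v, ∑ i, g v (b' i) • b i = v) (A : V →ₗ[ℝ] V →ₗ[ℝ] ℝ) :
    metricTrace g (fun u v => A u v) = ∑ i, A (b i) (b' i) := by
  classical
  rw [metricTrace, dif_pos hg]
  set f := Module.finBasis ℝ V
  have key : ∀ v, ∑ k, g (f k) v • g.dualBasis hg f k = v := by
    intro v
    have h1 := (g.dualBasis hg f).sum_repr v
    simpa [LinearMap.BilinForm.dualBasis_repr_apply, hsymm v] using h1
  calc ∑ k, A (f k) (g.dualBasis hg f k)
      = ∑ k, ∑ i, g (f k) (b' i) * A (b i) (g.dualBasis hg f k) := by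
        refine Finset.sum_congr rfl fun k _ => ?_
        conv_lhs => rw [← hb (f k)]
        simp
    _ = ∑ i, ∑ k, g (f k) (b' i) * A (b i) (g.dualBasis hg f k) := Finset.sum_comm
    _ = ∑ i, A (b i) (b' i) := by
        refine Finset.sum_congr rfl fun i _ => ?_
        conv_rhs => rw [← key (b' i)]
        simp

end Linear


/-! ### Definiteness of the pairing on the complement of `V₊`. -/

section Frames

variable {n : ℕ} {H : Type*} [TopologicalSpace H]
  {I : ModelWithCorners ℝ (EuclideanSpace ℝ (Fin n)) H}
  {M : Type*} [TopologicalSpace M] [ChartedSpace H M] [IsManifold I ∞ M]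
  {F : Type*} [NormedAddCommGroup F] [NormedSpace ℝ F]
  {E : M → Type*} [TopologicalSpace (TotalSpace F E)] [∀ x, AddCommGroup (E x)]
  [∀ x, Module ℝ (E x)] [∀ x, TopologicalSpace (E x)] [FiberBundle F E] [VectorBundle ℝ F E]

variable {C : CourantAlgebroid I F E}

lemma CourantAlgebroid.pairing_mdifferentiableAt (C : CourantAlgebroid I F E) (ψ ψ' : Sec I F E)
    (x : M) : MDifferentiableAt I 𝓘(ℝ, ℝ) (fun z => C.pairing z (ψ z) (ψ' z)) x :=
  (C.pairing_smooth ψ ψ').mdifferentiable (by simp) x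

lemma CourantAlgebroid.pairing_continuous (C : CourantAlgebroid I F E) (ψ ψ' : Sec I F E) :
    Continuous (fun z => C.pairing z (ψ z) (ψ' z)) :=
  (C.pairing_smooth ψ ψ').continuous

/-- The smooth function `⟨ψ, ψ'⟩`. -/
def CourantAlgebroid.pair (C : CourantAlgebroid I F E) (ψ ψ' : Sec I F E) : C^∞⟮I, M; ℝ⟯ :=
  ⟨fun z => C.pairing z (ψ z) (ψ' z), C.pairing_smooth ψ ψ'⟩

@[simp] lemma CourantAlgebroid.pair_apply (C : CourantAlgebroid I F E) (ψ ψ' : Sec I F E) (x : M) :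
    C.pair ψ ψ' x = C.pairing x (ψ x) (ψ' x) := rfl

lemma CourantAlgebroid.ext_pairing (C : CourantAlgebroid I F E) {x : M} {u v : E x}
    (h : ∀ w, C.pairing x u w = C.pairing x v w) : u = v := by
  have := (C.pairing_nondegenerate x).1 (u - v) fun w => by
    rw [map_sub, LinearMap.sub_apply, h, sub_self]
  exact sub_eq_zero.1 this

namespace GeneralizedMetric

variable (V : GeneralizedMetric C)

lemma pairing_plus_minus {x : M} {u v : E x} (hu : u ∈ V.plus x) (hv : v ∈ V.minus x) :
    C.pairing x u v = 0 := hv u hu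

lemma pairing_minus_plus {x : M} {u v : E x} (hu : u ∈ V.minus x) (hv : v ∈ V.plus x) :
    C.pairing x u v = 0 := by rw [C.pairing_symm]; exact hu v hv

variable [FiniteDimensional ℝ F]

/-- A vector of positive square in the complement could be added to `V₊` and would produce a
strictly larger positive subspace, against maximality. -/
lemma pairing_nonpos_of_mem_minus {x : M} {v : E x} (hv : v ∈ V.minus x) :
    C.pairing x v v ≤ 0 := by
  by_contra! h
  have hle : V.plus x ≤ V.plus x ⊔ Submodule.span ℝ {v} := le_sup_left
  have := V.maximal x _ (fun w hw hne => ?_) hle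
  · have hvp : v ∈ V.plus x := this ▸ Submodule.mem_sup_right (Submodule.mem_span_singleton_self v)
    rw [V.pairing_plus_minus hvp hv] at h
    exact lt_irrefl _ h
  · obtain ⟨u, hu, w', hw', rfl⟩ := Submodule.mem_sup.1 hw
    obtain ⟨c, rfl⟩ := Submodule.mem_span_singleton.1 hw'
    have h1 : C.pairing x (u + c • v) (u + c • v) = C.pairing x u u + c * c * C.pairing x v v := by
      simp only [map_add, map_smul, LinearMap.add_apply, LinearMap.smul_apply, smul_eq_mul,
        V.pairing_plus_minus hu hv, V.pairing_minus_plus hv hu]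
      ring
    rw [h1]
    by_cases hu0 : u = 0
    · subst hu0
      have hc : c ≠ 0 := fun hc => hne (by simp [hc])
      have := mul_pos (mul_self_pos.2 hc) h
      simpa using this
    · exact add_pos_of_pos_of_nonneg (V.pos x u hu hu0) (mul_nonneg (mul_self_nonneg c) h.le)

/-- A null vector `v` of the complement is orthogonal to the whole complement: otherwise moving
along `v` changes the square of some other vector of the complement linearly and makes it positive.
Nondegeneracy then forces `v = 0`. -/
lemma pairing_neg_of_mem_minus {x : M} {v : E x} (hv : v ∈ V.minus x) (h0 : v ≠ 0) :
    C.pairing x v v < 0 := by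
  refine lt_of_le_of_ne (V.pairing_nonpos_of_mem_minus hv) fun hvv => h0 ?_
  refine C.ext_pairing fun w => ?_
  rw [map_zero, LinearMap.zero_apply]
  by_contra hne
  obtain ⟨w₁, hw₁, w₂, hw₂, rfl⟩ :=
    Submodule.mem_sup.1 ((V.isCompl x).sup_eq_top ▸ Submodule.mem_top (x := w))
  rw [map_add, V.pairing_minus_plus hv hw₁, zero_add] at hne
  set a := C.pairing x v w₂ with ha
  -- Solves `⟨w₂, w₂⟩ + 2 t a = 1`; there is no quadratic term because `v` is null.
  set t := (1 - C.pairing x w₂ w₂) / (2 * a)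
  have hmem : w₂ + t • v ∈ V.minus x := Submodule.add_mem _ hw₂ (Submodule.smul_mem _ _ hv)
  have h1 : C.pairing x (w₂ + t • v) (w₂ + t • v) = 1 := by
    simp only [map_add, map_smul, LinearMap.add_apply, LinearMap.smul_apply, smul_eq_mul, hvv,
      C.pairing_symm x w₂ v, ← ha, t]
    field_simp
    ring
  have := V.pairing_nonpos_of_mem_minus hmem
  linarith

lemma finrank_fiber (x : M) : Module.finrank ℝ (E x) = Module.finrank ℝ F :=
  ((trivializationAt F E x).continuousLinearEquivAt ℝ x
    (FiberBundle.mem_baseSet_trivializationAt' x)).toLinearEquiv.finrank_eq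

end GeneralizedMetric

/-- A subspace on which a symmetric form is definite has an orthonormal basis. -/
lemma exists_orthoFrame_of_definite {W : Type*} [AddCommGroup W] [Module ℝ W]
    [FiniteDimensional ℝ W] (g : LinearMap.BilinForm ℝ W) (hsymm : ∀ u v, g u v = g v u)
    (σ : ℝ) (hσ : σ = 1 ∨ σ = -1) (hdef : ∀ v, v ≠ 0 → 0 < σ * g v v) :
    ∃ b : Fin (Module.finrank ℝ W) → W, IsOrthoFrame g (fun _ => σ) b := by
  have hS : LinearMap.IsSymm g := ⟨fun u v => by simpa using hsymm u v⟩
  have : Invertible (2 : ℝ) := invertibleOfNonzero two_ne_zero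
  obtain ⟨v, hv⟩ := LinearMap.BilinForm.exists_orthogonal_basis hS
  have hσσ : σ * σ = 1 := by rcases hσ with h | h <;> rw [h] <;> norm_num
  refine ⟨fun i => (Real.sqrt (σ * g (v i) (v i)))⁻¹ • v i, fun _ => hσ, fun i j => ?_⟩
  simp only [map_smul, LinearMap.smul_apply, smul_eq_mul]
  split_ifs with hij
  · subst hij
    have hpos := hdef (v i) (v.ne_zero i)
    have hs := Real.mul_self_sqrt hpos.le
    have hne := (Real.sqrt_pos.2 hpos).ne'
    have hg : g (v i) (v i) = σ * (Real.sqrt (σ * g (v i) (v i)) * Real.sqrt (σ * g (v i) (v i))) := by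
      rw [hs, ← mul_assoc, hσσ, one_mul]
    set r := Real.sqrt (σ * g (v i) (v i))
    rw [hg]
    field_simp
  · have : g (v i) (v j) = 0 := hv hij
    simp [this]

end Frames


/-! ### Smooth orthonormal frames adapted to `V₊ ⊕ V₋`. -/

section AdaptedFrames

variable {n : ℕ} {H : Type*} [TopologicalSpace H]
  {I : ModelWithCorners ℝ (EuclideanSpace ℝ (Fin n)) H}
  {M : Type*} [TopologicalSpace M] [ChartedSpace H M] [IsManifold I ∞ M]
  {F : Type*} [NormedAddCommGroup F] [NormedSpace ℝ F]
  {E : M → Type*} [TopologicalSpace (TotalSpace F E)] [∀ x, AddCommGroup (E x)]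
  [∀ x, Module ℝ (E x)] [∀ x, TopologicalSpace (E x)] [FiberBundle F E] [VectorBundle ℝ F E]

variable {C : CourantAlgebroid I F E}

lemma sec_add_apply (ψ ψ' : Sec I F E) (x : M) : (ψ + ψ') x = ψ x + ψ' x := rfl
lemma sec_sub_apply (ψ ψ' : Sec I F E) (x : M) : (ψ - ψ') x = ψ x - ψ' x := rfl
lemma sec_smul_apply (c : ℝ) (ψ : Sec I F E) (x : M) : (c • ψ) x = c • ψ x := rfl
lemma sec_sum_apply {ι : Type*} (s : Finset ι) (ψ : ι → Sec I F E) (x : M) :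
    (∑ i ∈ s, ψ i) x = ∑ i ∈ s, ψ i x :=
  map_sum (evalAt I F E x) ψ s

variable [T2Space M]

/-- One Gram–Schmidt step. Orthogonality and normalisation are required of `s` at `x₀` only, so the
value there is unchanged, and the square of the corrected section keeps the sign `σ` nearby, where
the square root is smooth. The last clause records triangularity, which later keeps sections of `V₊`
inside `V₊`. -/
lemma exists_orthonormal_extension {x₀ : M} {k : ℕ} {e : Fin k → Sec I F E} {η : Fin k → ℝ}
    (he : ∀ᶠ x in 𝓝 x₀, IsOrthoFrame (C.pairing x) η (fun i => e i x)) (s : Sec I F E)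
    {σ : ℝ} (hσ : σ = 1 ∨ σ = -1) (hs : ∀ i, C.pairing x₀ (s x₀) (e i x₀) = 0)
    (hss : C.pairing x₀ (s x₀) (s x₀) = σ) :
    ∃ e' : Sec I F E, e' x₀ = s x₀ ∧ ∀ᶠ x in 𝓝 x₀,
      (∀ i, C.pairing x (e' x) (e i x) = 0) ∧ C.pairing x (e' x) (e' x) = σ ∧
      ∃ (d : ℝ) (c : Fin k → ℝ), e' x = d • (s x + ∑ i, c i • e i x) := by
  have hσσ : σ * σ = 1 := by rcases hσ with h | h <;> rw [h] <;> norm_num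
  set s' : Sec I F E := s - ∑ i, η i • fsmul (C.pair s (e i)) (e i) with hs'
  have hs'x : ∀ x, s' x = s x - ∑ i, (η i * C.pairing x (s x) (e i x)) • e i x := by
    intro x
    simp only [hs', sec_sub_apply, sec_sum_apply, sec_smul_apply, fsmul_apply, smul_smul,
      CourantAlgebroid.pair_apply]
  have h0 : s' x₀ = s x₀ := by simp [hs'x, hs]
  have horth : ∀ᶠ x in 𝓝 x₀, ∀ i, C.pairing x (s' x) (e i x) = 0 := by
    filter_upwards [he] with x hx i
    rw [hs'x]
    simp only [map_sub, LinearMap.sub_apply, map_sum, LinearMap.sum_apply, map_smul,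
      LinearMap.smul_apply, smul_eq_mul, hx.ortho, mul_ite, mul_zero, Finset.sum_ite_eq',
      Finset.mem_univ, if_true]
    rw [mul_right_comm, hx.mul_self, one_mul, sub_self]
  set U : Set M := {x | 0 < σ * C.pairing x (s' x) (s' x)}
  have hUo : IsOpen U :=
    isOpen_lt continuous_const (continuous_const.mul (C.pairing_continuous s' s'))
  have hxU : x₀ ∈ U := by
    show 0 < σ * C.pairing x₀ (s' x₀) (s' x₀)
    rw [h0, hss, hσσ]
    exact one_pos
  have hsm : ContMDiffOn I 𝓘(ℝ, ℝ) ∞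
      (fun x => (Real.sqrt (σ * C.pairing x (s' x) (s' x)))⁻¹) U := by
    intro x hx
    have h1 : ContMDiffAt I 𝓘(ℝ, ℝ) ∞ (fun x => σ * C.pairing x (s' x) (s' x)) x :=
      (contMDiff_const.mul (C.pairing_smooth s' s')) x
    have hx' : 0 < σ * C.pairing x (s' x) (s' x) := hx
    have h2 : ContDiffAt ℝ ∞ (fun t : ℝ => (Real.sqrt t)⁻¹) (σ * C.pairing x (s' x) (s' x)) :=
      (Real.contDiffAt_sqrt hx'.ne').inv (Real.sqrt_pos.2 hx').ne'
    exact (h2.contMDiffAt.comp x h1).contMDiffWithinAt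
  obtain ⟨r, hr⟩ := exists_global_function (hUo.mem_nhds hxU) hsm
  refine ⟨fsmul r s', ?_, ?_⟩
  · rw [fsmul_apply, hr.self_of_nhds, h0, hss, hσσ, Real.sqrt_one, inv_one, one_smul]
  · filter_upwards [horth, hr, hUo.mem_nhds hxU] with x hx hrx hxU
    refine ⟨fun i => by simp [hx i], ?_, r x, fun i => -(η i * C.pairing x (s x) (e i x)), ?_⟩
    · have hx' : 0 < σ * C.pairing x (s' x) (s' x) := hxU
      have h1 := Real.mul_self_sqrt hx'.le
      have hne := (Real.sqrt_pos.2 hx').ne'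
      simp only [fsmul_apply, map_smul, LinearMap.smul_apply, smul_eq_mul, hrx]
      set ρ := Real.sqrt (σ * C.pairing x (s' x) (s' x))
      have h2 : C.pairing x (s' x) (s' x) = σ * (ρ * ρ) := by
        rw [h1, ← mul_assoc, hσσ, one_mul]
      rw [h2]
      field_simp
    · rw [fsmul_apply, hs'x]
      simp [sub_eq_add_neg]

/-- Smooth Gram–Schmidt orthonormalization near a point. -/
lemma exists_orthonormal_sections (x₀ : M) : ∀ (k : ℕ) (η : Fin k → ℝ) (s : Fin k → Sec I F E),
    IsOrthoFrame (C.pairing x₀) η (fun i => s i x₀) →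
    ∃ e : Fin k → Sec I F E, (∀ i, e i x₀ = s i x₀) ∧ ∀ᶠ x in 𝓝 x₀,
      IsOrthoFrame (C.pairing x) η (fun i => e i x) ∧
      ∀ i, e i x ∈ Submodule.span ℝ ((fun j => s j x) '' Iic i) := by
  intro k
  induction k with
  | zero =>
    intro η s _
    exact ⟨s, fun _ => rfl, Filter.Eventually.of_forall fun x =>
      ⟨⟨fun i => i.elim0, fun i => i.elim0⟩, fun i => i.elim0⟩⟩
  | succ k ih =>
    intro η s hs
    obtain ⟨e, he0, he⟩ := ih (fun i => η i.castSucc) (fun i => s i.castSucc)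
      ⟨fun i => hs.sign _, fun i j => by simpa using hs.ortho i.castSucc j.castSucc⟩
    obtain ⟨e', he'0, he'⟩ := exists_orthonormal_extension (C := C) (he.mono fun x hx => hx.1)
      (s (Fin.last k)) (hs.sign (Fin.last k))
      (fun i => by
        rw [he0, hs.ortho, if_neg (Fin.castSucc_lt_last i).ne'])
      (by rw [hs.ortho, if_pos rfl])
    refine ⟨Fin.snoc (α := fun _ => Sec I F E) e e', fun i => ?_, ?_⟩
    · induction i using Fin.lastCases with
      | last => simpa using he'0
      | cast i => simpa using he0 i
    filter_upwards [he, he'] with x hx hx'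
    refine ⟨⟨hs.sign, fun i j => ?_⟩, fun i => ?_⟩
    · induction i using Fin.lastCases with
      | last =>
        induction j using Fin.lastCases with
        | last => simpa using hx'.2.1
        | cast j =>
          rw [if_neg (Fin.castSucc_lt_last j).ne']
          simpa using hx'.1 j
      | cast i =>
        induction j using Fin.lastCases with
        | last =>
          rw [if_neg (Fin.castSucc_lt_last i).ne, C.pairing_symm]
          simpa using hx'.1 i
        | cast j => simpa using hx.1.ortho i j
    · have hmono : ∀ i : Fin k, e i x ∈ Submodule.span ℝ ((fun j => s j x) '' Iic i.castSucc) := by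
        intro i
        refine Submodule.span_mono ?_ (hx.2 i)
        rintro _ ⟨j, hj, rfl⟩
        exact ⟨j.castSucc, Fin.castSucc_le_castSucc_iff.2 hj, rfl⟩
      induction i using Fin.lastCases with
      | last =>
        obtain ⟨d, c, hc⟩ := hx'.2.2
        simp only [Fin.snoc_last]
        rw [hc]
        refine Submodule.smul_mem _ _ (Submodule.add_mem _ (Submodule.subset_span
          ⟨Fin.last k, self_mem_Iic, rfl⟩) (Submodule.sum_mem _ fun i _ => Submodule.smul_mem _ _ ?_))
        refine Submodule.span_mono (image_mono ?_) (hmono i)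
        exact Iic_subset_Iic.2 (Fin.le_last _)
      | cast i => simpa using hmono i

variable [FiniteDimensional ℝ F]

/-- An orthonormal frame of `E` adapted to the decomposition `E = V₊ ⊕ V₋`, consisting of global
sections which are orthonormal on a neighbourhood of `x₀`. -/
structure AdaptedFrame (V : GeneralizedMetric C) (x₀ : M) where
  /-- the number of sections -/
  m : ℕ
  /-- the signs -/
  η : Fin m → ℝ
  /-- the sections -/
  e : Fin m → Sec I F E
  /-- the neighbourhood on which the sections are orthonormal -/
  dom : Set M
  isOpen_dom : IsOpen dom
  mem_dom : x₀ ∈ dom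
  card_eq : m = Module.finrank ℝ F
  ortho : ∀ x ∈ dom, IsOrthoFrame (C.pairing x) η (fun i => e i x)
  mem_plus : ∀ x ∈ dom, ∀ i, η i = 1 → e i x ∈ V.plus x
  mem_minus : ∀ x ∈ dom, ∀ i, η i = -1 → e i x ∈ V.minus x

variable [ContMDiffVectorBundle ∞ F E I] [SigmaCompactSpace M]

/-- Orthonormal bases of `V₊` and `V₋` at `x₀` are extended and orthonormalised with `V₊` first.
Only the first `p` sections are extended inside `V₊`; the others are extended arbitrarily, since
orthogonality to the first `p` already puts them into `V₋`. -/
lemma nonempty_adaptedFrame (V : GeneralizedMetric C) (x₀ : M) : Nonempty (AdaptedFrame V x₀) := by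
  have : FiniteDimensional ℝ (E x₀) := VectorBundle.finiteDimensional ℝ F E x₀
  obtain ⟨k, s, hs⟩ := V.smooth x₀
  obtain ⟨p, b, hp, hb⟩ : ∃ (p : ℕ) (b : Fin p → V.plus x₀), p = Module.finrank ℝ (V.plus x₀) ∧
      IsOrthoFrame ((C.pairing x₀).restrict (V.plus x₀)) (fun _ => 1) b := by
    obtain ⟨b, hb⟩ := exists_orthoFrame_of_definite ((C.pairing x₀).restrict (V.plus x₀))
      (fun u v => C.pairing_symm x₀ u v) 1 (Or.inl rfl)
      (fun v hv => by simpa using V.pos x₀ v v.2 (by simpa using hv))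
    exact ⟨_, b, rfl, hb⟩
  obtain ⟨q, b', hq, hb'⟩ : ∃ (q : ℕ) (b : Fin q → V.minus x₀), q = Module.finrank ℝ (V.minus x₀) ∧
      IsOrthoFrame ((C.pairing x₀).restrict (V.minus x₀)) (fun _ => -1) b := by
    obtain ⟨b, hb⟩ := exists_orthoFrame_of_definite ((C.pairing x₀).restrict (V.minus x₀))
      (fun u v => C.pairing_symm x₀ u v) (-1) (Or.inr rfl)
      (fun v hv => by simpa using V.pairing_neg_of_mem_minus v.2 (by simpa using hv))
    exact ⟨_, b, rfl, hb⟩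
  have hk : ∀ᶠ x in 𝓝 x₀, Module.finrank ℝ (V.plus x) = k := by
    filter_upwards [hs] with x hx
    rw [← hx.2, finrank_span_eq_card hx.1, Fintype.card_fin]
  have hplus : ∀ i, ∃ t : Sec I F E, t x₀ = b i ∧ ∀ᶠ x in 𝓝 x₀, t x ∈ V.plus x := by
    intro i
    have hmem : (b i : E x₀) ∈ Submodule.span ℝ (range fun i => s i x₀) := by
      rw [hs.self_of_nhds.2]
      exact (b i).2
    obtain ⟨c, hc⟩ := (Submodule.mem_span_range_iff_exists_fun ℝ).1 hmem
    refine ⟨∑ j, c j • s j, by rw [sec_sum_apply]; exact hc, ?_⟩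
    filter_upwards [hs] with x hx
    rw [sec_sum_apply, ← hx.2]
    exact Submodule.sum_mem _ fun j _ => Submodule.smul_mem _ _ (Submodule.subset_span ⟨j, rfl⟩)
  choose t ht0 ht using hplus
  have hpq : p + q = Module.finrank ℝ F := by
    rw [hp, hq, Submodule.finrank_add_eq_of_isCompl (V.isCompl x₀)]
    exact GeneralizedMetric.finrank_fiber x₀
  set η : Fin (p + q) → ℝ := Fin.append (fun _ => 1) (fun _ => -1) with hη
  set S : Fin (p + q) → Sec I F E := Fin.append t (fun i => ext I F x₀ (b' i)) with hS
  have hS0 : IsOrthoFrame (C.pairing x₀) η (fun i => S i x₀) := by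
    refine ⟨fun i => ?_, fun i j => ?_⟩
    · induction i using Fin.addCases <;> simp [hη]
    · induction i using Fin.addCases with
      | left i =>
        induction j using Fin.addCases with
        | left j =>
          have := hb.ortho i j
          simpa [hη, hS, ht0, Fin.ext_iff] using this
        | right j =>
          rw [if_neg (by simp [Fin.ext_iff]; omega)]
          simp only [hS, Fin.append_left, Fin.append_right, ht0, ext_apply]
          exact V.pairing_plus_minus (b i).2 (b' j).2
      | right i =>
        induction j using Fin.addCases with
        | left j =>
          rw [if_neg (by simp [Fin.ext_iff]; omega)]
          simp only [hS, Fin.append_left, Fin.append_right, ht0, ext_apply]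
          exact V.pairing_minus_plus (b' i).2 (b j).2
        | right j =>
          have := hb'.ortho i j
          simpa [hη, hS, ext_apply, Fin.ext_iff] using this
  obtain ⟨e, he0, he⟩ := exists_orthonormal_sections x₀ (p + q) η S hS0
  have hgood : ∀ᶠ x in 𝓝 x₀, IsOrthoFrame (C.pairing x) η (fun i => e i x) ∧
      (∀ i, η i = 1 → e i x ∈ V.plus x) ∧ (∀ i, η i = -1 → e i x ∈ V.minus x) := by
    have ht' : ∀ᶠ x in 𝓝 x₀, ∀ i, t i x ∈ V.plus x := Filter.eventually_all.2 ht
    filter_upwards [he, ht', hk] with x hx htx hkx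
    -- By triangularity the first `p` orthonormalised sections only involve the first `p` original
    -- ones, all of which lie in `V₊`.
    have hpm : ∀ i : Fin p, e (Fin.castAdd q i) x ∈ V.plus x := by
      intro i
      refine Submodule.span_le.2 ?_ (hx.2 (Fin.castAdd q i))
      rintro _ ⟨j, hj, rfl⟩
      induction j using Fin.addCases with
      | left j => simpa [hS] using htx j
      | right j =>
        have : p + (j : ℕ) ≤ i := hj
        omega
    refine ⟨hx.1, fun i hi => ?_, fun i hi => ?_⟩
    · induction i using Fin.addCases with
      | left i => exact hpm i
      | right i => norm_num [hη] at hi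
    · induction i using Fin.addCases with
      | left i => norm_num [hη] at hi
      | right i =>
        have : FiniteDimensional ℝ (E x) := VectorBundle.finiteDimensional ℝ F E x
        have hli : LinearIndependent ℝ fun j : Fin p => e (Fin.castAdd q j) x :=
          hx.1.linearIndependent.comp _ (Fin.castAdd_injective p q)
        -- The rank of `V₊` is locally constant, so `p` independent vectors in it span it.
        have hspan : Submodule.span ℝ (range fun j : Fin p => e (Fin.castAdd q j) x)
            = V.plus x := by
          refine Submodule.eq_of_le_of_finrank_eq
            (Submodule.span_le.2 (by rintro _ ⟨j, rfl⟩; exact hpm j)) ?_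
          rw [finrank_span_eq_card hli, Fintype.card_fin, hkx]
          rw [hp]
          exact hk.self_of_nhds
        intro u hu
        rw [← hspan] at hu
        show C.pairing x u _ = 0
        induction hu using Submodule.span_induction with
        | mem u hu =>
          obtain ⟨j, rfl⟩ := hu
          rw [hx.1.ortho, if_neg (by simp [Fin.ext_iff]; omega)]
        | zero => simp
        | add u v _ _ hu hv => rw [map_add, LinearMap.add_apply, hu, hv, add_zero]
        | smul c u _ hu => rw [map_smul, LinearMap.smul_apply, hu, smul_zero]
  obtain ⟨U, hU, hUo, hxU⟩ := eventually_nhds_iff.1 hgood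
  exact ⟨⟨p + q, η, e, U, hUo, hxU, hpq, fun x hx => (hU x hx).1, fun x hx => (hU x hx).2.1,
    fun x hx => (hU x hx).2.2⟩⟩

end AdaptedFrames


/-! ### Function-linear expressions depend on the value at a point only. -/

section Tensoriality

variable {n : ℕ} {H : Type*} [TopologicalSpace H]
  {I : ModelWithCorners ℝ (EuclideanSpace ℝ (Fin n)) H}
  {M : Type*} [TopologicalSpace M] [ChartedSpace H M] [IsManifold I ∞ M]
  {F : Type*} [NormedAddCommGroup F] [NormedSpace ℝ F]
  {E : M → Type*} [TopologicalSpace (TotalSpace F E)] [∀ x, AddCommGroup (E x)]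
  [∀ x, Module ℝ (E x)] [∀ x, TopologicalSpace (E x)] [FiberBundle F E] [VectorBundle ℝ F E]

variable [FiniteDimensional ℝ F] [ContMDiffVectorBundle ∞ F E I] [T2Space M]

/-- Near a point, a section is a combination of global sections with smooth coefficients. -/
lemma exists_local_expansion (ψ : Sec I F E) (x₀ : M) :
    ∃ (k : ℕ) (c : Fin k → C^∞⟮I, M; ℝ⟯) (s : Fin k → Sec I F E),
      (∀ᶠ x in 𝓝 x₀, ψ x = ∑ i, c i x • s i x) ∧ (ψ x₀ = 0 → ∀ i, c i x₀ = 0) := by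
  set t := trivializationAt F E x₀
  have hx₀ : x₀ ∈ t.baseSet := FiberBundle.mem_baseSet_trivializationAt' x₀
  have hnhds : t.baseSet ∈ 𝓝 x₀ := t.open_baseSet.mem_nhds hx₀
  set b := Module.finBasis ℝ F
  have h1 : ContMDiffVectorBundle 1 F E I := ContMDiffVectorBundle.of_le (n := ∞) (by simp)
  have hs : ∀ i, ∃ σ : Sec I F E, ∀ᶠ x in 𝓝 x₀, σ x = t.localFrame b i x := fun i =>
    exists_global_section hnhds (t.contMDiffOn_localFrame_baseSet (I := I) ∞ b i)
  have hc : ∀ i, ∃ c : C^∞⟮I, M; ℝ⟯, ∀ᶠ x in 𝓝 x₀, c x = t.localFrameCoeff I b i x (ψ x) :=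
    fun i => exists_global_function hnhds
      (contMDiffOn_baseSet_localFrameCoeff b ψ.contMDiff.contMDiffOn i)
  choose s hs using hs
  choose c hc using hc
  refine ⟨_, c, s, ?_, fun h0 i => ?_⟩
  · filter_upwards [Filter.eventually_all.2 hs, Filter.eventually_all.2 hc,
      t.eventually_eq_localFrame_sum_coeff_smul (I := I) b (s := ψ) hx₀] with x hsx hcx hx
    rw [hx]
    exact Finset.sum_congr rfl fun i _ => by rw [hsx, hcx]
  · rw [(hc i).self_of_nhds, h0, map_zero]

/-- A function-linear functional of sections vanishes on sections vanishing at the point. -/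
lemma tensorial_eq_zero {W : Type*} [AddCommGroup W] [Module ℝ W] {x : M} {A : Sec I F E → W}
    (hadd : ∀ ψ ψ', A (ψ + ψ') = A ψ + A ψ') (hsmul : ∀ f ψ, A (fsmul f ψ) = f x • A ψ)
    {ψ : Sec I F E} (hψ : ψ x = 0) : A ψ = 0 := by
  have hloc : ∀ ψ : Sec I F E, (∀ᶠ z in 𝓝 x, ψ z = 0) → A ψ = 0 := by
    intro ψ hψ
    obtain ⟨χ, -, hχU, hχ, -⟩ := exists_cutoff I hψ
    -- The product of `χ` and `ψ` vanishes identically, hence equals `0 · ψ`; evaluating `A` on both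
    -- forms gives `A ψ = 0` from function-linearity alone.
    have hzero : fsmul χ ψ = fsmul 0 ψ := by
      ext z
      by_cases hz : z ∈ tsupport χ
      · have : ψ z = 0 := hχU hz
        simp [this]
      · simp [image_eq_zero_of_notMem_tsupport hz]
    have h1 := hsmul χ ψ
    rw [hzero, hsmul, hχ.self_of_nhds, one_smul] at h1
    rw [← h1]
    exact zero_smul ℝ _
  have hA0 : A 0 = 0 := hloc 0 (Filter.Eventually.of_forall fun _ => rfl)
  obtain ⟨k, c, s, hcs, hc0⟩ := exists_local_expansion ψ x
  have hsum : ∀ t : Finset (Fin k), A (∑ i ∈ t, fsmul (c i) (s i)) = ∑ i ∈ t, A (fsmul (c i) (s i)) := by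
    intro t
    classical
    induction t using Finset.induction_on with
    | empty => simpa using hA0
    | insert a t ha ih => rw [Finset.sum_insert ha, Finset.sum_insert ha, hadd, ih]
  have hrest := hloc (ψ + fsmul (-1) (∑ i, fsmul (c i) (s i))) (by
    filter_upwards [hcs] with z hz
    rw [sec_add_apply, fsmul_apply, sec_sum_apply, hz]
    simp only [fsmul_apply]
    exact (congrArg _ (neg_one_smul ℝ _)).trans (add_neg_cancel _))
  rw [hadd, hsmul, hsum] at hrest
  have hz : ∑ i, A (fsmul (c i) (s i)) = 0 :=
    Finset.sum_eq_zero fun i _ => by rw [hsmul, hc0 hψ, zero_smul]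
  rwa [hz, smul_zero, add_zero] at hrest

lemma tensorial_congr {W : Type*} [AddCommGroup W] [Module ℝ W] {x : M} {A : Sec I F E → W}
    (hadd : ∀ ψ ψ', A (ψ + ψ') = A ψ + A ψ') (hsmul : ∀ f ψ, A (fsmul f ψ) = f x • A ψ)
    {ψ ψ' : Sec I F E} (h : ψ x = ψ' x) : A ψ = A ψ' := by
  have h1 := tensorial_eq_zero hadd hsmul (ψ := ψ - ψ') (by rw [sec_sub_apply, h, sub_self])
  have h2 := hadd (ψ - ψ') ψ'
  rwa [sub_add_cancel, h1, zero_add] at h2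

end Tensoriality

/-! ### The bracket: symmetric part, left Leibniz rule, compatibility with the anchor. -/

section Anchor

variable {n : ℕ} {H : Type*} [TopologicalSpace H]
  {I : ModelWithCorners ℝ (EuclideanSpace ℝ (Fin n)) H}
  {M : Type*} [TopologicalSpace M] [ChartedSpace H M] [IsManifold I ∞ M]
  {F : Type*} [NormedAddCommGroup F] [NormedSpace ℝ F]
  {E : M → Type*} [TopologicalSpace (TotalSpace F E)] [∀ x, AddCommGroup (E x)]
  [∀ x, Module ℝ (E x)] [∀ x, TopologicalSpace (E x)] [FiberBundle F E] [VectorBundle ℝ F E]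

namespace CourantAlgebroid

variable (C : CourantAlgebroid I F E)

/-- The derivative `ρ(v) f` at `x`. -/
def act (x : M) (v : E x) (f : M → ℝ) : ℝ := dirDeriv (I := I) f x (C.anchor x v)

lemma act_add_left (x : M) (v w : E x) (f : M → ℝ) :
    C.act x (v + w) f = C.act x v f + C.act x w f := by
  rw [act, map_add, dirDeriv_add_right]; rfl

lemma act_smul_left (x : M) (c : ℝ) (v : E x) (f : M → ℝ) :
    C.act x (c • v) f = c * C.act x v f := by
  rw [act, map_smul, dirDeriv_smul_right]; rfl

lemma act_congr {x : M} (v : E x) {f g : M → ℝ} (h : f =ᶠ[𝓝 x] g) : C.act x v f = C.act x v g :=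
  dirDeriv_congr h _

lemma act_const (x : M) (v : E x) (c : ℝ) : C.act x v (fun _ => c) = 0 := dirDeriv_const c x _

lemma act_add {x : M} (v : E x) {f g : M → ℝ} (hf : MDifferentiableAt I 𝓘(ℝ, ℝ) f x)
    (hg : MDifferentiableAt I 𝓘(ℝ, ℝ) g x) :
    C.act x v (fun z => f z + g z) = C.act x v f + C.act x v g := dirDeriv_add hf hg _

lemma act_mul {x : M} (v : E x) {f g : M → ℝ} (hf : MDifferentiableAt I 𝓘(ℝ, ℝ) f x)
    (hg : MDifferentiableAt I 𝓘(ℝ, ℝ) g x) :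
    C.act x v (fun z => f z * g z) = f x * C.act x v g + g x * C.act x v f := dirDeriv_mul hf hg _

lemma act_const_mul {x : M} (v : E x) {f : M → ℝ} (hf : MDifferentiableAt I 𝓘(ℝ, ℝ) f x) (c : ℝ) :
    C.act x v (fun z => c * f z) = c * C.act x v f := dirDeriv_const_mul hf c _

lemma act_sum {x : M} (v : E x) {ι : Type*} (s : Finset ι) {f : ι → M → ℝ}
    (hf : ∀ i ∈ s, MDifferentiableAt I 𝓘(ℝ, ℝ) (f i) x) :
    C.act x v (fun z => ∑ i ∈ s, f i z) = ∑ i ∈ s, C.act x v (f i) := dirDeriv_sum s hf _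

/-- The differential of a function, as a linear form on the fibre. -/
def actForm (x : M) (f : M → ℝ) : E x →ₗ[ℝ] ℝ where
  toFun v := C.act x v f
  map_add' v w := C.act_add_left x v w f
  map_smul' c v := C.act_smul_left x c v f

lemma contMDiff_act (ψ : Sec I F E) (f : C^∞⟮I, M; ℝ⟯) :
    ContMDiff I 𝓘(ℝ, ℝ) ∞ (fun x => C.act x (ψ x) f) := by
  have h1 : ContMDiff I.tangent 𝓘(ℝ, ℝ).tangent ∞ (tangentMap I 𝓘(ℝ, ℝ) f) :=
    f.contMDiff.contMDiff_tangentMap (by simp)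
  exact (contMDiff_snd_tangentBundle_modelSpace ℝ 𝓘(ℝ, ℝ)).comp (h1.comp (C.anchor_smooth ψ))

/-- The smooth function `ρ(ψ) f`. -/
def actFun (ψ : Sec I F E) (f : C^∞⟮I, M; ℝ⟯) : C^∞⟮I, M; ℝ⟯ :=
  ⟨fun x => C.act x (ψ x) f, C.contMDiff_act ψ f⟩

@[simp] lemma actFun_apply (ψ : Sec I F E) (f : C^∞⟮I, M; ℝ⟯) (x : M) :
    C.actFun ψ f x = C.act x (ψ x) f := rfl

lemma bracket_fsmul_right (f : C^∞⟮I, M; ℝ⟯) (ψ ψ' : Sec I F E) :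
    C.bracket ψ (fsmul f ψ') = fsmul f (C.bracket ψ ψ') + fsmul (C.actFun ψ f) ψ' := by
  ext x
  exact C.bracket_fsmul f ψ ψ' x

lemma act_pairing (ψ ψ' ψ'' : Sec I F E) (x : M) :
    C.act x (ψ x) (fun z => C.pairing z (ψ' z) (ψ'' z))
      = C.pairing x (C.bracket ψ ψ' x) (ψ'' x) + C.pairing x (ψ' x) (C.bracket ψ ψ'' x) :=
  C.anchor_pairing ψ ψ' ψ'' x

/-- The symmetric part of the bracket. -/
lemma bracket_add_swap (ψ ψ' ψ'' : Sec I F E) (x : M) :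
    C.pairing x (C.bracket ψ ψ' x) (ψ'' x) + C.pairing x (C.bracket ψ' ψ x) (ψ'' x)
      = C.act x (ψ'' x) (fun z => C.pairing z (ψ z) (ψ' z)) := by
  have h := C.bracket_self (ψ + ψ') ψ'' x
  have h1 := C.bracket_self ψ ψ'' x
  have h2 := C.bracket_self ψ' ψ'' x
  have hd1 := C.pairing_mdifferentiableAt ψ ψ x
  have hd2 := C.pairing_mdifferentiableAt ψ' ψ' x
  have hd3 := C.pairing_mdifferentiableAt ψ ψ' x
  have hfun : (fun z => C.pairing z ((ψ + ψ') z) ((ψ + ψ') z)) = fun z =>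
      (C.pairing z (ψ z) (ψ z) + C.pairing z (ψ' z) (ψ' z)) + 2 * C.pairing z (ψ z) (ψ' z) := by
    funext z
    simp only [sec_add_apply, map_add, LinearMap.add_apply, C.pairing_symm z (ψ' z) (ψ z)]
    ring
  have hd12 : MDifferentiableAt I 𝓘(ℝ, ℝ)
      (fun z => C.pairing z (ψ z) (ψ z) + C.pairing z (ψ' z) (ψ' z)) x := hd1.add hd2
  have hd3' : MDifferentiableAt I 𝓘(ℝ, ℝ) (fun z => 2 * C.pairing z (ψ z) (ψ' z)) x :=
    mdifferentiableAt_const.mul hd3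
  rw [hfun, dirDeriv_add hd12 hd3', dirDeriv_add hd1 hd2, dirDeriv_const_mul hd3] at h
  simp only [map_add, LinearMap.add_apply, sec_add_apply] at h
  show _ = dirDeriv (I := I) _ x _
  linarith

/-- The Leibniz rule in the first argument. -/
lemma bracket_fsmul_left (f : C^∞⟮I, M; ℝ⟯) (ψ ψ' ψ'' : Sec I F E) (x : M) :
    C.pairing x (C.bracket (fsmul f ψ) ψ' x) (ψ'' x)
      = f x * C.pairing x (C.bracket ψ ψ' x) (ψ'' x)
        - C.act x (ψ' x) f * C.pairing x (ψ x) (ψ'' x)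
        + C.pairing x (ψ x) (ψ' x) * C.act x (ψ'' x) f := by
  have h1 := C.bracket_add_swap (fsmul f ψ) ψ' ψ'' x
  have h2 := C.bracket_add_swap ψ ψ' ψ'' x
  have hfun : (fun z => C.pairing z (fsmul f ψ z) (ψ' z)) = fun z =>
      f z * C.pairing z (ψ z) (ψ' z) := by
    funext z; simp
  rw [hfun, C.act_mul _ (f.contMDiff.mdifferentiable (by simp) x)
    (C.pairing_mdifferentiableAt ψ ψ' x), bracket_fsmul_right] at h1
  simp only [sec_add_apply, fsmul_apply, map_add, map_smul, LinearMap.add_apply,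
    LinearMap.smul_apply, smul_eq_mul, actFun_apply] at h1
  rw [← h2] at h1
  linarith

/-- The anchor is compatible with brackets, in the weak form given by the Jacobi identity. -/
lemma anchor_bracket (f : C^∞⟮I, M; ℝ⟯) (ψ ψ' φ : Sec I F E) (x : M) :
    (C.act x (ψ x) (C.actFun ψ' f) - C.act x (ψ' x) (C.actFun ψ f)
      - C.act x (C.bracket ψ ψ' x) f) • φ x = 0 := by
  -- Subtracting `f` times the Jacobi identity for `φ` from the one for `f φ`, the mixed
  -- first-derivative terms cancel and only the commutator defect of the anchor, applied to `f` and
  -- multiplying `φ`, survives.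
  have h := congrArg (fun s : Sec I F E => s x) (C.jacobi ψ ψ' (fsmul f φ))
  have h' := congrArg (fun s : Sec I F E => s x) (C.jacobi ψ ψ' φ)
  simp only [bracket_fsmul_right, map_add, sec_add_apply, fsmul_apply, actFun_apply] at h h'
  rw [h'] at h
  simp only [sub_smul, smul_add] at h ⊢
  have h3 := sub_eq_zero.2 h
  rw [← h3]
  abel

end CourantAlgebroid

end Anchor


/-! ### Tensoriality and symmetries of the generalised curvature. -/

section Curvature

variable {n : ℕ} {H : Type*} [TopologicalSpace H]
  {I : ModelWithCorners ℝ (EuclideanSpace ℝ (Fin n)) H}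
  {M : Type*} [TopologicalSpace M] [ChartedSpace H M] [IsManifold I ∞ M]
  {F : Type*} [NormedAddCommGroup F] [NormedSpace ℝ F]
  {E : M → Type*} [TopologicalSpace (TotalSpace F E)] [∀ x, AddCommGroup (E x)]
  [∀ x, Module ℝ (E x)] [∀ x, TopologicalSpace (E x)] [FiberBundle F E] [VectorBundle ℝ F E]

variable [FiniteDimensional ℝ F] [ContMDiffVectorBundle ∞ F E I] [T2Space M] [SigmaCompactSpace M]
  {C : CourantAlgebroid I F E}

/-- The vector metrically dual to the differential of `f`. -/
def CourantAlgebroid.grad (C : CourantAlgebroid I F E) (x : M) (f : M → ℝ) : E x :=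
  haveI : FiniteDimensional ℝ (E x) := VectorBundle.finiteDimensional ℝ F E x
  ((C.pairing x).toDual (C.pairing_nondegenerate x)).symm (C.actForm x f)

lemma CourantAlgebroid.pairing_grad (C : CourantAlgebroid I F E) (x : M) (f : M → ℝ) (v : E x) :
    C.pairing x (C.grad x f) v = C.act x v f := by
  have : FiniteDimensional ℝ (E x) := VectorBundle.finiteDimensional ℝ F E x
  exact LinearMap.BilinForm.apply_toDual_symm_apply _ _

lemma CourantAlgebroid.bracket_fsmul_left_apply (C : CourantAlgebroid I F E) (f : C^∞⟮I, M; ℝ⟯)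
    (ψ ψ' : Sec I F E) (x : M) :
    C.bracket (fsmul f ψ) ψ' x = f x • C.bracket ψ ψ' x - C.act x (ψ' x) f • ψ x
      + C.pairing x (ψ x) (ψ' x) • C.grad x f := by
  refine C.ext_pairing fun w => ?_
  obtain ⟨s, rfl⟩ := evalAt_surjective I F x w
  show C.pairing x _ (s x) = C.pairing x _ (s x)
  rw [C.bracket_fsmul_left]
  simp only [map_add, map_sub, map_smul, LinearMap.add_apply, LinearMap.sub_apply,
    LinearMap.smul_apply, smul_eq_mul, C.pairing_grad]

lemma CourantAlgebroid.bracket_add_swap_apply (C : CourantAlgebroid I F E)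
    (ψ ψ' : Sec I F E) (x : M) :
    C.bracket ψ ψ' x + C.bracket ψ' ψ x
      = C.grad x (fun z => C.pairing z (ψ z) (ψ' z)) := by
  refine C.ext_pairing fun w => ?_
  obtain ⟨s, rfl⟩ := evalAt_surjective I F x w
  show C.pairing x _ (s x) = C.pairing x _ (s x)
  rw [C.pairing_grad, ← C.bracket_add_swap, map_add, LinearMap.add_apply]

namespace Connection

variable (D : Connection C)

lemma act_pairing (ψ ψ' ψ'' : Sec I F E) (x : M) :
    C.act x (ψ x) (fun z => C.pairing z (ψ' z) (ψ'' z))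
      = C.pairing x (D.cov ψ ψ' x) (ψ'' x) + C.pairing x (ψ' x) (D.cov ψ ψ'' x) :=
  D.cov_pairing ψ ψ' ψ'' x

lemma cov_fsmul (f : C^∞⟮I, M; ℝ⟯) (ψ ψ' : Sec I F E) :
    D.cov ψ (fsmul f ψ') = fsmul f (D.cov ψ ψ') + fsmul (C.actFun ψ f) ψ' := by
  ext x
  exact D.cov_fsmul_right f ψ ψ' x

lemma cov_congr_left {ψ ψ' : Sec I F E} (φ : Sec I F E) {x : M} (h : ψ x = ψ' x) :
    D.cov ψ φ x = D.cov ψ' φ x :=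
  tensorial_congr (A := fun ψ => D.cov ψ φ x)
    (fun ψ ψ' => by rw [map_add, LinearMap.add_apply, sec_add_apply])
    (fun f ψ => by rw [D.cov_fsmul_left, fsmul_apply]) h

lemma covAt_apply (ψ φ : Sec I F E) (x : M) : D.covAt φ x (ψ x) = D.cov ψ φ x :=
  D.cov_congr_left φ (ext_apply x (ψ x))

lemma covAt_fsmul (f : C^∞⟮I, M; ℝ⟯) (φ : Sec I F E) (x : M) (v : E x) :
    D.covAt (fsmul f φ) x v = f x • D.covAt φ x v + C.act x v f • φ x := by
  obtain ⟨s, rfl⟩ := evalAt_surjective I F x v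
  show D.covAt (fsmul f φ) x (s x) = f x • D.covAt φ x (s x) + C.act x (s x) f • φ x
  rw [covAt_apply, covAt_apply, cov_fsmul]
  rfl

lemma covAt_add (φ φ' : Sec I F E) (x : M) (v : E x) :
    D.covAt (φ + φ') x v = D.covAt φ x v + D.covAt φ' x v := by
  obtain ⟨s, rfl⟩ := evalAt_surjective I F x v
  show D.covAt (φ + φ') x (s x) = D.covAt φ x (s x) + D.covAt φ' x (s x)
  rw [covAt_apply, covAt_apply, covAt_apply, map_add]
  rfl

lemma covAt_pairing (φ φ' : Sec I F E) (x : M) (v : E x) :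
    C.pairing x (D.covAt φ x v) (φ' x) + C.pairing x (φ x) (D.covAt φ' x v)
      = C.act x v (fun z => C.pairing z (φ z) (φ' z)) := by
  obtain ⟨s, rfl⟩ := evalAt_surjective I F x v
  show C.pairing x (D.covAt φ x (s x)) (φ' x) + C.pairing x (φ x) (D.covAt φ' x (s x))
      = C.act x (s x) (fun z => C.pairing z (φ z) (φ' z))
  rw [covAt_apply, covAt_apply, act_pairing]

lemma pairing_kVec (ψ ψ' : Sec I F E) (x : M) (v : E x) :
    C.pairing x (D.kVec ψ ψ' x) v = C.pairing x (D.covAt ψ x v) (ψ' x) := by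
  have : FiniteDimensional ℝ (E x) := VectorBundle.finiteDimensional ℝ F E x
  exact LinearMap.BilinForm.apply_toDual_symm_apply _ _

/-- The gradient term is the failure of `K` to be tensorial; it is what compensates the failure of
`R⁰` in `curv_fsmul_second`. -/
lemma kVec_fsmul_left (f : C^∞⟮I, M; ℝ⟯) (ψ ψ' : Sec I F E) (x : M) :
    D.kVec (fsmul f ψ) ψ' x
      = f x • D.kVec ψ ψ' x + C.pairing x (ψ x) (ψ' x) • C.grad x f := by
  refine C.ext_pairing fun w => ?_
  rw [pairing_kVec, covAt_fsmul]
  simp only [map_add, map_smul, LinearMap.add_apply, LinearMap.smul_apply, smul_eq_mul,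
    pairing_kVec, C.pairing_grad]
  ring

lemma kVec_fsmul_right (f : C^∞⟮I, M; ℝ⟯) (ψ ψ' : Sec I F E) (x : M) :
    D.kVec ψ (fsmul f ψ') x = f x • D.kVec ψ ψ' x := by
  refine C.ext_pairing fun w => ?_
  rw [pairing_kVec]
  simp only [fsmul_apply, map_smul, LinearMap.smul_apply, smul_eq_mul, pairing_kVec]

lemma kVec_add_left (ψ₁ ψ₂ ψ' : Sec I F E) (x : M) :
    D.kVec (ψ₁ + ψ₂) ψ' x = D.kVec ψ₁ ψ' x + D.kVec ψ₂ ψ' x := by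
  refine C.ext_pairing fun w => ?_
  rw [pairing_kVec, covAt_add]
  simp only [map_add, LinearMap.add_apply, pairing_kVec]

lemma kVec_add_right (ψ ψ₁ ψ₂ : Sec I F E) (x : M) :
    D.kVec ψ (ψ₁ + ψ₂) x = D.kVec ψ ψ₁ x + D.kVec ψ ψ₂ x := by
  refine C.ext_pairing fun w => ?_
  rw [pairing_kVec]
  simp only [sec_add_apply, map_add, LinearMap.add_apply, pairing_kVec]

lemma kVec_add_swap (ψ ψ' : Sec I F E) (x : M) :
    D.kVec ψ ψ' x + D.kVec ψ' ψ x = C.grad x (fun z => C.pairing z (ψ z) (ψ' z)) := by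
  refine C.ext_pairing fun w => ?_
  rw [map_add, LinearMap.add_apply, pairing_kVec, pairing_kVec, C.pairing_grad, ← D.covAt_pairing,
    C.pairing_symm x (ψ x)]

/-- Built into the definition. It reduces linearity in the third and fourth arguments to linearity
in the second and first. -/
lemma curv_swap (φ' φ ψ ψ' : Sec I F E) (x : M) :
    D.curv φ' φ ψ ψ' x = D.curv ψ' ψ φ φ' x := by
  rw [curv, curv, C.pairing_symm x (D.kVec ψ ψ' x)]
  ring

lemma curv_add_first (φ₁ φ₂ φ ψ ψ' : Sec I F E) (x : M) :
    D.curv (φ₁ + φ₂) φ ψ ψ' x = D.curv φ₁ φ ψ ψ' x + D.curv φ₂ φ ψ ψ' x := by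
  simp only [curv, curv₀, map_add, LinearMap.add_apply, sec_add_apply, sec_sub_apply, map_sub,
    LinearMap.sub_apply, kVec_add_right]
  ring

lemma curv_add_second (φ' φ₁ φ₂ ψ ψ' : Sec I F E) (x : M) :
    D.curv φ' (φ₁ + φ₂) ψ ψ' x = D.curv φ' φ₁ ψ ψ' x + D.curv φ' φ₂ ψ ψ' x := by
  simp only [curv, curv₀, map_add, LinearMap.add_apply, sec_add_apply, sec_sub_apply, map_sub,
    LinearMap.sub_apply, kVec_add_left]
  ring

lemma curv_fsmul_first (f : C^∞⟮I, M; ℝ⟯) (φ' φ ψ ψ' : Sec I F E) (x : M) :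
    D.curv (fsmul f φ') φ ψ ψ' x = f x * D.curv φ' φ ψ ψ' x := by
  simp only [curv, curv₀, C.bracket_fsmul_right, D.cov_fsmul_left, D.cov_fsmul, map_add,
    LinearMap.add_apply, sec_add_apply, sec_sub_apply, fsmul_apply, map_sub, map_smul,
    LinearMap.sub_apply, LinearMap.smul_apply, smul_eq_mul, kVec_fsmul_right,
    CourantAlgebroid.actFun_apply]
  ring

/-- The first `R⁰` is function-linear here by `anchor_bracket`. In the second one the bracket of `f
φ` with `φ'` contributes `⟨φ, φ'⟩` times the gradient of `f`, and the `K` term contributes the same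
with the opposite sign. -/
lemma curv_fsmul_second (f : C^∞⟮I, M; ℝ⟯) (φ' φ ψ ψ' : Sec I F E) (x : M) :
    D.curv φ' (fsmul f φ) ψ ψ' x = f x * D.curv φ' φ ψ ψ' x := by
  have h1 : D.curv₀ φ' (fsmul f φ) ψ ψ' x = f x * D.curv₀ φ' φ ψ ψ' x := by
    have h := congrArg (fun v => C.pairing x v (φ' x)) (C.anchor_bracket f ψ ψ' φ x)
    simp only [map_smul, LinearMap.smul_apply, smul_eq_mul, map_zero, LinearMap.zero_apply] at h
    simp only [curv₀, D.cov_fsmul, map_add,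
      LinearMap.add_apply, sec_add_apply, sec_sub_apply, fsmul_apply, map_sub, map_smul,
      LinearMap.sub_apply, LinearMap.smul_apply, smul_eq_mul, CourantAlgebroid.actFun_apply]
    linear_combination h
  have h2 : D.curv₀ ψ' ψ (fsmul f φ) φ' x = f x * D.curv₀ ψ' ψ φ φ' x
      - C.pairing x (φ x) (φ' x) * C.pairing x (D.covAt ψ x (C.grad x f)) (ψ' x) := by
    simp only [curv₀, sec_sub_apply, ← D.covAt_apply (C.bracket (fsmul f φ) φ'),
      C.bracket_fsmul_left_apply, map_add, map_sub, map_smul, D.covAt_apply]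
    simp only [D.cov_fsmul_left, D.cov_fsmul, map_add, LinearMap.add_apply, sec_add_apply,
      fsmul_apply, map_smul, LinearMap.sub_apply, LinearMap.smul_apply, smul_eq_mul,
      CourantAlgebroid.actFun_apply]
    ring
  rw [curv, curv, h1, h2, kVec_fsmul_left]
  simp only [map_add, map_smul, smul_eq_mul, pairing_kVec]
  ring

lemma curv_fsmul_third (f : C^∞⟮I, M; ℝ⟯) (φ' φ ψ ψ' : Sec I F E) (x : M) :
    D.curv φ' φ (fsmul f ψ) ψ' x = f x * D.curv φ' φ ψ ψ' x := by
  rw [curv_swap, curv_fsmul_second, curv_swap]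

lemma curv_fsmul_fourth (f : C^∞⟮I, M; ℝ⟯) (φ' φ ψ ψ' : Sec I F E) (x : M) :
    D.curv φ' φ ψ (fsmul f ψ') x = f x * D.curv φ' φ ψ ψ' x := by
  rw [curv_swap, curv_fsmul_first, curv_swap]

lemma curv_add_third (φ' φ ψ₁ ψ₂ ψ' : Sec I F E) (x : M) :
    D.curv φ' φ (ψ₁ + ψ₂) ψ' x = D.curv φ' φ ψ₁ ψ' x + D.curv φ' φ ψ₂ ψ' x := by
  rw [curv_swap, curv_add_second, curv_swap, D.curv_swap φ' φ ψ₂]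

lemma curv_add_fourth (φ' φ ψ ψ₁ ψ₂ : Sec I F E) (x : M) :
    D.curv φ' φ ψ (ψ₁ + ψ₂) x = D.curv φ' φ ψ ψ₁ x + D.curv φ' φ ψ ψ₂ x := by
  rw [curv_swap, curv_add_first, curv_swap, D.curv_swap φ' φ ψ ψ₂]

lemma curv_congr {φ₁' φ₂' φ₁ φ₂ ψ₁ ψ₂ ψ₁' ψ₂' : Sec I F E} {x : M} (h1 : φ₁' x = φ₂' x)
    (h2 : φ₁ x = φ₂ x) (h3 : ψ₁ x = ψ₂ x) (h4 : ψ₁' x = ψ₂' x) :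
    D.curv φ₁' φ₁ ψ₁ ψ₁' x = D.curv φ₂' φ₂ ψ₂ ψ₂' x := by
  rw [tensorial_congr (A := fun s => D.curv s φ₁ ψ₁ ψ₁' x) (fun s t => D.curv_add_first s t _ _ _ x)
      (fun f s => D.curv_fsmul_first f s _ _ _ x) h1,
    tensorial_congr (A := fun s => D.curv φ₂' s ψ₁ ψ₁' x) (fun s t => D.curv_add_second _ s t _ _ x)
      (fun f s => D.curv_fsmul_second f _ s _ _ x) h2,
    tensorial_congr (A := fun s => D.curv φ₂' φ₂ s ψ₁' x) (fun s t => D.curv_add_third _ _ s t _ x)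
      (fun f s => D.curv_fsmul_third f _ _ s _ x) h3,
    tensorial_congr (A := fun s => D.curv φ₂' φ₂ ψ₂ s x) (fun s t => D.curv_add_fourth _ _ _ s t x)
      (fun f s => D.curv_fsmul_fourth f _ _ _ s x) h4]

/-- For the first `R⁰` this is metric compatibility applied twice to `⟨φ, φ'⟩`, together with
`anchor_bracket`. For the second, the symmetric part of the bracket is the gradient of `⟨φ, φ'⟩`,
which is also the symmetric part of `K`; the two contributions cancel. -/
lemma curv_antisymm (φ' φ ψ ψ' : Sec I F E) (x : M) :
    D.curv φ' φ ψ ψ' x = - D.curv φ φ' ψ ψ' x := by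
  have h1 : D.curv₀ φ' φ ψ ψ' x + D.curv₀ φ φ' ψ ψ' x = 0 := by
    -- A nonzero vector is needed to extract a scalar identity from `anchor_bracket`; over a zero
    -- fibre every pairing vanishes.
    by_cases hne : ∃ v : E x, v ≠ 0
    · obtain ⟨v, hv⟩ := hne
      obtain ⟨s, rfl⟩ := evalAt_surjective I F x v
      have h := (smul_eq_zero.1 (C.anchor_bracket (C.pair φ φ') ψ ψ' s x)).resolve_right hv
      have e : ∀ ψ : Sec I F E, (⇑(C.actFun ψ (C.pair φ φ')) : M → ℝ) = fun z =>
          C.pairing z (D.cov ψ φ z) (φ' z) + C.pairing z (φ z) (D.cov ψ φ' z) := by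
        intro ψ
        funext z
        exact D.act_pairing ψ φ φ' z
      have d := fun (s t : Sec I F E) => C.pairing_mdifferentiableAt s t x
      have e2 : C.act x (C.bracket ψ ψ' x) (C.pair φ φ') = _ :=
        D.act_pairing (C.bracket ψ ψ') φ φ' x
      rw [e, e, C.act_add _ (d _ _) (d _ _), C.act_add _ (d _ _) (d _ _), e2, D.act_pairing,
        D.act_pairing, D.act_pairing, D.act_pairing] at h
      simp only [curv₀, sec_sub_apply, map_sub, LinearMap.sub_apply]
      rw [C.pairing_symm x (D.cov ψ (D.cov ψ' φ') x), C.pairing_symm x (D.cov ψ' (D.cov ψ φ') x),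
        C.pairing_symm x (D.cov (C.bracket ψ ψ') φ' x)]
      linear_combination h
    · push Not at hne
      simp [curv₀, hne]
  have h2 : D.curv₀ ψ' ψ φ φ' x + D.curv₀ ψ' ψ φ' φ x
      = - C.pairing x (D.covAt ψ x (C.grad x (fun z => C.pairing z (φ z) (φ' z)))) (ψ' x) := by
    rw [← C.bracket_add_swap_apply]
    simp only [curv₀, sec_sub_apply, map_add, map_sub, LinearMap.sub_apply, LinearMap.add_apply,
      D.covAt_apply]
    ring
  have h3 : C.pairing x (D.kVec ψ ψ' x) (D.kVec φ φ' x)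
      + C.pairing x (D.kVec ψ ψ' x) (D.kVec φ' φ x)
      = C.pairing x (D.covAt ψ x (C.grad x (fun z => C.pairing z (φ z) (φ' z)))) (ψ' x) := by
    rw [← map_add, kVec_add_swap, pairing_kVec]
  rw [curv, curv]
  linear_combination (1 / 2) * h1 + (1 / 2) * h2 + (1 / 2) * h3

/-- This pair symmetry makes the Ricci tensor symmetric. -/
lemma curv_reverse (φ' φ ψ ψ' : Sec I F E) (x : M) :
    D.curv φ' φ ψ ψ' x = D.curv ψ ψ' φ' φ x := by
  rw [curv_swap, curv_antisymm, curv_swap, curv_antisymm, curv_swap, curv_swap, neg_neg, curv_swap]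

end Connection
end Curvature


/-! ### Traces in orthonormal bases. -/

section LinearTrace

variable {W : Type*} [AddCommGroup W] [Module ℝ W] [FiniteDimensional ℝ W]
  {g : LinearMap.BilinForm ℝ W} {m : ℕ} {η : Fin m → ℝ} {b : Fin m → W}

lemma IsOrthoFrame.trace_eq (h : IsOrthoFrame g η b) (hm : m = Module.finrank ℝ W)
    (L : W →ₗ[ℝ] W) : LinearMap.trace ℝ W L = ∑ i, η i * g (L (b i)) (b i) := by
  have hcard : Fintype.card (Fin m) = Module.finrank ℝ W := by simpa using hm
  let B : Module.Basis (Fin m) ℝ W := Module.Basis.mk h.linearIndependent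
    (h.linearIndependent.span_eq_top_of_card_eq_finrank' hcard).ge
  have hB : ∀ i, B i = b i := fun i => by simp [B]
  rw [LinearMap.trace_eq_matrix_trace ℝ B, Matrix.trace]
  refine Finset.sum_congr rfl fun i _ => ?_
  rw [Matrix.diag_apply, LinearMap.toMatrix_apply, hB]
  have h1 : ∑ j, (η j * g (L (b i)) (b j)) • B j = L (b i) := by
    simp only [hB]
    exact h.sum_coord hm _
  conv_lhs => rw [← h1]
  simp [Finsupp.single_apply]

lemma IsOrthoFrame.metricTrace_eq (h : IsOrthoFrame g η b) (hm : m = Module.finrank ℝ W)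
    (hg : g.Nondegenerate) (hsymm : ∀ u v, g u v = g v u) (A : W →ₗ[ℝ] W →ₗ[ℝ] ℝ) :
    metricTrace g (fun u v => A u v) = ∑ i, η i * A (b i) (b i) := by
  rw [metricTrace_eq_sum hg hsymm (b := b) (b' := fun i => η i • b i)
    (fun v => by simpa using h.sum_coord hm v)]
  simp

lemma IsOrthoFrame.pairing_eq (h : IsOrthoFrame g η b) (hm : m = Module.finrank ℝ W) (u v : W) :
    g u v = ∑ i, η i * g u (b i) * g v (b i) := by
  conv_lhs => rw [← h.sum_coord hm v]
  simp only [map_sum, map_smul, smul_eq_mul]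
  exact Finset.sum_congr rfl fun i _ => by ring

end LinearTrace

/-! ### Ricci and scalar curvature in frames, and their continuity. -/

section Scalar

variable {n : ℕ} {H : Type*} [TopologicalSpace H]
  {I : ModelWithCorners ℝ (EuclideanSpace ℝ (Fin n)) H}
  {M : Type*} [TopologicalSpace M] [ChartedSpace H M] [IsManifold I ∞ M]
  {F : Type*} [NormedAddCommGroup F] [NormedSpace ℝ F]
  {E : M → Type*} [TopologicalSpace (TotalSpace F E)] [∀ x, AddCommGroup (E x)]
  [∀ x, Module ℝ (E x)] [∀ x, TopologicalSpace (E x)] [FiberBundle F E] [VectorBundle ℝ F E]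

variable [FiniteDimensional ℝ F] {C : CourantAlgebroid I F E}

namespace GeneralizedMetric

variable (V : GeneralizedMetric C)

lemma projPlus_of_mem_plus {x : M} {v : E x} (hv : v ∈ V.plus x) : V.projPlus x v = v :=
  Submodule.projection_apply_of_mem_left (V.isCompl x) hv

lemma projPlus_of_mem_minus {x : M} {v : E x} (hv : v ∈ V.minus x) : V.projPlus x v = 0 :=
  (Submodule.projection_apply_eq_zero_iff (V.isCompl x)).2 hv

lemma projPlus_mem (x : M) (v : E x) : V.projPlus x v ∈ V.plus x :=
  Submodule.projection_apply_mem (V.isCompl x) v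

lemma sub_projPlus_mem (x : M) (v : E x) : v - V.projPlus x v ∈ V.minus x :=
  Submodule.sub_projection_mem (V.isCompl x) v

/-- The involution equal to `±1` on `V₊` and `V₋`. -/
def invol (x : M) : E x →ₗ[ℝ] E x := (2 : ℝ) • V.projPlus x - LinearMap.id

lemma invol_apply (x : M) (v : E x) : V.invol x v = (2 : ℝ) • V.projPlus x v - v := rfl

lemma invol_of_mem_plus {x : M} {v : E x} (hv : v ∈ V.plus x) : V.invol x v = v := by
  rw [invol_apply, V.projPlus_of_mem_plus hv, two_smul, add_sub_cancel_right]

lemma invol_of_mem_minus {x : M} {v : E x} (hv : v ∈ V.minus x) : V.invol x v = -v := by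
  rw [invol_apply, V.projPlus_of_mem_minus hv, smul_zero, zero_sub]

lemma invol_invol (x : M) (v : E x) : V.invol x (V.invol x v) = v := by
  rw [V.invol_apply x v, map_sub, map_smul, V.invol_of_mem_plus (V.projPlus_mem x v),
    V.invol_apply x v]
  abel

/-- The cross terms vanish because `V₊` and `V₋` are orthogonal. All dependence on the generalised
metric is thereby moved into an involution that is self-adjoint for the pairing. -/
lemma G_eq (x : M) (u v : E x) : V.G x u v = C.pairing x (V.invol x u) v := by
  have h1 := V.pairing_plus_minus (V.projPlus_mem x u) (V.sub_projPlus_mem x v)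
  have h2 := V.pairing_minus_plus (V.sub_projPlus_mem x u) (V.projPlus_mem x v)
  simp only [map_sub, LinearMap.sub_apply] at h1 h2
  simp only [G, invol_apply, LinearMap.sub_apply, LinearMap.BilinForm.comp_apply,
    LinearMap.id_apply, map_sub, map_smul, LinearMap.smul_apply, smul_eq_mul]
  linarith

lemma pairing_invol (x : M) (u v : E x) :
    C.pairing x (V.invol x u) v = C.pairing x u (V.invol x v) := by
  have h1 := V.pairing_plus_minus (V.projPlus_mem x u) (V.sub_projPlus_mem x v)
  have h2 := V.pairing_minus_plus (V.sub_projPlus_mem x u) (V.projPlus_mem x v)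
  simp only [map_sub, LinearMap.sub_apply] at h1 h2
  simp only [invol_apply, map_sub, map_smul, LinearMap.smul_apply, smul_eq_mul,
    LinearMap.sub_apply]
  linarith

lemma G_symm (x : M) (u v : E x) : V.G x u v = V.G x v u := by
  rw [G_eq, G_eq, pairing_invol, C.pairing_symm]

lemma G_nondegenerate (x : M) : (V.G x).Nondegenerate := by
  have key : ∀ u, (∀ v, V.G x u v = 0) → u = 0 := by
    intro u hu
    have h : V.invol x u = 0 := C.ext_pairing fun w => by
      rw [← V.G_eq, hu, map_zero, LinearMap.zero_apply]
    rw [← V.invol_invol x u, h, map_zero]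
  exact ⟨key, fun u hu => key u fun v => by rw [V.G_symm]; exact hu v⟩

/-- The basis dual to `b i` for `G` is `η i • V.invol x (b i)`. The basis need not be adapted to
`V`, which later allows a varied metric to be traced in a fixed frame. -/
lemma metricTrace_G {x : M} {m : ℕ} {η : Fin m → ℝ} {b : Fin m → E x}
    (h : IsOrthoFrame (C.pairing x) η b) (hm : m = Module.finrank ℝ F)
    (A : E x →ₗ[ℝ] E x →ₗ[ℝ] ℝ) :
    haveI : FiniteDimensional ℝ (E x) := VectorBundle.finiteDimensional ℝ F E x
    metricTrace (V.G x) (fun u v => A u v) = ∑ i, η i * A (b i) (V.invol x (b i)) := by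
  have : FiniteDimensional ℝ (E x) := VectorBundle.finiteDimensional ℝ F E x
  rw [metricTrace_eq_sum (V.G_nondegenerate x) (V.G_symm x) (b := b)
    (b' := fun i => η i • V.invol x (b i)) (fun v => ?_)]
  · simp
  · simp only [map_smul, smul_eq_mul, G_eq, pairing_invol, invol_invol]
    exact h.sum_coord (hm.trans (finrank_fiber x).symm) v

end GeneralizedMetric

variable [ContMDiffVectorBundle ∞ F E I] [T2Space M] [SigmaCompactSpace M]

/-- A constant function. -/
def constFun (c : ℝ) : C^∞⟮I, M; ℝ⟯ := ⟨fun _ => c, contMDiff_const⟩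

namespace Connection

variable (D : Connection C)

lemma curv_smul_first (c : ℝ) (φ' φ ψ ψ' : Sec I F E) (x : M) :
    D.curv (c • φ') φ ψ ψ' x = c * D.curv φ' φ ψ ψ' x := 
  D.curv_fsmul_first (constFun c) φ' φ ψ ψ' x

lemma curv_smul_second (c : ℝ) (φ' φ ψ ψ' : Sec I F E) (x : M) :
    D.curv φ' (c • φ) ψ ψ' x = c * D.curv φ' φ ψ ψ' x := 
  D.curv_fsmul_second (constFun c) φ' φ ψ ψ' x

lemma curv_smul_third (c : ℝ) (φ' φ ψ ψ' : Sec I F E) (x : M) :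
    D.curv φ' φ (c • ψ) ψ' x = c * D.curv φ' φ ψ ψ' x := 
  D.curv_fsmul_third (constFun c) φ' φ ψ ψ' x

lemma curv_smul_fourth (c : ℝ) (φ' φ ψ ψ' : Sec I F E) (x : M) :
    D.curv φ' φ ψ (c • ψ') x = c * D.curv φ' φ ψ ψ' x := 
  D.curv_fsmul_fourth (constFun c) φ' φ ψ ψ' x

/-- The curvature as a bilinear form in its first and third arguments. -/
def curvForm (x : M) (u v : E x) : E x →ₗ[ℝ] E x →ₗ[ℝ] ℝ :=
  LinearMap.mk₂ ℝ
    (fun a b => D.curv (ext I F x a) (ext I F x u) (ext I F x b) (ext I F x v) x)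
    (fun _ _ _ => by rw [map_add, curv_add_first])
    (fun _ _ _ => by rw [map_smul, curv_smul_first, smul_eq_mul])
    (fun _ _ _ => by rw [map_add, curv_add_third])
    (fun _ _ _ => by rw [map_smul, curv_smul_third, smul_eq_mul])

/-- The Ricci tensor as a bilinear form. -/
def ricForm (x : M) : E x →ₗ[ℝ] E x →ₗ[ℝ] ℝ :=
  haveI : FiniteDimensional ℝ (E x) := VectorBundle.finiteDimensional ℝ F E x
  LinearMap.mk₂ ℝ (D.ric x)
    (fun _ _ _ => by
      simp only [ric, metricTrace, dif_pos (C.pairing_nondegenerate x), map_add, curv_add_second,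
        Finset.sum_add_distrib])
    (fun _ _ _ => by
      simp only [ric, metricTrace, dif_pos (C.pairing_nondegenerate x), map_smul, curv_smul_second,
        Finset.mul_sum, smul_eq_mul])
    (fun _ _ _ => by
      simp only [ric, metricTrace, dif_pos (C.pairing_nondegenerate x), map_add, curv_add_fourth,
        Finset.sum_add_distrib])
    (fun _ _ _ => by
      simp only [ric, metricTrace, dif_pos (C.pairing_nondegenerate x), map_smul, curv_smul_fourth,
        Finset.mul_sum, smul_eq_mul])

lemma ricForm_apply (x : M) (u v : E x) : D.ricForm x u v = D.ric x u v := rfl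

lemma ric_eq_sum {x : M} {m : ℕ} {η : Fin m → ℝ} {e : Fin m → Sec I F E}
    (h : IsOrthoFrame (C.pairing x) η (fun i => e i x)) (hm : m = Module.finrank ℝ F)
    (φ ψ : Sec I F E) :
    D.ric x (φ x) (ψ x) = ∑ i, η i * D.curv (e i) φ (e i) ψ x := by
  have : FiniteDimensional ℝ (E x) := VectorBundle.finiteDimensional ℝ F E x
  have h1 := h.metricTrace_eq (hm.trans (GeneralizedMetric.finrank_fiber x).symm)
    (C.pairing_nondegenerate x) (C.pairing_symm x) (D.curvForm x (φ x) (ψ x))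
  refine (h1 : D.ric x (φ x) (ψ x) = _).trans (Finset.sum_congr rfl fun i _ => ?_)
  congr 1
  exact D.curv_congr (ext_apply _ _) (ext_apply _ _) (ext_apply _ _) (ext_apply _ _)

lemma ric_symm (V : GeneralizedMetric C) (x : M) (u v : E x) : D.ric x u v = D.ric x v u := by
  obtain ⟨f⟩ := nonempty_adaptedFrame V x
  obtain ⟨s, rfl⟩ := evalAt_surjective I F x u
  obtain ⟨t, rfl⟩ := evalAt_surjective I F x v
  show D.ric x (s x) (t x) = D.ric x (t x) (s x)
  rw [D.ric_eq_sum (f.ortho x f.mem_dom) f.card_eq, D.ric_eq_sum (f.ortho x f.mem_dom) f.card_eq]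
  exact Finset.sum_congr rfl fun i _ => by rw [D.curv_reverse]

lemma scalar_G_eq (V : GeneralizedMetric C) {x : M} {m : ℕ} {η : Fin m → ℝ} {b : Fin m → E x}
    (h : IsOrthoFrame (C.pairing x) η b) (hm : m = Module.finrank ℝ F) :
    D.scalar V.G x = ∑ i, η i * D.ric x (b i) (V.invol x (b i)) :=
  V.metricTrace_G h hm (D.ricForm x)

lemma scalar_pairing_eq {x : M} {m : ℕ} {η : Fin m → ℝ} {e : Fin m → Sec I F E}
    (h : IsOrthoFrame (C.pairing x) η (fun i => e i x)) (hm : m = Module.finrank ℝ F) :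
    D.scalar C.pairing x = ∑ i, η i * D.ric x (e i x) (e i x) := by
  have : FiniteDimensional ℝ (E x) := VectorBundle.finiteDimensional ℝ F E x
  exact h.metricTrace_eq (hm.trans (GeneralizedMetric.finrank_fiber x).symm)
    (C.pairing_nondegenerate x) (C.pairing_symm x) (D.ricForm x)

lemma div_eq_sum {x : M} {m : ℕ} {η : Fin m → ℝ} {e : Fin m → Sec I F E}
    (h : IsOrthoFrame (C.pairing x) η (fun i => e i x)) (hm : m = Module.finrank ℝ F)
    (ψ : Sec I F E) :
    D.div ψ x = ∑ i, η i * C.pairing x (D.cov (e i) ψ x) (e i x) := by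
  have : FiniteDimensional ℝ (E x) := VectorBundle.finiteDimensional ℝ F E x
  rw [div, h.trace_eq (hm.trans (GeneralizedMetric.finrank_fiber x).symm)]
  exact Finset.sum_congr rfl fun i _ => by rw [D.covAt_apply (e i)]

lemma pairing_kVec_kVec {x : M} {m : ℕ} {η : Fin m → ℝ} {e : Fin m → Sec I F E}
    (h : IsOrthoFrame (C.pairing x) η (fun i => e i x)) (hm : m = Module.finrank ℝ F)
    (ψ ψ' φ φ' : Sec I F E) :
    C.pairing x (D.kVec ψ ψ' x) (D.kVec φ φ' x)
      = ∑ i, η i * C.pairing x (D.cov (e i) ψ x) (ψ' x)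
          * C.pairing x (D.cov (e i) φ x) (φ' x) := by
  have : FiniteDimensional ℝ (E x) := VectorBundle.finiteDimensional ℝ F E x
  rw [h.pairing_eq (hm.trans (GeneralizedMetric.finrank_fiber x).symm)]
  refine Finset.sum_congr rfl fun i _ => ?_
  rw [pairing_kVec, pairing_kVec, covAt_apply, covAt_apply]

end Connection

namespace AdaptedFrame

variable {V : GeneralizedMetric C} {x₀ : M} (f : AdaptedFrame V x₀)

lemma dom_mem_nhds : f.dom ∈ 𝓝 x₀ := f.isOpen_dom.mem_nhds f.mem_dom

lemma invol_apply {x : M} (hx : x ∈ f.dom) (i : Fin f.m) :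
    V.invol x (f.e i x) = f.η i • f.e i x := by
  rcases (f.ortho x hx).sign i with h | h
  · rw [V.invol_of_mem_plus (f.mem_plus x hx i h), h, one_smul]
  · rw [V.invol_of_mem_minus (f.mem_minus x hx i h), h, neg_one_smul]

end AdaptedFrame

namespace Connection

variable (D : Connection C)

/-- The vector `K` is defined pointwise by inverting the pairing; expanding `⟨K, K⟩` in a frame
turns it into pairings of smooth sections. -/
lemma continuousOn_curv {V : GeneralizedMetric C} {x₀ : M} (f : AdaptedFrame V x₀)
    (φ' φ ψ ψ' : Sec I F E) : ContinuousOn (D.curv φ' φ ψ ψ') f.dom := by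
  have h : ContinuousOn (fun x => (1 / 2) * (D.curv₀ φ' φ ψ ψ' x + D.curv₀ ψ' ψ φ φ' x
      + ∑ i, f.η i * C.pairing x (D.cov (f.e i) ψ x) (ψ' x)
          * C.pairing x (D.cov (f.e i) φ x) (φ' x))) f.dom := by
    refine Continuous.continuousOn (continuous_const.mul
      (((C.pairing_continuous _ _).add (C.pairing_continuous _ _)).add
        (continuous_finsetSum _ fun i _ => ?_)))
    exact (continuous_const.mul (C.pairing_continuous _ _)).mul (C.pairing_continuous _ _)
  refine h.congr fun x hx => ?_
  rw [curv, D.pairing_kVec_kVec (f.ortho x hx) f.card_eq]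

lemma continuous_ric (V : GeneralizedMetric C) (φ ψ : Sec I F E) :
    Continuous (fun x => D.ric x (φ x) (ψ x)) := by
  rw [continuous_iff_continuousAt]
  intro x₀
  obtain ⟨f⟩ := nonempty_adaptedFrame V x₀
  have h : ContinuousOn (fun x => ∑ i, f.η i * D.curv (f.e i) φ (f.e i) ψ x) f.dom :=
    continuousOn_finsetSum _ fun i _ => continuousOn_const.mul (D.continuousOn_curv f _ _ _ _)
  exact (h.congr fun x hx => D.ric_eq_sum (f.ortho x hx) f.card_eq φ ψ).continuousAt
    f.dom_mem_nhds

lemma scalar_G_eq_frame {V : GeneralizedMetric C} {x₀ : M} (f : AdaptedFrame V x₀) {x : M}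
    (hx : x ∈ f.dom) : D.scalar V.G x = ∑ i, D.ric x (f.e i x) (f.e i x) := by
  rw [D.scalar_G_eq V (f.ortho x hx) f.card_eq]
  refine Finset.sum_congr rfl fun i _ => ?_
  rw [f.invol_apply hx, ← ricForm_apply, map_smul, smul_eq_mul, ← mul_assoc,
    (f.ortho x hx).mul_self, one_mul, ricForm_apply]

lemma continuous_scalar_G (V : GeneralizedMetric C) : Continuous (D.scalar V.G) := by
  rw [continuous_iff_continuousAt]
  intro x₀
  obtain ⟨f⟩ := nonempty_adaptedFrame V x₀
  have h : ContinuousOn (fun x => ∑ i, D.ric x (f.e i x) (f.e i x)) f.dom :=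
    (continuous_finsetSum _ fun i _ => D.continuous_ric V _ _).continuousOn
  exact (h.congr fun x hx => D.scalar_G_eq_frame f hx).continuousAt f.dom_mem_nhds

lemma continuous_scalar_pairing (V : GeneralizedMetric C) : Continuous (D.scalar C.pairing) := by
  rw [continuous_iff_continuousAt]
  intro x₀
  obtain ⟨f⟩ := nonempty_adaptedFrame V x₀
  have h : ContinuousOn (fun x => ∑ i, f.η i * D.ric x (f.e i x) (f.e i x)) f.dom :=
    (continuous_finsetSum _ fun i _ =>
      continuous_const.mul (D.continuous_ric V _ _)).continuousOn
  exact (h.congr fun x hx => D.scalar_pairing_eq (f.ortho x hx) f.card_eq).continuousAt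
    f.dom_mem_nhds

end Connection

/-- Continuity is all that the variational argument uses: `R_E` is a fixed function, whichever
connection was chosen to compute it. -/
lemma continuous_canonicalScalar (V : GeneralizedMetric C) : Continuous (canonicalScalar C) := by
  unfold canonicalScalar
  split_ifs with h
  · exact Connection.continuous_scalar_pairing _ V
  · exact continuous_const

end Scalar


/-! ### Top-degree alternating forms, determinants and traces. -/

section Alternating

variable {ι W : Type*} [Fintype ι] [DecidableEq ι] [AddCommGroup W] [Module ℝ W]

lemma alternating_sum_smul (f : W [⋀^ι]→ₗ[ℝ] ℝ) (b : Module.Basis ι ℝ W) (a : Matrix ι ι ℝ) :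
    f (fun j => ∑ k, a j k • b k) = a.det * f b := by
  conv_lhs => rw [f.eq_smul_basis_det b]
  rw [AlternatingMap.smul_apply, Module.Basis.det_apply, smul_eq_mul, mul_comm,
    ← Matrix.det_transpose]
  congr 2
  ext j k
  simp [Module.Basis.toMatrix_apply, Finsupp.single_apply]

/-- In the `j`-th summand only the component of `L (b j)` along `b j` survives, the others producing
a repeated argument. -/
lemma alternating_sum_update (f : W [⋀^ι]→ₗ[ℝ] ℝ) (b : Module.Basis ι ℝ W) (L : W →ₗ[ℝ] W) :
    ∑ j, f (Function.update b j (L (b j))) = LinearMap.trace ℝ W L * f b := by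
  rw [LinearMap.trace_eq_matrix_trace ℝ b, Matrix.trace, Finset.sum_mul]
  refine Finset.sum_congr rfl fun j _ => ?_
  rw [Matrix.diag_apply, LinearMap.toMatrix_apply]
  conv_lhs => rw [← b.sum_repr (L (b j))]
  rw [AlternatingMap.map_update_sum, Finset.sum_eq_single j]
  · rw [AlternatingMap.map_update_smul, Function.update_eq_self, smul_eq_mul]
  · intro k _ hk
    rw [AlternatingMap.map_update_smul, f.map_update_self b hk.symm, smul_zero]
  · simp

lemma alternating_comp (f : W [⋀^ι]→ₗ[ℝ] ℝ) (b : Module.Basis ι ℝ W) (L : W →ₗ[ℝ] W) :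
    f (fun j => L (b j)) = LinearMap.det L * f b := by
  conv_lhs => rw [f.eq_smul_basis_det b]
  have h := b.det_comp L b
  rw [b.det_self, mul_one] at h
  rw [AlternatingMap.smul_apply, smul_eq_mul, mul_comm, ← h]
  rfl

end Alternating

/-! ### Coordinate fields and coefficients of volume forms. -/

section Coordinates

variable {n : ℕ} {H : Type*} [TopologicalSpace H]
  {I : ModelWithCorners ℝ (EuclideanSpace ℝ (Fin n)) H}
  {M : Type*} [TopologicalSpace M] [ChartedSpace H M] [IsManifold I ∞ M]

variable (n) in
/-- The standard basis of the model space. -/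
def stdBasis : Module.Basis (Fin n) ℝ (EuclideanSpace ℝ (Fin n)) :=
  (EuclideanSpace.basisFun (Fin n) ℝ).toBasis

lemma stdBasis_apply (j : Fin n) : stdBasis n j = EuclideanSpace.single j (1 : ℝ) := by
  simp [stdBasis]

variable (I) in
/-- The `j`-th component of tangent vectors in the chart at `c`. -/
def coordComp (c : M) (j : Fin n) (z : M) : TangentSpace I z →ₗ[ℝ] ℝ :=
  haveI : ContMDiffVectorBundle 1 (EuclideanSpace ℝ (Fin n)) (TangentSpace I : M → Type _) I :=
    ContMDiffVectorBundle.of_le (n := ∞) (by simp)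
  (trivializationAt (EuclideanSpace ℝ (Fin n)) (TangentSpace I) c).localFrameCoeff I (stdBasis n) j z

lemma mem_baseSet_iff {c z : M} :
    z ∈ (trivializationAt (EuclideanSpace ℝ (Fin n)) (TangentSpace I : M → Type _) c).baseSet
      ↔ z ∈ (chartAt H c).source := by
  rw [TangentBundle.trivializationAt_baseSet]

lemma coordField_eq_symmL {c z : M} (hz : z ∈ (chartAt H c).source) (j : Fin n) :
    coordField I c j z
      = (trivializationAt (EuclideanSpace ℝ (Fin n)) (TangentSpace I) c).symmL ℝ z
          (stdBasis n j) := by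
  rw [TangentBundle.symmL_trivializationAt hz, stdBasis_apply]
  rfl

/-- The basis of the tangent space given by the coordinate fields. -/
def coordBasis {c z : M} (hz : z ∈ (chartAt H c).source) :
    Module.Basis (Fin n) ℝ (TangentSpace I z) :=
  (trivializationAt (EuclideanSpace ℝ (Fin n)) (TangentSpace I) c).basisAt (stdBasis n)
    (mem_baseSet_iff.2 hz)

lemma coordBasis_apply {c z : M} (hz : z ∈ (chartAt H c).source) (j : Fin n) :
    coordBasis (I := I) hz j = coordField I c j z := by
  rw [coordField_eq_symmL hz, coordBasis, Trivialization.basisAt, Module.Basis.map_apply]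
  rw [Trivialization.linearEquivAt_symm_apply, Trivialization.symmL_apply _ (mem_baseSet_iff.2 hz)]

lemma coordField_eq_localFrame {c z : M} (hz : z ∈ (chartAt H c).source) (j : Fin n) :
    coordField I c j z
      = (trivializationAt (EuclideanSpace ℝ (Fin n)) (TangentSpace I) c).localFrame
          (stdBasis n) j z := by
  rw [Trivialization.localFrame_apply_of_mem_baseSet _ _ (mem_baseSet_iff.2 hz)]
  exact (coordBasis_apply hz j).symm

lemma coordComp_eq_repr {c z : M} (hz : z ∈ (chartAt H c).source) (j : Fin n)
    (X : TangentSpace I z) : coordComp I c j z X = (coordBasis hz).repr X j := by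
  have : ContMDiffVectorBundle 1 (EuclideanSpace ℝ (Fin n)) (TangentSpace I : M → Type _) I :=
    ContMDiffVectorBundle.of_le (n := ∞) (by simp)
  classical
  -- The field equal to `X` at `z` and zero elsewhere turns the statement about sections into one
  -- about a single vector.
  have h := Trivialization.localFrameCoeff_apply_of_mem_baseSet (I := I)
    (trivializationAt (EuclideanSpace ℝ (Fin n)) (TangentSpace I) c) (stdBasis n)
    (mem_baseSet_iff.2 hz) (Function.update (fun _ => 0) z X) j
  simpa using! h

lemma sum_coordComp_smul {c z : M} (hz : z ∈ (chartAt H c).source) (X : TangentSpace I z) :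
    ∑ j, coordComp I c j z X • coordField I c j z = X := by
  simp only [coordComp_eq_repr hz, ← coordBasis_apply hz]
  exact (coordBasis hz).sum_repr X

lemma contMDiffOn_coordField (c : M) (j : Fin n) :
    ContMDiffOn I I.tangent ∞ (fun z => (⟨z, coordField I c j z⟩ : TangentBundle I M))
      (chartAt H c).source := by
  have h := (trivializationAt (EuclideanSpace ℝ (Fin n)) (TangentSpace I : M → Type _) c
    ).contMDiffOn_localFrame_baseSet (I := I) ∞ (stdBasis n) j
  rw [TangentBundle.trivializationAt_baseSet] at h
  exact h.congr fun z hz => by rw [coordField_eq_localFrame hz]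

lemma contMDiffAt_coordComp {c z : M} (hz : z ∈ (chartAt H c).source) (j : Fin n)
    {X : ∀ x : M, TangentSpace I x}
    (hX : ContMDiffAt I I.tangent ∞ (fun x => (⟨x, X x⟩ : TangentBundle I M)) z) :
    ContMDiffAt I 𝓘(ℝ, ℝ) ∞ (fun x => coordComp I c j x (X x)) z := by
  have : ContMDiffVectorBundle 1 (EuclideanSpace ℝ (Fin n)) (TangentSpace I : M → Type _) I :=
    ContMDiffVectorBundle.of_le (n := ∞) (by simp)
  exact contMDiffAt_localFrameCoeff (stdBasis n) (mem_baseSet_iff.2 hz) hX j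

/-- The coefficient of an `n`-form in the chart at `c`. -/
def coef (Ω : VolumeForm I M) (c z : M) : ℝ := Ω.form z (fun j => coordField I c j z)

lemma coef_ne_zero (Ω : VolumeForm I M) {c z : M} (hz : z ∈ (chartAt H c).source) :
    coef Ω c z ≠ 0 := by
  intro h
  refine Ω.ne_zero z ?_
  have h1 := (Ω.form z).eq_smul_basis_det (coordBasis hz)
  have h2 : (coordBasis (I := I) hz : Fin n → TangentSpace I z) = fun j => coordField I c j z :=
    funext fun j => coordBasis_apply hz j
  rw [h2] at h1
  rw [h1]
  show coef Ω c z • _ = _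
  rw [h, zero_smul]

/-- Smoothness of a volume form is assumed on global fields only, so the local fields are first
replaced by global ones that agree near `z`. -/
lemma contMDiffAt_form [T2Space M] (Ω : VolumeForm I M) {z : M}
    {Y : Fin n → ∀ x : M, TangentSpace I x} {U : Set M} (hU : U ∈ 𝓝 z)
    (hY : ∀ j, ContMDiffOn I I.tangent ∞ (fun x => (⟨x, Y j x⟩ : TangentBundle I M)) U) :
    ContMDiffAt I 𝓘(ℝ, ℝ) ∞ (fun x => Ω.form x (fun j => Y j x)) z := by
  choose Z hZ using fun j => exists_global_section hU (hY j)
  refine (Ω.smooth Z z).congr_of_eventuallyEq ?_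
  filter_upwards [Filter.eventually_all.2 hZ] with x hx
  congr 1
  funext j
  exact (hx j).symm

lemma contMDiffAt_coef [T2Space M] (Ω : VolumeForm I M) {c z : M} (hz : z ∈ (chartAt H c).source) :
    ContMDiffAt I 𝓘(ℝ, ℝ) ∞ (coef Ω c) z :=
  contMDiffAt_form Ω ((chartAt H c).open_source.mem_nhds hz) fun j => contMDiffOn_coordField c j

end Coordinates


/-! ### Lie derivatives of volume forms under a change of frame. -/

section Frames

variable {n : ℕ} {H : Type*} [TopologicalSpace H]
  {I : ModelWithCorners ℝ (EuclideanSpace ℝ (Fin n)) H}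
  {M : Type*} [TopologicalSpace M] [ChartedSpace H M] [IsManifold I ∞ M]

lemma dirDeriv_comp {W : Type*} [NormedAddCommGroup W] [NormedSpace ℝ W] {f : W → ℝ}
    {f' : W →L[ℝ] ℝ} {A : M → W} {x : M} (hf : HasFDerivAt f f' (A x))
    (hA : MDifferentiableAt I 𝓘(ℝ, W) A x) (X : TangentSpace I x) :
    dirDeriv (I := I) (fun z => f (A z)) x X = f' (mfderiv I 𝓘(ℝ, W) A x X) := by
  have h := hf.hasMFDerivAt.comp x hA.hasMFDerivAt
  exact congrArg (fun L => L X) h.mfderiv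

lemma dirDeriv_det {A : M → Matrix (Fin n) (Fin n) ℝ} {x : M}
    (hA : ∀ j k, ContMDiffAt I 𝓘(ℝ, ℝ) ∞ (fun z => A z j k) x) (X : TangentSpace I x) :
    dirDeriv (I := I) (fun z => (A z).det) x X
      = ∑ j, ((A x).updateRow j (fun k => dirDeriv (I := I) (fun z => A z j k) x X)).det := by
  let f : ContinuousMultilinearMap ℝ (fun _ : Fin n => Fin n → ℝ) ℝ :=
    { (Matrix.detRowAlternating (R := ℝ) (n := Fin n)).toMultilinearMap with
      cont := (Continuous.matrix_det (A := fun a : Matrix (Fin n) (Fin n) ℝ => a) continuous_id) }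
  have hA' : MDifferentiableAt I 𝓘(ℝ, Fin n → Fin n → ℝ) (fun z j k => A z j k) x :=
    (contMDiffAt_pi_space.2 fun j => contMDiffAt_pi_space.2 fun k => hA j k).mdifferentiableAt
      (by simp)
  have hcomp : ∀ j k, dirDeriv (I := I) (fun z => A z j k) x X
      = (mfderiv I 𝓘(ℝ, Fin n → Fin n → ℝ) (fun z j k => A z j k) x X : Fin n → Fin n → ℝ) j k :=
    fun j k =>
      let L : (Fin n → Fin n → ℝ) →L[ℝ] ℝ := (ContinuousLinearMap.proj k).comp
        (ContinuousLinearMap.proj (R := ℝ) (φ := fun _ : Fin n => Fin n → ℝ) j)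
      dirDeriv_comp (f := L) L.hasFDerivAt hA' X
  rw [show (fun z => (A z).det) = fun z => f (fun j k => A z j k) from rfl,
    dirDeriv_comp (f.hasFDerivAt _) hA' X]
  refine (f.linearDeriv_apply _ _).trans (Finset.sum_congr rfl fun j _ => ?_)
  rw [show (fun k => dirDeriv (I := I) (fun z => A z j k) x X) =
    (mfderiv I 𝓘(ℝ, Fin n → Fin n → ℝ) (fun z j k => A z j k) x X : Fin n → Fin n → ℝ) j from
    funext fun k => hcomp j k]
  rfl

variable {X : ∀ x : M, TangentSpace I x}

lemma mlieBracket_sum_smul {ι : Type*} [Fintype ι] {a : ι → M → ℝ}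
    {Z : ι → ∀ x : M, TangentSpace I x} {x : M}
    (ha : ∀ k, ContMDiffAt I 𝓘(ℝ, ℝ) ∞ (a k) x)
    (hZ : ∀ k, ContMDiffAt I I.tangent ∞ (fun z => (⟨z, Z k z⟩ : TangentBundle I M)) x) :
    VectorField.mlieBracket I X (fun z => ∑ k, a k z • Z k z) x
      = ∑ k, (dirDeriv (I := I) (a k) x (X x) • Z k x
        + a k x • VectorField.mlieBracket I X (Z k) x) := by
  classical
  have : IsManifold I 2 M := inferInstance
  have hterm : ∀ k, ContMDiffAt I I.tangent ∞
      (fun z => (⟨z, a k z • Z k z⟩ : TangentBundle I M)) x :=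
    fun k => (ha k).smul_section (hZ k)
  suffices h : ∀ s : Finset ι, VectorField.mlieBracket I X (fun z => ∑ k ∈ s, a k z • Z k z) x
      = ∑ k ∈ s, (dirDeriv (I := I) (a k) x (X x) • Z k x
        + a k x • VectorField.mlieBracket I X (Z k) x) from h Finset.univ
  intro s
  induction s using Finset.induction_on with
  | empty =>
    simp only [Finset.sum_empty]
    exact congrFun VectorField.mlieBracket_zero_right x
  | insert k s hk ih =>
    simp only [Finset.sum_insert hk]
    rw [← ih]
    have h1 := VectorField.mlieBracket_add_right (V := X) (W := fun z => a k z • Z k z)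
      (W₁ := fun z => ∑ k ∈ s, a k z • Z k z) (x := x)
      ((hterm k).mdifferentiableAt (by simp))
      ((ContMDiffAt.sum_section fun i _ => hterm i).mdifferentiableAt (by simp))
    refine h1.trans (congrArg (· + _) ?_)
    exact VectorField.mlieBracket_smul_right ((ha k).mdifferentiableAt (by simp))
      ((hZ k).mdifferentiableAt (by simp))

/-- The Lie derivative of a form is again tensorial. The derivative of the determinant of the change
of frame, which appears when differentiating the coefficient, cancels against the derivatives of the
matrix entries in the brackets. -/
lemma lieDerivForm_frame [T2Space M] (Ω : VolumeForm I M) {x : M}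
    {Y Z : Fin n → ∀ x : M, TangentSpace I x} {a : Fin n → Fin n → M → ℝ}
    (ha : ∀ j k, ContMDiffAt I 𝓘(ℝ, ℝ) ∞ (a j k) x)
    (hZ : ∀ k, ContMDiffAt I I.tangent ∞ (fun z => (⟨z, Z k z⟩ : TangentBundle I M)) x)
    (hΩ : ContMDiffAt I 𝓘(ℝ, ℝ) ∞ (fun z => Ω.form z (fun j => Z j z)) x)
    (hY : ∀ᶠ z in 𝓝 x, ∀ j, Y j z = ∑ k, a j k z • Z k z)
    (b : ∀ᶠ z in 𝓝 x, ∃ b : Module.Basis (Fin n) ℝ (TangentSpace I z), ∀ k, b k = Z k z)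
    (c : Module.Basis (Fin n) ℝ (TangentSpace I x)) (hc : ∀ k, c k = Y k x) :
    lieDerivForm I X Ω.form Y x
      = (Matrix.of fun j k => a j k x).det * lieDerivForm I X Ω.form Z x := by
  have hΩY : (fun z => Ω.form z (fun j => Y j z)) =ᶠ[𝓝 x]
      fun z => (Matrix.of fun j k => a j k z).det * Ω.form z (fun j => Z j z) := by
    filter_upwards [hY, b] with z hz ⟨b, hb⟩
    have h := alternating_sum_smul (Ω.form z) b (Matrix.of fun j k => a j k z)
    rw [show (b : Fin n → TangentSpace I z) = fun j => Z j z from funext hb] at h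
    rw [← h]
    congr 1
    funext j
    simp [hz j]
  obtain ⟨b, hb⟩ := b.self_of_nhds
  have hbZ : (b : Fin n → TangentSpace I x) = fun j => Z j x := funext hb
  have hcY : (c : Fin n → TangentSpace I x) = fun j => Y j x := funext hc
  have hYx := hY.self_of_nhds
  have hdet : ContMDiffAt I 𝓘(ℝ, ℝ) ∞ (fun z => (Matrix.of fun j k => a j k z).det) x := by
    simp only [Matrix.det_apply', Matrix.of_apply]
    refine ContMDiffAt.sum fun σ _ => contMDiffAt_const.mul ?_
    exact contMDiffAt_finsetProd fun i _ => ha _ _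
  have hbr : ∀ j, VectorField.mlieBracket I X (Y j) x
      = ∑ k, (dirDeriv (I := I) (a j k) x (X x) • Z k x
        + a j k x • VectorField.mlieBracket I X (Z k) x) := by
    intro j
    rw [← mlieBracket_sum_smul (ha j) hZ]
    exact Filter.EventuallyEq.mlieBracket_vectorField_eq (.refl _ _)
      (hY.mono fun z hz => hz j)
  -- With this endomorphism the undifferentiated bracket terms in both frames become the trace of
  -- `L` times the value of the form.
  let L : TangentSpace I x →ₗ[ℝ] TangentSpace I x :=
    b.constr ℝ fun k => VectorField.mlieBracket I X (Z k) x
  have hL : ∀ k, L (Z k x) = VectorField.mlieBracket I X (Z k) x := by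
    intro k
    rw [← hb k]
    exact b.constr_basis ℝ _ k
  have hLY : ∀ j, L (Y j x) = ∑ k, a j k x • VectorField.mlieBracket I X (Z k) x := by
    intro j
    rw [hYx j, map_sum]
    exact Finset.sum_congr rfl fun k _ => by rw [map_smul, hL]
  have hsumZ := alternating_sum_update (Ω.form x) b L
  have hsumY := alternating_sum_update (Ω.form x) c L
  rw [hbZ] at hsumZ
  rw [hcY] at hsumY
  simp only [hL] at hsumZ
  simp only [hLY] at hsumY
  have hdetrow : ∀ j, Ω.form x (Function.update (fun k => Y k x) j
      (∑ k, dirDeriv (I := I) (a j k) x (X x) • Z k x))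
      = ((Matrix.of fun j k => a j k x).updateRow j
          (fun k => dirDeriv (I := I) (a j k) x (X x))).det * Ω.form x (fun k => Z k x) := by
    intro j
    rw [← hbZ, ← alternating_sum_smul]
    congr 1
    funext i
    by_cases h : i = j
    · subst h
      simp [hb]
    · simp [h, hb, hYx i]
  simp only [lieDerivForm]
  rw [dirDeriv_congr hΩY, dirDeriv_mul (hdet.mdifferentiableAt (by simp))
    (hΩ.mdifferentiableAt (by simp)),
    dirDeriv_det (A := fun z => Matrix.of fun j k => a j k z) ha]
  simp only [hbr, Finset.sum_add_distrib, AlternatingMap.map_update_add, hsumY, hsumZ, hdetrow,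
    Matrix.of_apply, ← Finset.sum_mul]
  have hΩx := hΩY.self_of_nhds
  simp only at hΩx
  rw [hΩx]
  ring

end Frames


/-! ### Commutation of coordinate fields. -/

section Model

variable {W H : Type*} [NormedAddCommGroup W] [NormedSpace ℝ W] [CompleteSpace W]
  [TopologicalSpace H]
  {I : ModelWithCorners ℝ W H} {M : Type*} [TopologicalSpace M] [ChartedSpace H M]
  [IsManifold I ∞ M]

/-- Vector fields that are constant in a chart commute. -/
lemma mlieBracket_chart_const {c z : M} (hz : z ∈ (chartAt H c).source) (v w : W) :
    VectorField.mlieBracket I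
      (fun z => (mfderivWithin 𝓘(ℝ, W) I (extChartAt I c).symm (range I) (extChartAt I c z) :
        W → TangentSpace I ((extChartAt I c).symm (extChartAt I c z))) v)
      (fun z => (mfderivWithin 𝓘(ℝ, W) I (extChartAt I c).symm (range I) (extChartAt I c z) :
        W → TangentSpace I ((extChartAt I c).symm (extChartAt I c z))) w) z = 0 := by
  have : IsManifold I 1 M := inferInstance
  have : IsManifold I 2 M := inferInstance
  have : IsManifold I (minSmoothness ℝ 2) M := by simpa using this
  have : IsManifold I (minSmoothness ℝ 3) M := by
    simpa using (inferInstance : IsManifold I 3 M)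
  let K : W → ∀ x : W, TangentSpace 𝓘(ℝ, W) x := fun u _ => u
  -- The fields are pullbacks under the chart of constant fields, and the bracket commutes with
  -- pullback.
  have hev : ∀ u : W, (fun z => (mfderivWithin 𝓘(ℝ, W) I (extChartAt I c).symm (range I)
      (extChartAt I c z) : W → TangentSpace I ((extChartAt I c).symm (extChartAt I c z))) u)
      =ᶠ[𝓝 z] VectorField.mpullback I 𝓘(ℝ, W) (extChartAt I c) (K u) := by
    intro u
    filter_upwards [(chartAt H c).open_source.mem_nhds hz] with y hy
    have hy' : y ∈ (extChartAt I c).source := by rwa [extChartAt_source]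
    have h := mfderiv_extChartAt_comp_mfderivWithin_extChartAt_symm' hy'
    exact ((isInvertible_mfderiv_extChartAt hy').inverse_apply_eq.2
      (congrArg (fun L => L u) h).symm).symm
  have hK : ∀ u : W, MDifferentiableAt 𝓘(ℝ, W) 𝓘(ℝ, W).tangent
      (fun y => (⟨y, K u y⟩ : TangentBundle 𝓘(ℝ, W) W)) (extChartAt I c z) := by
    intro u
    refine ContMDiffAt.mdifferentiableAt (n := 1) ?_ (by simp)
    rw [contMDiffAt_vectorSpace_iff_contDiffAt]
    exact contDiffAt_const
  refine (Filter.EventuallyEq.mlieBracket_vectorField_eq (hev v) (hev w)).trans ?_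
  rw [← VectorField.mpullback_mlieBracket (n := 2) (hK v) (hK w) (contMDiffAt_extChartAt' hz)
      (by simp),
    VectorField.mpullback_apply, ← VectorField.mlieBracketWithin_univ,
    VectorField.mlieBracketWithin_eq_lieBracketWithin, VectorField.lieBracketWithin_univ]
  have h0 : VectorField.lieBracket ℝ (K v) (K w) (extChartAt I c z) = 0 := by
    simp only [VectorField.lieBracket]
    rw [show (K v : W → W) = fun _ => v from rfl, show (K w : W → W) = fun _ => w from rfl]
    simp
  rw [h0]
  exact map_zero _

end Model

/-! ### The coordinate formula for the divergence. -/

section Coordinates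

variable {n : ℕ} {H : Type*} [TopologicalSpace H]
  {I : ModelWithCorners ℝ (EuclideanSpace ℝ (Fin n)) H}
  {M : Type*} [TopologicalSpace M] [ChartedSpace H M] [IsManifold I ∞ M]

lemma mlieBracket_coordField {c z : M} (hz : z ∈ (chartAt H c).source) (j k : Fin n) :
    VectorField.mlieBracket I (coordField I c j) (coordField I c k) z = 0 :=
  mlieBracket_chart_const hz (EuclideanSpace.single j 1) (EuclideanSpace.single k 1)

/-- The coordinate expression of the Lie derivative of a volume form. -/
lemma volumeDiv_mul_coef [T2Space M] (Ω : VolumeForm I M) {X : ∀ x : M, TangentSpace I x}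
    {c z : M} (hz : z ∈ (chartAt H c).source)
    (hX : ContMDiffAt I I.tangent ∞ (fun x => (⟨x, X x⟩ : TangentBundle I M)) z) :
    volumeDiv I Ω X z * coef Ω c z
      = ∑ j, dirDeriv (I := I) (fun w => coordComp I c j w (X w) * coef Ω c w) z
          (coordField I c j z) := by
  have hzz : z ∈ (chartAt H z).source := mem_chart_source H z
  have hnhds : (chartAt H c).source ∈ 𝓝 z := (chartAt H c).open_source.mem_nhds hz
  have hsm : ∀ d : M, z ∈ (chartAt H d).source → ∀ k, ContMDiffAt I I.tangent ∞
      (fun w => (⟨w, coordField I d k w⟩ : TangentBundle I M)) z := fun d hd k =>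
    (contMDiffOn_coordField d k).contMDiffAt ((chartAt H d).open_source.mem_nhds hd)
  -- The divergence at `z` is defined in the preferred chart of `z`, whereas the formula is wanted
  -- in a fixed chart `c`; both numerator and denominator change by the same determinant.
  have hframe := lieDerivForm_frame (X := X) Ω (x := z) (Y := coordField I z)
    (Z := coordField I c) (a := fun j k w => coordComp I c k w (coordField I z j w))
    (fun j k => contMDiffAt_coordComp hz k (hsm z hzz j)) (hsm c hz)
    (contMDiffAt_coef Ω hz)
    (by filter_upwards [hnhds] with w hw j using (sum_coordComp_smul hw _).symm)
    (by filter_upwards [hnhds] with w hw using ⟨coordBasis hw, coordBasis_apply hw⟩)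
    (coordBasis hzz) (coordBasis_apply hzz)
  have hdet : coef Ω z z = (Matrix.of fun j k => coordComp I c k z (coordField I z j z)).det
      * coef Ω c z := by
    have h := alternating_sum_smul (Ω.form z) (coordBasis (I := I) hz)
      (Matrix.of fun j k => coordComp I c k z (coordField I z j z))
    simp only [Matrix.of_apply, coordBasis_apply, sum_coordComp_smul hz] at h
    rw [show (coordBasis (I := I) hz : Fin n → TangentSpace I z) = fun j => coordField I c j z from
      funext fun j => coordBasis_apply hz j] at h
    exact h
  have hne := coef_ne_zero Ω hzz
  have hvol : volumeDiv I Ω X z * coef Ω c z = lieDerivForm I X Ω.form (coordField I c) z := by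
    have h1 : volumeDiv I Ω X z * coef Ω z z = lieDerivForm I X Ω.form (coordField I z) z :=
      div_mul_cancel₀ _ hne
    rw [hframe, hdet] at h1
    rw [hdet] at hne
    exact mul_left_cancel₀ (left_ne_zero_of_mul hne) (by linarith)
  have hcomp : ∀ j, MDifferentiableAt I 𝓘(ℝ, ℝ) (fun w => coordComp I c j w (X w)) z :=
    fun j => (contMDiffAt_coordComp hz j hX).mdifferentiableAt (by simp)
  have hcoef : MDifferentiableAt I 𝓘(ℝ, ℝ) (coef Ω c) z :=
    (contMDiffAt_coef Ω hz).mdifferentiableAt (by simp)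
  -- Expand `X` in coordinate fields. These commute, so only the derivatives of the components of
  -- `X` remain.
  have hbr : ∀ j, VectorField.mlieBracket I X (coordField I c j) z
      = ∑ k, (-dirDeriv (I := I) (fun w => coordComp I c k w (X w)) z (coordField I c j z))
          • coordField I c k z := by
    intro j
    have hXev : X =ᶠ[𝓝 z] fun w => ∑ k, coordComp I c k w (X w) • coordField I c k w := by
      filter_upwards [hnhds] with w hw using (sum_coordComp_smul hw _).symm
    have h1 := (Filter.EventuallyEq.mlieBracket_vectorField_eq (.refl _ (coordField I c j))
      hXev).trans (mlieBracket_sum_smul (fun k => contMDiffAt_coordComp hz k hX) (hsm c hz))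
    rw [VectorField.mlieBracket_swap_apply, h1, ← Finset.sum_neg_distrib]
    refine Finset.sum_congr rfl fun k _ => ?_
    rw [mlieBracket_coordField hz, smul_zero, add_zero, neg_smul]
  have hupd : ∀ j, Ω.form z (Function.update (fun k => coordField I c k z) j
      (VectorField.mlieBracket I X (coordField I c j) z))
      = -dirDeriv (I := I) (fun w => coordComp I c j w (X w)) z (coordField I c j z)
        * coef Ω c z := by
    intro j
    rw [hbr, AlternatingMap.map_update_sum, Finset.sum_eq_single j]
    · rw [AlternatingMap.map_update_smul, Function.update_eq_self, smul_eq_mul]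
      rfl
    · intro k _ hk
      rw [AlternatingMap.map_update_smul,
        AlternatingMap.map_update_self _ (fun k => coordField I c k z) hk.symm, smul_zero]
    · simp
  have hXz : dirDeriv (I := I) (coef Ω c) z (X z)
      = ∑ j, coordComp I c j z (X z) * dirDeriv (I := I) (coef Ω c) z (coordField I c j z) := by
    conv_lhs => rw [← sum_coordComp_smul hz (X z)]
    simp only [dirDeriv, map_sum, map_smul]
    rfl
  rw [hvol, lieDerivForm]
  simp only [hupd]
  rw [show (fun z => Ω.form z fun j => coordField I c j z) = coef Ω c from rfl, hXz,
    ← Finset.sum_sub_distrib]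
  refine Finset.sum_congr rfl fun j _ => ?_
  rw [dirDeriv_mul (hcomp j) hcoef]
  ring

end Coordinates


/-! ### Integrals of derivatives over a convex set. -/

section Euclidean

open MeasureTheory
open scoped NNReal

variable {W : Type*} [NormedAddCommGroup W] [NormedSpace ℝ W]

/-- A function that is Lipschitz on a set and vanishes outside of it and on its frontier is
Lipschitz. -/
lemma lipschitzWith_of_lipschitzOnWith {s : Set W} {u : W → ℝ} {L : ℝ≥0}
    (hL : LipschitzOnWith L u s) (h0 : ∀ y ∉ s, u y = 0) (hfr : ∀ y ∈ frontier s, u y = 0)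
    (hs : IsClosed s) : LipschitzWith L u := by
  have key : ∀ x y : W, x ∈ s → y ∉ s → dist (u x) (u y) ≤ L * dist x y := by
    intro x y hx hy
    -- A segment from inside to outside meets the frontier, where `u` vanishes; the Lipschitz bound
    -- is applied up to that point.
    obtain ⟨z, hz, hzf⟩ : (segment ℝ x y ∩ frontier s).Nonempty := by
      by_contra hne
      have hcov : segment ℝ x y ⊆ interior s ∪ sᶜ := by
        intro w hw
        by_cases hws : w ∈ s
        · left
          by_contra hwi
          exact hne ⟨w, hw, subset_closure hws, hwi⟩
        · exact Or.inr hws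
      obtain ⟨w, -, hwi, hws⟩ := (convex_segment x y).isPreconnected _ _ isOpen_interior
        hs.isOpen_compl hcov
        ⟨x, left_mem_segment ℝ x y,
          (hcov (left_mem_segment ℝ x y)).resolve_right (fun h => h hx)⟩
        ⟨y, right_mem_segment ℝ x y, hy⟩
      exact hws (interior_subset hwi)
    have hzs : z ∈ s := hs.frontier_subset hzf
    have h1 := hL.dist_le_mul x hx z hzs
    rw [hfr z hzf] at h1
    rw [h0 y hy]
    refine h1.trans ?_
    gcongr
    have := dist_add_dist_of_mem_segment hz
    linarith [dist_nonneg (x := z) (y := y)]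
  refine LipschitzWith.of_dist_le_mul fun x y => ?_
  by_cases hx : x ∈ s
  · by_cases hy : y ∈ s
    · exact hL.dist_le_mul x hx y hy
    · exact key x y hx hy
  · by_cases hy : y ∈ s
    · rw [dist_comm, dist_comm x y]
      exact key y x hy hx
    · rw [h0 x hx, h0 y hy, dist_self]
      positivity

variable [FiniteDimensional ℝ W] [MeasurableSpace W] [BorelSpace W]
  (μ : Measure W) [μ.IsAddHaarMeasure]

/-- The integral of a directional derivative over a convex set vanishes if the function vanishes
outside of the set and on its frontier. -/
lemma setIntegral_fderivWithin_eq_zero {s : Set W} (hs : Convex ℝ s) (hc : IsClosed s)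
    (hint : (interior s).Nonempty) {u : W → ℝ} (hu : ContDiffOn ℝ 1 u s)
    (hsupp : HasCompactSupport u) (h0 : ∀ y ∉ s, u y = 0) (hfr : ∀ y ∈ frontier s, u y = 0)
    (v : W) : ∫ y in s, fderivWithin ℝ u s y v ∂μ = 0 := by
  have huniq : UniqueDiffOn ℝ s := uniqueDiffOn_convex hs hint
  have hcont : ContinuousOn (fun y => fderivWithin ℝ u s y) s :=
    hu.continuousOn_fderivWithin huniq le_rfl
  obtain ⟨L, hL⟩ : ∃ L : ℝ≥0, ∀ y ∈ s, ‖fderivWithin ℝ u s y‖₊ ≤ L := by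
    have hK : IsCompact (tsupport u ∩ s) := hsupp.isCompact.inter_right hc
    obtain ⟨L, hL⟩ := hK.exists_bound_of_continuousOn (hcont.mono inter_subset_right)
    refine ⟨⟨max L 0, le_max_right _ _⟩, fun y hy => ?_⟩
    by_cases hyt : y ∈ tsupport u
    · exact (hL y ⟨hyt, hy⟩).trans (le_max_left _ _)
    · have : fderivWithin ℝ u s y = 0 := by
        have h1 : u =ᶠ[𝓝[s] y] fun _ => 0 :=
          (notMem_tsupport_iff_eventuallyEq.1 hyt).filter_mono nhdsWithin_le_nhds
        rw [h1.fderivWithin_eq (image_eq_zero_of_notMem_tsupport hyt)]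
        simp
      rw [this, nnnorm_zero]
      exact zero_le
  have hlip : LipschitzWith L u := lipschitzWith_of_lipschitzOnWith
    (hs.lipschitzOnWith_of_nnnorm_fderivWithin_le (𝕜 := ℝ) (hu.differentiableOn (by simp)) hL)
    h0 hfr hc
  -- The extension by zero is Lipschitz but in general not differentiable on the frontier, so one
  -- integrates by parts for Lipschitz functions, against the constant `1`. The frontier of a convex
  -- set is null, and off it the line derivative is the derivative within `s`, or zero outside `s`.
  have h1 := LipschitzWith.integral_lineDeriv_mul_eq (μ := μ)
    (LipschitzWith.const (α := W) (1 : ℝ)) hlip hsupp (-v)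
  have hl1 : ∀ x : W, lineDeriv ℝ (fun _ : W => (1 : ℝ)) x (-v) = 0 := by
    intro x
    simp [lineDeriv]
  simp only [hl1, zero_mul, integral_zero, neg_neg, mul_one] at h1
  rw [h1, ← integral_indicator hc.measurableSet]
  refine integral_congr_ae ?_
  have hnull : μ (frontier s) = 0 := hs.addHaar_frontier μ
  filter_upwards [compl_mem_ae_iff.2 hnull] with y hy
  by_cases hys : y ∈ s
  · have hyi : y ∈ interior s := by
      by_contra h
      exact hy ⟨subset_closure hys, h⟩
    have hmem : s ∈ 𝓝 y := mem_interior_iff_mem_nhds.1 hyi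
    rw [indicator_of_mem hys, fderivWithin_of_mem_nhds hmem,
      DifferentiableAt.lineDeriv_eq_fderiv]
    exact ((hu.differentiableOn (by simp)) y hys).differentiableAt hmem
  · rw [indicator_of_notMem hys]
    have h2 : u =ᶠ[𝓝 y] fun _ => 0 := by
      filter_upwards [hc.isOpen_compl.mem_nhds hys] with z hz using h0 z hz
    rw [(h2.hasFDerivAt_iff.2 (hasFDerivAt_const (0 : ℝ) y)).differentiableAt.lineDeriv_eq_fderiv,
      h2.fderiv_eq]
    simp

end Euclidean


/-! ### Densities and change of variables between charts. -/

section ChartIntegrals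

open MeasureTheory

variable {n : ℕ} {H : Type*} [TopologicalSpace H]
  {I : ModelWithCorners ℝ (EuclideanSpace ℝ (Fin n)) H}
  {M : Type*} [TopologicalSpace M] [ChartedSpace H M] [IsManifold I ∞ M]

lemma coef_change (Ω : VolumeForm I M) {c d z : M} (hc : z ∈ (chartAt H c).source)
    (hd : z ∈ (chartAt H d).source) :
    coef Ω c z = (tangentCoordChange I c d z).det * coef Ω d z := by
  have hc' : z ∈ (extChartAt I c).source := by rwa [extChartAt_source]
  have hd' : z ∈ (extChartAt I d).source := by rwa [extChartAt_source]
  have hz' : z ∈ (extChartAt I z).source := mem_extChartAt_source z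
  let f : (EuclideanSpace ℝ (Fin n)) [⋀^Fin n]→ₗ[ℝ] ℝ := (Ω.form z).compLinearMap
    ((trivializationAt (EuclideanSpace ℝ (Fin n)) (TangentSpace I) d).symmL ℝ z).toLinearMap
  have h := alternating_comp f (stdBasis n) (tangentCoordChange I c d z).toLinearMap
  have h1 : f (fun j => tangentCoordChange I c d z (stdBasis n j)) = coef Ω c z := by
    refine congrArg (Ω.form z) (funext fun j => ?_)
    rw [coordField_eq_symmL hc]
    refine Eq.trans ?_ (congrArg (fun L => L (stdBasis n j))
      (TangentBundle.symmL_trivializationAt_eq_core (I := I) (M := M) hc)).symm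
    refine (congrArg (fun L => L (tangentCoordChange I c d z (stdBasis n j)))
      (TangentBundle.symmL_trivializationAt_eq_core (I := I) (M := M) hd)).trans ?_
    exact tangentCoordChange_comp (I := I) (z := z) (x := d) (y := z) (w := c) ⟨⟨hc', hd'⟩, hz'⟩
  have h2 : f (stdBasis n) = coef Ω d z :=
    congrArg (Ω.form z) (funext fun j => (coordField_eq_symmL hd j).symm)
  rw [← h1, ← h2]
  exact h

/-- The density of `Ω` in the chart at `c`, with respect to the orientation `o`. -/
def density (o Ω : VolumeForm I M) (c z : M) : ℝ :=
  (SignType.sign (coef o c z) : ℝ) * coef Ω c z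

variable (o Ω : VolumeForm I M)

/-- The sign of the reference form contributes the sign of the Jacobian determinant, which turns the
determinant into the absolute value demanded by the change of variables formula. -/
lemma density_change {c d z : M} (hc : z ∈ (chartAt H c).source)
    (hd : z ∈ (chartAt H d).source) :
    density o Ω c z = |(tangentCoordChange I c d z).det| * density o Ω d z := by
  rw [density, density, coef_change o hc hd, coef_change Ω hc hd, sign_mul, SignType.coe_mul,
    ← self_mul_sign]
  ring

/-- The coefficient of the reference form is continuous and never zero, so its sign is locally
constant and does not affect derivatives. -/
lemma density_eventuallyEq [T2Space M] {c z : M} (hz : z ∈ (chartAt H c).source) :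
    density o Ω c =ᶠ[𝓝 z] fun w => (SignType.sign (coef o c z) : ℝ) * coef Ω c w := by
  have hcont := (contMDiffAt_coef o hz).continuousAt
  rcases lt_or_gt_of_ne (coef_ne_zero o hz) with h | h
  · filter_upwards [hcont.eventually_lt_const h] with w hw
    rw [density, sign_neg hw, sign_neg h]
  · filter_upwards [hcont.eventually_const_lt h] with w hw
    rw [density, sign_pos hw, sign_pos h]

lemma contMDiffAt_density [T2Space M] {c z : M} (hz : z ∈ (chartAt H c).source) :
    ContMDiffAt I 𝓘(ℝ, ℝ) ∞ (density o Ω c) z :=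
  (contMDiffAt_const.mul (contMDiffAt_coef Ω hz)).congr_of_eventuallyEq
    (density_eventuallyEq o Ω hz)

lemma density_ne_zero {c z : M} (hz : z ∈ (chartAt H c).source) : density o Ω c z ≠ 0 := by
  refine mul_ne_zero ?_ (coef_ne_zero Ω hz)
  rcases lt_or_gt_of_ne (coef_ne_zero o hz) with h | h
  · simp [sign_neg h]
  · simp [sign_pos h]

lemma continuousOn_density [T2Space M] (c : M) :
    ContinuousOn (density o Ω c) (chartAt H c).source :=
  fun _ hz => (contMDiffAt_density o Ω hz).continuousAt.continuousWithinAt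

variable (I) in
lemma measurableSet_target_inter (c : M) {U : Set M} (hU : IsOpen U) :
    MeasurableSet ((extChartAt I c).target ∩ (extChartAt I c).symm ⁻¹' U) := by
  have h : (extChartAt I c).target ∩ (extChartAt I c).symm ⁻¹' U
      = I.symm ⁻¹' ((chartAt H c).target ∩ (chartAt H c).symm ⁻¹' U) ∩ range I := by
    rw [extChartAt_target]
    ext y
    simp only [mem_inter_iff, mem_preimage, extChartAt_coe_symm, Function.comp_apply]
    tauto
  rw [h]
  exact (((chartAt H c).isOpen_inter_preimage_symm hU).preimage
    I.continuous_symm).measurableSet.inter I.isClosed_range.measurableSet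

variable (I) in
lemma measurableSet_target (c : M) : MeasurableSet (extChartAt I c).target := by
  simpa using measurableSet_target_inter I c isOpen_univ

variable (I) in
lemma measurableSet_target_inter_of_isClosed (c : M) {K : Set M} (hK : IsClosed K) :
    MeasurableSet ((extChartAt I c).target ∩ (extChartAt I c).symm ⁻¹' K) := by
  convert (measurableSet_target I c).diff (measurableSet_target_inter I c hK.isOpen_compl) using 1
  ext y
  simp only [mem_inter_iff, mem_preimage, mem_sdiff, mem_compl_iff]
  tauto

/-- The integral of `h Ω` computed in the chart at `c`. -/
def chartInt (c : M) (h : M → ℝ) : ℝ :=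
  ∫ y in (extChartAt I c).target,
    h ((extChartAt I c).symm y) * density o Ω c ((extChartAt I c).symm y)

/-- Both integrals restrict to the overlap, where the transition map is injective and its Jacobian
is absorbed by `density_change`. -/
lemma chartInt_change {c d : M} {h : M → ℝ}
    (h0 : ∀ z, z ∉ (chartAt H c).source ∩ (chartAt H d).source → h z = 0) :
    chartInt o Ω c h = chartInt o Ω d h := by
  have hrestrict : ∀ a b : M, (∀ z, z ∉ (chartAt H b).source → h z = 0) → chartInt o Ω a h
      = ∫ y in (extChartAt I a).target ∩ (extChartAt I a).symm ⁻¹' (chartAt H b).source,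
        h ((extChartAt I a).symm y) * density o Ω a ((extChartAt I a).symm y) := by
    intro a b hb
    refine setIntegral_eq_of_subset_of_forall_sdiff_eq_zero (measurableSet_target I a)
      inter_subset_left fun y hy => ?_
    rw [hb _ fun h' => hy.2 ⟨hy.1, h'⟩, zero_mul]
  have himage : (extChartAt I d ∘ (extChartAt I c).symm) ''
      ((extChartAt I c).target ∩ (extChartAt I c).symm ⁻¹' (chartAt H d).source)
      = (extChartAt I d).target ∩ (extChartAt I d).symm ⁻¹' (chartAt H c).source := by
    rw [← extChartAt_source I d, ← extChartAt_source I c]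
    ext y
    constructor
    · rintro ⟨x, ⟨hx, hxd⟩, rfl⟩
      refine ⟨(extChartAt I d).map_source hxd, ?_⟩
      simp only [mem_preimage, Function.comp_apply] at hxd ⊢
      rw [(extChartAt I d).left_inv hxd]
      exact (extChartAt I c).map_target hx
    · rintro ⟨hy, hyc⟩
      refine ⟨extChartAt I c ((extChartAt I d).symm y), ⟨(extChartAt I c).map_source hyc, ?_⟩, ?_⟩
      · simp only [mem_preimage] at hyc ⊢
        rw [(extChartAt I c).left_inv hyc]
        exact (extChartAt I d).map_target hy
      · simp only [mem_preimage] at hyc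
        simp only [Function.comp_apply]
        rw [(extChartAt I c).left_inv hyc, (extChartAt I d).right_inv hy]
  have hinj : InjOn (extChartAt I d ∘ (extChartAt I c).symm)
      ((extChartAt I c).target ∩ (extChartAt I c).symm ⁻¹' (chartAt H d).source) := by
    rw [← extChartAt_source I d]
    exact (extChartAt I d).injOn.comp ((extChartAt I c).symm.injOn.mono inter_subset_left)
      fun y hy => hy.2
  rw [hrestrict c d fun z hz => h0 z fun h => hz h.2,
    hrestrict d c fun z hz => h0 z fun h => hz h.1, ← himage,
    integral_image_eq_integral_abs_det_fderiv_smul volume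
      (f' := fun y => tangentCoordChange I c d ((extChartAt I c).symm y))
      (measurableSet_target_inter I c (chartAt H d).open_source) ?_ hinj]
  · refine setIntegral_congr_fun (measurableSet_target_inter I c (chartAt H d).open_source)
      fun y hy => ?_
    have hc : (extChartAt I c).symm y ∈ (chartAt H c).source := by
      rw [← extChartAt_source I c]
      exact (extChartAt I c).map_target hy.1
    have hd : (extChartAt I c).symm y ∈ (chartAt H d).source := hy.2
    simp only [Function.comp_apply, smul_eq_mul]
    rw [(extChartAt I d).left_inv (by rwa [extChartAt_source]), density_change o Ω hc hd]
    ring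
  · intro y hy
    have hc : (extChartAt I c).symm y ∈ (extChartAt I c).source := (extChartAt I c).map_target hy.1
    have hd : (extChartAt I c).symm y ∈ (extChartAt I d).source := by
      rw [extChartAt_source]
      exact hy.2
    have h := hasFDerivWithinAt_tangentCoordChange (I := I) ⟨hc, hd⟩
    rw [(extChartAt I c).right_inv hy.1] at h
    exact h.mono (inter_subset_left.trans (extChartAt_target_subset_range c))

end ChartIntegrals


/-! ### The integral of functions against a volume form over compact sets. -/

section VolumeIntegral

open MeasureTheory

variable {n : ℕ} {H : Type*} [TopologicalSpace H]
  {I : ModelWithCorners ℝ (EuclideanSpace ℝ (Fin n)) H}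
  {M : Type*} [TopologicalSpace M] [ChartedSpace H M] [IsManifold I ∞ M]

variable [T2Space M] [SigmaCompactSpace M] (o Ω : VolumeForm I M)

/-- The integral of the function `h` against the volume form `Ω` over `K`. -/
def volInt (K : Set M) (h : M → ℝ) : ℝ := integralForm I o (fun x => h x • Ω.form x) K

lemma tsupport_chartPartition (c : M) :
    tsupport (chartPartition I M c) ⊆ (chartAt H c).source :=
  Classical.choose_spec (SmoothPartitionOfUnity.exists_isSubordinate_chartAt_source I M) c

lemma chartPartition_eq_zero {c z : M} (hz : z ∉ (chartAt H c).source) :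
    chartPartition I M c z = 0 :=
  image_eq_zero_of_notMem_tsupport fun h => hz (tsupport_chartPartition c h)

variable (I) in
lemma finite_charts {K : Set M} (hK : IsCompact K) :
    {c : M | (tsupport (chartPartition I M c) ∩ K).Nonempty}.Finite :=
  (chartPartition I M).locallyFinite.closure.finite_nonempty_inter_compact hK

variable (I) in
/-- The charts that contribute to integrals over the compact set `K`. -/
def charts {K : Set M} (hK : IsCompact K) : Finset M := (finite_charts I hK).toFinset

lemma chartPartition_eq_zero_of_notMem {K : Set M} (hK : IsCompact K) {c z : M}
    (hc : c ∉ charts I hK) (hz : z ∈ K) : chartPartition I M c z = 0 := by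
  refine image_eq_zero_of_notMem_tsupport fun h => hc ?_
  exact (finite_charts I hK).mem_toFinset.2 ⟨z, h, hz⟩

lemma sum_chartPartition {K : Set M} (hK : IsCompact K) {z : M} (hz : z ∈ K) :
    ∑ c ∈ charts I hK, chartPartition I M c z = 1 := by
  rw [← (chartPartition I M).sum_eq_one (mem_univ z), eq_comm]
  refine finsum_eq_sum_of_support_subset _ fun c hc => ?_
  by_contra h
  exact hc (chartPartition_eq_zero_of_notMem hK h hz)

lemma symm_mem_source {c : M} {y : EuclideanSpace ℝ (Fin n)} (hy : y ∈ (extChartAt I c).target) :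
    (extChartAt I c).symm y ∈ (chartAt H c).source := by
  rw [← extChartAt_source I c]
  exact (extChartAt I c).map_target hy

lemma continuousOn_comp_symm {f : M → ℝ} {c : M} (hf : ContinuousOn f (chartAt H c).source) :
    ContinuousOn (fun y => f ((extChartAt I c).symm y)) (extChartAt I c).target :=
  hf.comp (continuousOn_extChartAt_symm c) fun _ hy => symm_mem_source hy

lemma isCompact_image_chart {c : M} {K : Set M} (hK : IsCompact K)
    (hc : K ⊆ (chartAt H c).source) : IsCompact (extChartAt I c '' K) :=
  hK.image_of_continuousOn ((continuousOn_extChartAt c).mono (by rwa [extChartAt_source]))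

lemma image_chart_subset {c : M} {K : Set M} (hc : K ⊆ (chartAt H c).source) :
    extChartAt I c '' K ⊆ (extChartAt I c).target := by
  rintro _ ⟨z, hz, rfl⟩
  exact (extChartAt I c).map_source (by rw [extChartAt_source]; exact hc hz)

lemma symm_mem_of_mem_image {c : M} {K : Set M} (hc : K ⊆ (chartAt H c).source)
    {y : EuclideanSpace ℝ (Fin n)} (hy : y ∈ extChartAt I c '' K) :
    (extChartAt I c).symm y ∈ K := by
  obtain ⟨z, hz, rfl⟩ := hy
  rw [(extChartAt I c).left_inv (by rw [extChartAt_source]; exact hc hz)]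
  exact hz

/-- A compact set meets finitely many supports of the partition, and each integral can be shrunk to
a compact set inside the chart target. Continuous integrands are then integrable without further
argument. -/
lemma volInt_eq_sum {K : Set M} (hK : IsCompact K) (h : M → ℝ) :
    volInt o Ω K h = ∑ c ∈ charts I hK,
      ∫ y in extChartAt I c '' (K ∩ tsupport (chartPartition I M c)),
        chartPartition I M c ((extChartAt I c).symm y) * density o Ω c ((extChartAt I c).symm y)
          * h ((extChartAt I c).symm y) := by
  have hterm : ∀ (c : M) (y : EuclideanSpace ℝ (Fin n)),
      chartPartition I M c ((extChartAt I c).symm y)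
      * (SignType.sign (o.form ((extChartAt I c).symm y)
          (fun j => coordField I c j ((extChartAt I c).symm y))) : ℝ)
      * ((h ((extChartAt I c).symm y) • Ω.form ((extChartAt I c).symm y))
        (fun j => coordField I c j ((extChartAt I c).symm y)))
      = chartPartition I M c ((extChartAt I c).symm y) * density o Ω c ((extChartAt I c).symm y)
          * h ((extChartAt I c).symm y) := by
    intro c y
    rw [AlternatingMap.smul_apply, smul_eq_mul, density, coef, coef]
    ring
  rw [volInt, integralForm]
  simp only [hterm]
  rw [finsum_eq_sum_of_support_subset (s := charts I hK)]
  · refine Finset.sum_congr rfl fun c _ => ?_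
    have hsub : K ∩ tsupport (chartPartition I M c) ⊆ (chartAt H c).source :=
      inter_subset_right.trans (tsupport_chartPartition c)
    refine setIntegral_eq_of_subset_of_forall_sdiff_eq_zero
      (measurableSet_target_inter_of_isClosed I c hK.isClosed) ?_ ?_
    · exact fun y hy => ⟨image_chart_subset hsub hy, (symm_mem_of_mem_image hsub hy).1⟩
    · rintro y ⟨⟨hy, hyK⟩, hyn⟩
      rw [image_eq_zero_of_notMem_tsupport (f := chartPartition I M c), zero_mul, zero_mul]
      exact fun h' => hyn ⟨_, ⟨hyK, h'⟩, (extChartAt I c).right_inv hy⟩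
  · intro c hc
    by_contra hcn
    refine hc ?_
    refine setIntegral_eq_zero_of_forall_eq_zero fun y hy => ?_
    rw [chartPartition_eq_zero_of_notMem hK hcn hy.2, zero_mul, zero_mul]

lemma continuousOn_integrand (c : M) {h : M → ℝ} (hh : Continuous h) :
    ContinuousOn (fun y => chartPartition I M c ((extChartAt I c).symm y)
      * density o Ω c ((extChartAt I c).symm y) * h ((extChartAt I c).symm y))
      (extChartAt I c).target :=
  ((continuousOn_comp_symm (chartPartition I M c).contMDiff.continuous.continuousOn).mul
    (continuousOn_comp_symm (continuousOn_density o Ω c))).mul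
    (continuousOn_comp_symm hh.continuousOn)

lemma integrableOn_integrand {K : Set M} (hK : IsCompact K) (c : M) {h : M → ℝ}
    (hh : Continuous h) : IntegrableOn (fun y => chartPartition I M c ((extChartAt I c).symm y)
      * density o Ω c ((extChartAt I c).symm y) * h ((extChartAt I c).symm y))
      (extChartAt I c '' (K ∩ tsupport (chartPartition I M c))) := by
  have hsub : K ∩ tsupport (chartPartition I M c) ⊆ (chartAt H c).source :=
    inter_subset_right.trans (tsupport_chartPartition c)
  exact ((continuousOn_integrand o Ω c hh).mono (image_chart_subset hsub)).integrableOn_compact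
    (isCompact_image_chart (hK.inter_right (isClosed_tsupport _)) hsub)

lemma volInt_add {K : Set M} (hK : IsCompact K) {h k : M → ℝ} (hh : Continuous h)
    (hk : Continuous k) :
    volInt o Ω K (fun x => h x + k x) = volInt o Ω K h + volInt o Ω K k := by
  rw [volInt_eq_sum o Ω hK, volInt_eq_sum o Ω hK, volInt_eq_sum o Ω hK, ← Finset.sum_add_distrib]
  refine Finset.sum_congr rfl fun c _ => ?_
  rw [← integral_add (integrableOn_integrand o Ω hK c hh) (integrableOn_integrand o Ω hK c hk)]
  simp only [mul_add]

lemma volInt_const_mul {K : Set M} (hK : IsCompact K) (a : ℝ) (h : M → ℝ) :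
    volInt o Ω K (fun x => a * h x) = a * volInt o Ω K h := by
  rw [volInt_eq_sum o Ω hK, volInt_eq_sum o Ω hK, Finset.mul_sum]
  refine Finset.sum_congr rfl fun c _ => ?_
  rw [← integral_const_mul]
  congr 1
  funext y
  ring

lemma volInt_congr {K : Set M} (hK : IsCompact K) {h k : M → ℝ} (hk : ∀ x ∈ K, h x = k x) :
    volInt o Ω K h = volInt o Ω K k := by
  rw [volInt_eq_sum o Ω hK, volInt_eq_sum o Ω hK]
  refine Finset.sum_congr rfl fun c _ => ?_
  have hsub : K ∩ tsupport (chartPartition I M c) ⊆ (chartAt H c).source :=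
    inter_subset_right.trans (tsupport_chartPartition c)
  refine setIntegral_congr_fun (isCompact_image_chart (hK.inter_right (isClosed_tsupport _))
    hsub).measurableSet fun y hy => ?_
  rw [hk _ (symm_mem_of_mem_image hsub hy).1]

lemma volInt_zero {K : Set M} (hK : IsCompact K) : volInt o Ω K (fun _ => 0) = 0 := by
  simpa using volInt_const_mul o Ω hK 0 (fun _ => 0)

lemma volInt_sum {K : Set M} (hK : IsCompact K) {ι : Type*} (s : Finset ι) {h : ι → M → ℝ}
    (hh : ∀ i ∈ s, Continuous (h i)) :
    volInt o Ω K (fun x => ∑ i ∈ s, h i x) = ∑ i ∈ s, volInt o Ω K (h i) := by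
  classical
  induction s using Finset.induction_on with
  | empty => simpa using volInt_zero o Ω hK
  | insert i s hi ih =>
    simp only [Finset.sum_insert hi]
    rw [volInt_add o Ω hK (hh i (by simp))
      (continuous_finsetSum _ fun j hj => hh j (by simp [hj])), ih fun j hj => hh j (by simp [hj])]

/-- Continuity of the integral in the sup norm on `K`; it carries a uniform expansion of the
integrand over to the action. -/
lemma exists_volInt_bound {K : Set M} (hK : IsCompact K) :
    ∃ B : ℝ, 0 ≤ B ∧ ∀ (h : M → ℝ) (δ : ℝ), 0 ≤ δ → (∀ x ∈ K, |h x| ≤ δ) →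
      |volInt o Ω K h| ≤ B * δ := by
  have hsub : ∀ c, K ∩ tsupport (chartPartition I M c) ⊆ (chartAt H c).source := fun c =>
    inter_subset_right.trans (tsupport_chartPartition c)
  have hA : ∀ c, IsCompact (extChartAt I c '' (K ∩ tsupport (chartPartition I M c))) := fun c =>
    isCompact_image_chart (hK.inter_right (isClosed_tsupport _)) (hsub c)
  have hb : ∀ c, ∃ b : ℝ, 0 ≤ b ∧
      ∀ y ∈ extChartAt I c '' (K ∩ tsupport (chartPartition I M c)),
        |chartPartition I M c ((extChartAt I c).symm y)
          * density o Ω c ((extChartAt I c).symm y)| ≤ b := by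
    intro c
    obtain ⟨b, hb⟩ := (hA c).exists_bound_of_continuousOn
      ((continuousOn_integrand o Ω c (continuous_const (y := (1 : ℝ)))).mono
        (image_chart_subset (hsub c)))
    refine ⟨max b 0, le_max_right _ _, fun y hy => ?_⟩
    have h := (hb y hy).trans (le_max_left b 0)
    rwa [Real.norm_eq_abs, mul_one] at h
  choose b hb0 hb using hb
  refine ⟨∑ c ∈ charts I hK, b c *
    volume.real (extChartAt I c '' (K ∩ tsupport (chartPartition I M c))),
    Finset.sum_nonneg fun c _ => mul_nonneg (hb0 c) measureReal_nonneg, fun h δ hδ hh => ?_⟩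
  rw [volInt_eq_sum o Ω hK, Finset.sum_mul]
  refine (Finset.abs_sum_le_sum_abs _ _).trans (Finset.sum_le_sum fun c _ => ?_)
  rw [← Real.norm_eq_abs]
  refine (norm_setIntegral_le_of_norm_le_const (C := b c * δ) (hA c).measure_lt_top
    fun y hy => ?_).trans (le_of_eq (by ring))
  rw [Real.norm_eq_abs, abs_mul]
  exact mul_le_mul (hb c y hy) (hh _ (symm_mem_of_mem_image (hsub c) hy).1) (abs_nonneg _) (hb0 c)

/-- The integral of a function supported in a chart can be computed in that chart. -/
lemma volInt_eq_chartInt {K L : Set M} (hK : IsCompact K) (hL : IsCompact L) (hLK : L ⊆ K) {d : M}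
    (hd : L ⊆ (chartAt H d).source) {h : M → ℝ} (hh : Continuous h) (h0 : ∀ z ∉ L, h z = 0) :
    volInt o Ω K h = chartInt o Ω d h := by
  -- The function weighted by the partition member of `c` is supported in the overlap of the two
  -- charts, so it may be integrated in chart `d`, where the weights add up to one.
  have hterm : ∀ c ∈ charts I hK,
      ∫ y in extChartAt I c '' (K ∩ tsupport (chartPartition I M c)),
        chartPartition I M c ((extChartAt I c).symm y) * density o Ω c ((extChartAt I c).symm y)
          * h ((extChartAt I c).symm y)
      = chartInt o Ω d (fun z => chartPartition I M c z * h z) := by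
    intro c _
    have hsub : K ∩ tsupport (chartPartition I M c) ⊆ (chartAt H c).source :=
      inter_subset_right.trans (tsupport_chartPartition c)
    rw [← chartInt_change o Ω (c := c) (d := d)]
    · rw [chartInt, eq_comm]
      trans ∫ y in extChartAt I c '' (K ∩ tsupport (chartPartition I M c)),
        chartPartition I M c ((extChartAt I c).symm y) * h ((extChartAt I c).symm y)
          * density o Ω c ((extChartAt I c).symm y)
      · refine setIntegral_eq_of_subset_of_forall_sdiff_eq_zero (measurableSet_target I c)
          (image_chart_subset hsub) ?_
        rintro y ⟨hy, hyn⟩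
        by_cases hyK : (extChartAt I c).symm y ∈ K
        · rw [image_eq_zero_of_notMem_tsupport (f := chartPartition I M c), zero_mul, zero_mul]
          exact fun h' => hyn ⟨_, ⟨hyK, h'⟩, (extChartAt I c).right_inv hy⟩
        · rw [h0 _ fun h' => hyK (hLK h'), mul_zero, zero_mul]
      · congr 1
        funext y
        ring
    · intro z hz
      by_cases hzc : z ∈ (chartAt H c).source
      · rw [h0 z fun h' => hz ⟨hzc, hd h'⟩, mul_zero]
      · rw [chartPartition_eq_zero hzc, zero_mul]
  rw [volInt_eq_sum o Ω hK, Finset.sum_congr rfl hterm]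
  simp only [chartInt]
  rw [← integral_finsetSum]
  · refine setIntegral_congr_fun (measurableSet_target I d) fun y hy => ?_
    rw [← Finset.sum_mul, ← Finset.sum_mul]
    by_cases hyL : (extChartAt I d).symm y ∈ L
    · rw [sum_chartPartition hK (hLK hyL), one_mul]
    · rw [h0 _ hyL, mul_zero]
  · intro c _
    refine IntegrableOn.of_forall_sdiff_eq_zero (s := extChartAt I d '' L) ?_
      (measurableSet_target I d) ?_
    · refine ContinuousOn.integrableOn_compact (isCompact_image_chart hL hd) ?_
      exact (((continuousOn_comp_symm
        (chartPartition I M c).contMDiff.continuous.continuousOn).mul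
        (continuousOn_comp_symm hh.continuousOn)).mul
        (continuousOn_comp_symm (continuousOn_density o Ω d))).mono (image_chart_subset hd)
    · rintro y ⟨hy, hyn⟩
      rw [h0 _ fun h' => hyn ⟨_, h', (extChartAt I d).right_inv hy⟩, mul_zero, zero_mul]

end VolumeIntegral


/-! ### Interior and boundary points in charts. -/

section Boundary

variable {n : ℕ} {H : Type*} [TopologicalSpace H]
  {I : ModelWithCorners ℝ (EuclideanSpace ℝ (Fin n)) H}
  {M : Type*} [TopologicalSpace M] [ChartedSpace H M] [IsManifold I ∞ M]

variable [T2Space M] [SigmaCompactSpace M]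

lemma symm_isInteriorPoint_iff {c : M} {y : EuclideanSpace ℝ (Fin n)}
    (hy : y ∈ (extChartAt I c).target) :
    I.IsInteriorPoint ((extChartAt I c).symm y) ↔ y ∈ interior (range I) := by
  have h := I.isInteriorPoint_iff_of_mem_atlas (M := M) (n := ∞) (by simp)
    (chart_mem_atlas H c) (symm_mem_source (I := I) hy)
  rw [h]
  have h1 : (chartAt H c).extend I ((extChartAt I c).symm y) = y := (extChartAt I c).right_inv hy
  rw [h1]
  constructor
  · exact fun h => interior_mono (extChartAt_target_subset_range c) h
  · intro hi
    rw [mem_interior_iff_mem_nhds] at hi ⊢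
    have h2 := extChartAt_target_mem_nhdsWithin_of_mem hy
    rwa [nhdsWithin_eq_nhds.2 hi] at h2

lemma symm_mem_boundary {c : M} {y : EuclideanSpace ℝ (Fin n)}
    (hy : y ∈ (extChartAt I c).target) (hf : y ∈ frontier (range I)) :
    (extChartAt I c).symm y ∈ I.boundary M := by
  rw [← I.compl_interior]
  exact fun h => hf.2 ((symm_isInteriorPoint_iff hy).1 h)

variable (I M) in
-- The range of the model is convex with nonempty interior, hence contained in the closure of its
-- interior.
lemma dense_interior : Dense (I.interior M) := by
  intro x
  rw [mem_closure_iff_nhds]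
  intro U hU
  have hx : extChartAt I x x ∈ (extChartAt I x).target := mem_extChartAt_target x
  have h1 : (extChartAt I x).symm ⁻¹' U ∈ 𝓝[range I] (extChartAt I x x) := by
    have h := (contMDiffWithinAt_extChartAt_symm_range (I := I) (n := ∞) x hx).continuousWithinAt
    refine h.preimage_mem_nhdsWithin ?_
    rwa [extChartAt_to_inv]
  have h2 := Filter.inter_mem h1 (extChartAt_target_mem_nhdsWithin_of_mem hx)
  obtain ⟨O, hO, hxO, hsub⟩ := mem_nhdsWithin.1 h2
  have hcl : extChartAt I x x ∈ closure (interior (range I)) := by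
    rw [I.convex_range.closure_interior_eq_closure_of_nonempty_interior I.nonempty_interior]
    exact subset_closure (extChartAt_target_subset_range x hx)
  obtain ⟨y, hyO, hyi⟩ := mem_closure_iff.1 hcl O hO hxO
  obtain ⟨hyU, hyt⟩ := hsub ⟨hyO, interior_subset hyi⟩
  exact ⟨_, hyU, (symm_isInteriorPoint_iff hyt).2 hyi⟩

end Boundary

/-! ### The divergence theorem and the fundamental lemma of the calculus of variations. -/

section Divergence

open MeasureTheory

variable {n : ℕ} {H : Type*} [TopologicalSpace H]
  {I : ModelWithCorners ℝ (EuclideanSpace ℝ (Fin n)) H}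
  {M : Type*} [TopologicalSpace M] [ChartedSpace H M] [IsManifold I ∞ M]

variable [T2Space M] [SigmaCompactSpace M]

lemma dirDeriv_coordField {g : M → ℝ} {c : M} {y : EuclideanSpace ℝ (Fin n)}
    (hy : y ∈ (extChartAt I c).target)
    (hg : MDifferentiableAt I 𝓘(ℝ, ℝ) g ((extChartAt I c).symm y)) (j : Fin n) :
    dirDeriv (I := I) g ((extChartAt I c).symm y) (coordField I c j ((extChartAt I c).symm y))
      = fderivWithin ℝ (fun y => g ((extChartAt I c).symm y)) (range I) y
          (EuclideanSpace.single j (1 : ℝ)) := by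
  have : IsManifold I 1 M := inferInstance
  have hu : UniqueMDiffWithinAt 𝓘(ℝ, EuclideanSpace ℝ (Fin n)) (range I) y :=
    (I.uniqueDiffOn y (extChartAt_target_subset_range c hy)).uniqueMDiffWithinAt
  have h := mfderiv_comp_mfderivWithin y hg (mdifferentiableWithinAt_extChartAt_symm hy) hu
  have h1 : (coordField I c j ((extChartAt I c).symm y) : EuclideanSpace ℝ (Fin n))
      = (mfderivWithin 𝓘(ℝ, EuclideanSpace ℝ (Fin n)) I (extChartAt I c).symm (range I) y :
          EuclideanSpace ℝ (Fin n) → EuclideanSpace ℝ (Fin n))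
        (EuclideanSpace.single j (1 : ℝ)) := by
    have h2 := (extChartAt I c).right_inv hy
    exact congrArg (fun w => (mfderivWithin 𝓘(ℝ, EuclideanSpace ℝ (Fin n)) I (extChartAt I c).symm
      (range I) w : EuclideanSpace ℝ (Fin n) → EuclideanSpace ℝ (Fin n))
        (EuclideanSpace.single j (1 : ℝ))) h2
  rw [← mfderivWithin_eq_fderivWithin]
  refine Eq.trans ?_ (congrArg (fun L => L (EuclideanSpace.single j (1 : ℝ))) h).symm
  exact congrArg (mfderiv I 𝓘(ℝ, ℝ) g ((extChartAt I c).symm y)) h1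

lemma contMDiffAt_dirDeriv {g : M → ℝ} {X : ∀ x : M, TangentSpace I x} {z : M} {U : Set M}
    (hU : U ∈ 𝓝 z) (hg : ContMDiffOn I 𝓘(ℝ, ℝ) ∞ g U)
    (hX : ContMDiffOn I I.tangent ∞ (fun x => (⟨x, X x⟩ : TangentBundle I M)) U) :
    ContMDiffAt I 𝓘(ℝ, ℝ) ∞ (fun x => dirDeriv (I := I) g x (X x)) z := by
  obtain ⟨f, hf⟩ := exists_global_function hU hg
  obtain ⟨Z, hZ⟩ := exists_global_section hU hX
  have h1 : ContMDiff I.tangent 𝓘(ℝ, ℝ).tangent ∞ (tangentMap I 𝓘(ℝ, ℝ) f) :=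
    f.contMDiff.contMDiff_tangentMap (by simp)
  have h2 : ContMDiff I 𝓘(ℝ, ℝ) ∞ (fun x => dirDeriv (I := I) f x (Z x)) :=
    (contMDiff_snd_tangentBundle_modelSpace ℝ 𝓘(ℝ, ℝ)).comp (h1.comp Z.contMDiff)
  refine (h2 z).congr_of_eventuallyEq ?_
  filter_upwards [hf.eventually_nhds, hZ] with x hx hxZ
  rw [hxZ, dirDeriv_congr (f := f) (g := g) hx]

variable (Ω : VolumeForm I M) {X : ∀ x : M, TangentSpace I x}

/-- The definition uses a chart that changes with the point, so continuity is read off from the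
formula of `volumeDiv_mul_coef` in one fixed chart. -/
lemma continuous_volumeDiv
    (hX : ContMDiff I I.tangent ∞ (fun x => (⟨x, X x⟩ : TangentBundle I M))) :
    Continuous (volumeDiv I Ω X) := by
  refine continuous_iff_continuousAt.2 fun z => ?_
  have hz : z ∈ (chartAt H z).source := mem_chart_source H z
  have hnhds : (chartAt H z).source ∈ 𝓝 z := (chartAt H z).open_source.mem_nhds hz
  have h1 : ContMDiffAt I 𝓘(ℝ, ℝ) ∞ (fun x => ∑ j, dirDeriv (I := I)
      (fun w => coordComp I z j w (X w) * coef Ω z w) x (coordField I z j x)) z :=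
    ContMDiffAt.sum fun j _ => contMDiffAt_dirDeriv hnhds
      (fun w hw => ((contMDiffAt_coordComp hw j (hX w)).mul
        (contMDiffAt_coef Ω hw)).contMDiffWithinAt) (contMDiffOn_coordField z j)
  refine (h1.continuousAt.div (contMDiffAt_coef Ω hz).continuousAt
    (coef_ne_zero Ω hz)).congr_of_eventuallyEq ?_
  filter_upwards [hnhds] with w hw
  simp only [Pi.div_apply]
  rw [eq_div_iff (coef_ne_zero Ω hw), volumeDiv_mul_coef Ω hw (hX w)]

lemma volumeDiv_sum {ι : Type*} (s : Finset ι) {X : ι → ∀ x : M, TangentSpace I x}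
    (hX : ∀ i, ContMDiff I I.tangent ∞ (fun x => (⟨x, X i x⟩ : TangentBundle I M))) (z : M) :
    volumeDiv I Ω (fun x => ∑ i ∈ s, X i x) z = ∑ i ∈ s, volumeDiv I Ω (X i) z := by
  have hz : z ∈ (chartAt H z).source := mem_chart_source H z
  refine mul_right_cancel₀ (coef_ne_zero Ω hz) ?_
  rw [Finset.sum_mul]
  refine (volumeDiv_mul_coef Ω hz (ContMDiffAt.sum_section fun i _ => hX i z)).trans ?_
  rw [Finset.sum_congr rfl fun i _ => volumeDiv_mul_coef Ω hz (hX i z), Finset.sum_comm]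
  refine Finset.sum_congr rfl fun j _ => ?_
  rw [← dirDeriv_sum]
  · congr 1
    funext w
    rw [map_sum, Finset.sum_mul]
  · exact fun i _ => ((contMDiffAt_coordComp hz j (hX i z)).mul
      (contMDiffAt_coef Ω hz)).mdifferentiableAt (by simp)

lemma volumeDiv_eq_zero
    (hX : ContMDiff I I.tangent ∞ (fun x => (⟨x, X x⟩ : TangentBundle I M))) {z : M}
    (h : ∀ᶠ x in 𝓝 z, X x = 0) : volumeDiv I Ω X z = 0 := by
  have hz : z ∈ (chartAt H z).source := mem_chart_source H z
  refine mul_right_cancel₀ (coef_ne_zero Ω hz) ?_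
  rw [volumeDiv_mul_coef Ω hz (hX z), zero_mul]
  refine Finset.sum_eq_zero fun j _ => ?_
  rw [dirDeriv_congr (g := fun _ => 0), dirDeriv_const]
  filter_upwards [h] with w hw
  rw [hw, map_zero, zero_mul]

variable (o : VolumeForm I M)

/-- In coordinates the divergence times the density is the sum of the `j`-th partial derivatives of
the `j`-th component of `X` times the density. Since `X` vanishes on the boundary, each such product
vanishes on the frontier of the model range. -/
lemma chartInt_volumeDiv {d : M} {L : Set M} (hL : IsCompact L) (hd : L ⊆ (chartAt H d).source)
    (hX : ContMDiff I I.tangent ∞ (fun x => (⟨x, X x⟩ : TangentBundle I M)))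
    (h0 : ∀ x, x ∉ L ∨ x ∈ I.boundary M → X x = 0) :
    chartInt o Ω d (volumeDiv I Ω X) = 0 := by
  classical
  let g : Fin n → M → ℝ := fun j z => coordComp I d j z (X z) * density o Ω d z
  -- Extension by zero from the chart target, so that the Euclidean statement applies to the whole
  -- convex range of the model.
  let u : Fin n → EuclideanSpace ℝ (Fin n) → ℝ := fun j =>
    (extChartAt I d).target.indicator fun y => g j ((extChartAt I d).symm y)
  have hg : ∀ j, ∀ z ∈ (chartAt H d).source, ContMDiffAt I 𝓘(ℝ, ℝ) ∞ (g j) z := fun j z hz =>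
    (contMDiffAt_coordComp hz j (hX z)).mul (contMDiffAt_density o Ω hz)
  have hLc := isCompact_image_chart (I := I) hL hd
  have hu0 : ∀ j, ∀ y ∉ extChartAt I d '' L, u j y = 0 := by
    intro j y hy
    by_cases hyt : y ∈ (extChartAt I d).target
    · have h1 : (extChartAt I d).symm y ∉ L := fun h => hy ⟨_, h, (extChartAt I d).right_inv hyt⟩
      simp only [u, indicator_of_mem hyt, g]
      rw [h0 _ (Or.inl h1), map_zero, zero_mul]
    · exact indicator_of_notMem hyt _
  have hueq : ∀ j, ∀ y ∈ (extChartAt I d).target,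
      u j =ᶠ[𝓝[range I] y] fun y => g j ((extChartAt I d).symm y) := by
    intro j y hy
    filter_upwards [extChartAt_target_mem_nhdsWithin_of_mem hy] with w hw
    exact indicator_of_mem hw _
  have huz : ∀ j, ∀ y ∉ extChartAt I d '' L, u j =ᶠ[𝓝 y] fun _ => 0 := by
    intro j y hy
    filter_upwards [hLc.isClosed.isOpen_compl.mem_nhds hy] with w hw using hu0 j w hw
  have hfz : ∀ j, ∀ y ∉ extChartAt I d '' L, fderivWithin ℝ (u j) (range I) y = 0 := by
    intro j y hy
    rw [((huz j y hy).filter_mono nhdsWithin_le_nhds).fderivWithin_eq (hu0 j y hy)]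
    simp
  have hucd : ∀ j, ContDiffOn ℝ 1 (u j) (range I) := by
    intro j y hy
    by_cases hyL : y ∈ extChartAt I d '' L
    · have hyt := image_chart_subset hd hyL
      have h1 : ContMDiffWithinAt 𝓘(ℝ, EuclideanSpace ℝ (Fin n)) 𝓘(ℝ, ℝ) ∞
          (fun y => g j ((extChartAt I d).symm y)) (range I) y :=
        (hg j _ (symm_mem_source hyt)).comp_contMDiffWithinAt y
          (contMDiffWithinAt_extChartAt_symm_range d hyt)
      exact ((contMDiffWithinAt_iff_contDiffWithinAt.1 h1).of_le (by simp)).congr_of_eventuallyEq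
        (hueq j y hyt) (indicator_of_mem hyt _)
    · exact contDiffWithinAt_const.congr_of_eventuallyEq
        ((huz j y hyL).filter_mono nhdsWithin_le_nhds) (hu0 j y hyL)
  have hzero : ∀ j, ∫ y in range I, fderivWithin ℝ (u j) (range I) y
      (EuclideanSpace.single j (1 : ℝ)) = 0 := by
    intro j
    refine setIntegral_fderivWithin_eq_zero volume I.convex_range I.isClosed_range
      I.nonempty_interior (hucd j) (HasCompactSupport.intro hLc (hu0 j)) ?_ ?_ _
    · exact fun y hy => indicator_of_notMem (fun h => hy (extChartAt_target_subset_range d h)) _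
    · intro y hy
      by_cases hyt : y ∈ (extChartAt I d).target
      · simp only [u, indicator_of_mem hyt, g]
        rw [h0 _ (Or.inr (symm_mem_boundary hyt hy)), map_zero, zero_mul]
      · exact indicator_of_notMem hyt _
  have hval : ∀ y ∈ (extChartAt I d).target,
      volumeDiv I Ω X ((extChartAt I d).symm y) * density o Ω d ((extChartAt I d).symm y)
      = ∑ j, fderivWithin ℝ (u j) (range I) y (EuclideanSpace.single j (1 : ℝ)) := by
    intro y hy
    have hz := symm_mem_source hy
    rw [density, mul_left_comm, volumeDiv_mul_coef Ω hz (hX _), Finset.mul_sum]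
    refine Finset.sum_congr rfl fun j _ => ?_
    rw [(hueq j y hy).fderivWithin_eq (indicator_of_mem hy _),
      ← dirDeriv_coordField hy ((hg j _ hz).mdifferentiableAt (by simp)),
      ← dirDeriv_const_mul (f := fun w => coordComp I d j w (X w) * coef Ω d w)
        (((contMDiffAt_coordComp hz j (hX _)).mul
        (contMDiffAt_coef Ω hz)).mdifferentiableAt (by simp))]
    refine dirDeriv_congr ?_ _
    filter_upwards [density_eventuallyEq o Ω hz] with w hw
    simp only [g, hw]
    ring
  rw [chartInt, setIntegral_congr_fun (measurableSet_target I d) hval,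
    ← setIntegral_eq_of_subset_of_forall_sdiff_eq_zero I.isClosed_range.measurableSet
      (extChartAt_target_subset_range d), integral_finsetSum]
  · exact Finset.sum_eq_zero fun j _ => hzero j
  · intro j _
    refine IntegrableOn.of_forall_sdiff_eq_zero (s := extChartAt I d '' L) ?_
      I.isClosed_range.measurableSet ?_
    · refine ContinuousOn.integrableOn_compact hLc ?_
      have h1 := (hucd j).continuousOn_fderivWithin I.uniqueDiffOn le_rfl
      exact (h1.clm_apply continuousOn_const).mono
        ((image_chart_subset hd).trans (extChartAt_target_subset_range d))
    · intro y hy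
      rw [hfz j y hy.2]
      rfl
  · intro y hy
    refine Finset.sum_eq_zero fun j _ => ?_
    rw [hfz j y fun h => hy.2 (image_chart_subset hd h)]
    rfl

/-- The divergence theorem for vector fields that vanish on the boundary. -/
lemma volInt_volumeDiv {K : Set M} (hK : IsCompact K)
    (hX : ContMDiff I I.tangent ∞ (fun x => (⟨x, X x⟩ : TangentBundle I M)))
    (h0 : ∀ x, x ∉ K ∨ x ∈ I.boundary M → X x = 0) :
    volInt o Ω K (volumeDiv I Ω X) = 0 := by
  have hXc : ∀ c, ContMDiff I I.tangent ∞
      (fun x => (⟨x, chartPartition I M c x • X x⟩ : TangentBundle I M)) := fun c =>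
    (chartPartition I M c).contMDiff.smul_section hX
  -- The partition of unity splits the vector field rather than the integrand, so that every piece
  -- is itself a divergence supported in one chart.
  have hsum : X = fun x => ∑ c ∈ charts I hK, chartPartition I M c x • X x := by
    funext x
    rw [← Finset.sum_smul]
    by_cases hx : x ∈ K
    · rw [sum_chartPartition hK hx, one_smul]
    · rw [h0 x (Or.inl hx), smul_zero]
  have hdiv : volumeDiv I Ω X = fun z => ∑ c ∈ charts I hK,
      volumeDiv I Ω (fun x => chartPartition I M c x • X x) z := by
    funext z
    conv_lhs => rw [hsum]
    exact volumeDiv_sum Ω _ hXc z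
  rw [hdiv, volInt_sum o Ω hK _ fun c _ => continuous_volumeDiv Ω (hXc c)]
  refine Finset.sum_eq_zero fun c _ => ?_
  have hL : IsCompact (K ∩ tsupport (chartPartition I M c)) := hK.inter_right (isClosed_tsupport _)
  have hLc : K ∩ tsupport (chartPartition I M c) ⊆ (chartAt H c).source :=
    inter_subset_right.trans (tsupport_chartPartition c)
  have hzero : ∀ x, x ∉ K ∩ tsupport (chartPartition I M c) ∨ x ∈ I.boundary M →
      chartPartition I M c x • X x = 0 := by
    rintro x (hx | hx)
    · by_cases hxK : x ∈ K
      · rw [image_eq_zero_of_notMem_tsupport (f := chartPartition I M c) fun h => hx ⟨hxK, h⟩,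
          zero_smul]
      · rw [h0 x (Or.inl hxK), smul_zero]
    · rw [h0 x (Or.inr hx), smul_zero]
  rw [volInt_eq_chartInt o Ω hK hL inter_subset_left hLc (continuous_volumeDiv Ω (hXc c))]
  · exact chartInt_volumeDiv Ω o hL hLc (hXc c) hzero
  · intro z hz
    refine volumeDiv_eq_zero Ω (hXc c) ?_
    filter_upwards [hL.isClosed.isOpen_compl.mem_nhds hz] with w hw using hzero w (Or.inl hw)

/-- The fundamental lemma of the calculus of variations. -/
lemma eq_zero_of_volInt {h : M → ℝ} (hh : Continuous h)
    (H0 : ∀ K : Set M, IsCompact K → ∀ f : C^∞⟮I, M; ℝ⟯,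
      (∀ x, x ∉ K ∨ x ∈ I.boundary M → f x = 0) → volInt o Ω K (fun x => f x * h x) = 0)
    (x : M) : h x = 0 := by
  -- The zero set of `h` is closed and the interior is dense, so interior points suffice; there the
  -- test function can avoid the boundary.
  refine (isClosed_eq hh continuous_const).closure_subset_iff.2 ?_ (dense_interior I M x)
  intro x hx
  show h x = 0
  by_contra hne
  have hxs : x ∈ (chartAt H x).source := mem_chart_source H x
  have hcont := (contMDiffAt_density o Ω hxs).continuousAt
  have hpos : 0 < h x * density o Ω x x * (h x * density o Ω x x) :=
    mul_self_pos.2 (mul_ne_zero hne (density_ne_zero o Ω hxs))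
  have hU : ∀ᶠ y in 𝓝 x, 0 < h x * density o Ω x x * (h y * density o Ω x y) ∧
      y ∈ (chartAt H x).source ∧ y ∈ I.interior M := by
    filter_upwards [(continuousAt_const.mul (hh.continuousAt.mul hcont)).eventually_const_lt hpos,
      (chartAt H x).open_source.mem_nhds hxs,
      (I.isOpen_interior (n := ∞) (by simp)).mem_nhds hx] with y h1 h2 h3 using ⟨h1, h2, h3⟩
  obtain ⟨χ, hχc, hχU, hχ1, hχ0⟩ := exists_cutoff I hU
  have hint := H0 _ hχc.isCompact χ (by
    rintro y (hy | hy)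
    · exact image_eq_zero_of_notMem_tsupport hy
    · refine image_eq_zero_of_notMem_tsupport fun h' => ?_
      rw [← I.compl_interior] at hy
      exact hy (hχU h').2.2)
  have hsrc : tsupport χ ⊆ (chartAt H x).source := fun y hy => (hχU hy).2.1
  rw [volInt_eq_chartInt o Ω hχc.isCompact hχc.isCompact Subset.rfl hsrc
    (h := fun x => χ x * h x) (χ.contMDiff.continuous.mul hh)
    (fun z hz => by rw [image_eq_zero_of_notMem_tsupport hz, zero_mul])] at hint
  -- The constant factor, the value of `h` times the density at `x`, makes the integrand nonnegative
  -- on the support of `χ` and positive near `x`, whatever the sign of `h x`.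
  let k : M → ℝ := fun y => h x * density o Ω x x * (χ y * h y * density o Ω x y)
  have hk0 : ∀ y, 0 ≤ k y := by
    intro y
    by_cases hy : y ∈ tsupport χ
    · have h1 := (hχU hy).1
      have h2 := mul_nonneg (hχ0 y) h1.le
      calc (0 : ℝ) ≤ _ := h2
        _ = k y := by simp only [k]; ring
    · simp only [k, image_eq_zero_of_notMem_tsupport hy, zero_mul, mul_zero, le_refl]
  have hk : ∫ y in (extChartAt I x).target, k ((extChartAt I x).symm y) = 0 := by
    simp only [k]
    rw [integral_const_mul]
    exact mul_eq_zero_of_right _ hint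
  have hkint : IntegrableOn (fun y => k ((extChartAt I x).symm y)) (extChartAt I x).target := by
    refine IntegrableOn.of_forall_sdiff_eq_zero (s := extChartAt I x '' tsupport χ) ?_
      (measurableSet_target I x) ?_
    · refine ContinuousOn.integrableOn_compact (isCompact_image_chart hχc.isCompact hsrc) ?_
      refine (continuousOn_comp_symm (f := k) ?_).mono (image_chart_subset hsrc)
      exact continuousOn_const.mul ((χ.contMDiff.continuous.mul hh).continuousOn.mul
        (continuousOn_density o Ω x))
    · rintro y ⟨hy, hyn⟩
      have h1 : (extChartAt I x).symm y ∉ tsupport χ := fun h' =>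
        hyn ⟨_, h', (extChartAt I x).right_inv hy⟩
      simp only [k, image_eq_zero_of_notMem_tsupport h1, zero_mul, mul_zero]
  have hpos' := (setIntegral_pos_iff_support_of_nonneg_ae
    (Filter.Eventually.of_forall fun y => hk0 ((extChartAt I x).symm y)) hkint).2 ?_
  · exact hpos'.ne' hk
  · have hxt : extChartAt I x x ∈ (extChartAt I x).target := mem_extChartAt_target x
    have hxi : extChartAt I x x ∈ interior (range I) :=
      (symm_isInteriorPoint_iff hxt).1 (by rw [extChartAt_to_inv]; exact hx)
    have htn : (extChartAt I x).target ∈ 𝓝 (extChartAt I x x) := by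
      have h2 := extChartAt_target_mem_nhdsWithin_of_mem hxt
      rwa [nhdsWithin_eq_nhds.2 (mem_interior_iff_mem_nhds.1 hxi)] at h2
    have hsc : ContinuousAt (extChartAt I x).symm (extChartAt I x x) := continuousAt_extChartAt_symm x
    have hkx : ∀ᶠ y in 𝓝 x, 0 < k y := by
      filter_upwards [hU, hχ1] with y hy hy1
      simp only [k, hy1, one_mul]
      exact hy.1
    refine Measure.measure_pos_of_mem_nhds volume (x := extChartAt I x x) (Filter.inter_mem ?_ htn)
    have h3 : Filter.Tendsto (extChartAt I x).symm (𝓝 (extChartAt I x x)) (𝓝 x) := by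
      have := hsc.tendsto
      rwa [extChartAt_to_inv] at this
    filter_upwards [h3.eventually hkx] with y hy using hy.ne'

end Divergence


/-! ### Dependence of the curvature on the connection. -/

section ConnectionVariation

variable {n : ℕ} {H : Type*} [TopologicalSpace H]
  {I : ModelWithCorners ℝ (EuclideanSpace ℝ (Fin n)) H}
  {M : Type*} [TopologicalSpace M] [ChartedSpace H M] [IsManifold I ∞ M]
  {F : Type*} [NormedAddCommGroup F] [NormedSpace ℝ F]
  {E : M → Type*} [TopologicalSpace (TotalSpace F E)] [∀ x, AddCommGroup (E x)]
  [∀ x, Module ℝ (E x)] [∀ x, TopologicalSpace (E x)] [FiberBundle F E] [VectorBundle ℝ F E]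

variable [FiniteDimensional ℝ F] [ContMDiffVectorBundle ∞ F E I] [T2Space M] [SigmaCompactSpace M]
  {C : CourantAlgebroid I F E}

variable (C) in
/-- The tensors `n` such that `∇ + n` is a connection whenever `∇` is one. -/
structure CovTensor where
  /-- the underlying map -/
  map : Sec I F E →ₗ[ℝ] Sec I F E →ₗ[ℝ] Sec I F E
  fsmul_left : ∀ (f : C^∞⟮I, M; ℝ⟯) (ψ ψ' : Sec I F E), map (fsmul f ψ) ψ' = fsmul f (map ψ ψ')
  fsmul_right : ∀ (f : C^∞⟮I, M; ℝ⟯) (ψ ψ' : Sec I F E), map ψ (fsmul f ψ') = fsmul f (map ψ ψ')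
  skew : ∀ (ψ ψ' ψ'' : Sec I F E) (x : M),
    C.pairing x (map ψ ψ' x) (ψ'' x) + C.pairing x (ψ' x) (map ψ ψ'' x) = 0

namespace CovTensor

variable (N : CovTensor C)

lemma congr_left {ψ ψ' : Sec I F E} (φ : Sec I F E) {x : M} (h : ψ x = ψ' x) :
    N.map ψ φ x = N.map ψ' φ x :=
  tensorial_congr (A := fun ψ => N.map ψ φ x) (fun a b => by rw [map_add]; rfl)
    (fun f a => by rw [N.fsmul_left]; rfl) h

lemma congr_right (φ : Sec I F E) {ψ ψ' : Sec I F E} {x : M} (h : ψ x = ψ' x) :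
    N.map φ ψ x = N.map φ ψ' x :=
  tensorial_congr (A := fun ψ => N.map φ ψ x) (fun a b => by rw [map_add]; rfl)
    (fun f a => by rw [N.fsmul_right]; rfl) h

/-- The components of `n` with respect to sections `e`. -/
def comp {m : ℕ} (e : Fin m → Sec I F E) (x : M) (k i j : Fin m) : ℝ :=
  C.pairing x (N.map (e k) (e i) x) (e j x)

lemma comp_skew {m : ℕ} (e : Fin m → Sec I F E) (x : M) (k i j : Fin m) :
    N.comp e x k i j = -N.comp e x k j i := by
  have h := N.skew (e k) (e i) (e j) x
  rw [C.pairing_symm x (e i x)] at h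
  simp only [comp]
  linarith

/-- The product of a function with a tensor. -/
def fmul (h : C^∞⟮I, M; ℝ⟯) : CovTensor C where
  map := LinearMap.mk₂ ℝ (fun ψ ψ' => fsmul h (N.map ψ ψ'))
    (fun _ _ _ => by
      ext x
      simp only [map_add, LinearMap.add_apply, fsmul_apply, sec_add_apply, smul_add])
    (fun _ _ _ => by
      ext x
      simp only [map_smul, LinearMap.smul_apply, fsmul_apply, sec_smul_apply]
      rw [smul_comm])
    (fun _ _ _ => by
      ext x
      simp only [map_add, fsmul_apply, sec_add_apply, smul_add])
    (fun _ _ _ => by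
      ext x
      simp only [map_smul, fsmul_apply, sec_smul_apply]
      rw [smul_comm])
  fsmul_left f ψ ψ' := by
    ext x
    simp only [LinearMap.mk₂_apply, N.fsmul_left, fsmul_apply]
    rw [smul_comm]
  fsmul_right f ψ ψ' := by
    ext x
    simp only [LinearMap.mk₂_apply, N.fsmul_right, fsmul_apply]
    rw [smul_comm]
  skew ψ ψ' ψ'' x := by
    simp only [LinearMap.mk₂_apply, fsmul_apply, map_smul, LinearMap.smul_apply, smul_eq_mul]
    rw [← mul_add, N.skew, mul_zero]

lemma fmul_map_apply (h : C^∞⟮I, M; ℝ⟯) (ψ ψ' : Sec I F E) (x : M) :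
    (N.fmul h).map ψ ψ' x = h x • N.map ψ ψ' x := rfl

lemma fmul_comp (h : C^∞⟮I, M; ℝ⟯) {m : ℕ} (e : Fin m → Sec I F E) (x : M) (k i j : Fin m) :
    (N.fmul h).comp e x k i j = h x * N.comp e x k i j := by
  simp only [comp, fmul_map_apply, map_smul, LinearMap.smul_apply, smul_eq_mul]

end CovTensor

namespace Connection

variable (D : Connection C) (N : CovTensor C)

/-- The connection `∇ + ε n`. -/
def addTensor (ε : ℝ) : Connection C where
  cov := D.cov + ε • N.map
  cov_fsmul_left f ψ ψ' := by
    ext x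
    simp only [LinearMap.add_apply, LinearMap.smul_apply, D.cov_fsmul_left, N.fsmul_left,
      sec_add_apply, sec_smul_apply, fsmul_apply, smul_add]
    rw [smul_comm]
  cov_fsmul_right f ψ ψ' x := by
    simp only [LinearMap.add_apply, LinearMap.smul_apply, D.cov_fsmul_right, N.fsmul_right,
      sec_add_apply, sec_smul_apply, fsmul_apply, smul_add]
    rw [smul_comm ε]
    abel
  cov_pairing ψ ψ' ψ'' x := by
    have h := N.skew ψ ψ' ψ'' x
    simp only [LinearMap.add_apply, LinearMap.smul_apply, sec_add_apply, sec_smul_apply,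
      map_add, map_smul, smul_eq_mul]
    rw [D.cov_pairing ψ ψ' ψ'' x]
    linear_combination -ε * h

lemma addTensor_cov (ε : ℝ) (ψ ψ' : Sec I F E) :
    (D.addTensor N ε).cov ψ ψ' = D.cov ψ ψ' + ε • N.map ψ ψ' := rfl

/-- The linear part of `R⁰` of `∇ + ε n`. -/
def curvLin₀ (φ' φ ψ ψ' : Sec I F E) (x : M) : ℝ :=
  C.pairing x ((D.cov ψ (N.map ψ' φ) + N.map ψ (D.cov ψ' φ) - D.cov ψ' (N.map ψ φ)
    - N.map ψ' (D.cov ψ φ) - N.map (C.bracket ψ ψ') φ) x) (φ' x)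

lemma curv₀_addTensor (ε : ℝ) (φ' φ ψ ψ' : Sec I F E) (x : M) :
    (D.addTensor N ε).curv₀ φ' φ ψ ψ' x = D.curv₀ φ' φ ψ ψ' x + ε * D.curvLin₀ N φ' φ ψ ψ' x
      + ε ^ 2 * C.pairing x ((N.map ψ (N.map ψ' φ) - N.map ψ' (N.map ψ φ)) x) (φ' x) := by
  simp only [curv₀, curvLin₀, addTensor_cov, map_add, map_smul, sec_add_apply, sec_sub_apply,
    sec_smul_apply, map_sub, LinearMap.add_apply, LinearMap.sub_apply, LinearMap.smul_apply,
    smul_eq_mul]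
  ring

variable {m : ℕ} {η : Fin m → ℝ} {e : Fin m → Sec I F E}

variable (η e) in
/-- The linear part of the curvature of `∇ + ε n`, in an orthonormal frame. -/
def curvLin (φ' φ ψ ψ' : Sec I F E) (x : M) : ℝ :=
  (1 / 2) * (D.curvLin₀ N φ' φ ψ ψ' x + D.curvLin₀ N ψ' ψ φ φ' x
    + ∑ i, η i * (C.pairing x (N.map (e i) ψ x) (ψ' x) * C.pairing x (D.cov (e i) φ x) (φ' x)
      + C.pairing x (D.cov (e i) ψ x) (ψ' x) * C.pairing x (N.map (e i) φ x) (φ' x)))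

lemma exists_curv_addTensor {x : M} (h : IsOrthoFrame (C.pairing x) η (fun i => e i x))
    (hm : m = Module.finrank ℝ F) (φ' φ ψ ψ' : Sec I F E) :
    ∃ q : ℝ, ∀ ε : ℝ, (D.addTensor N ε).curv φ' φ ψ ψ' x
      = D.curv φ' φ ψ ψ' x + ε * D.curvLin N η e φ' φ ψ ψ' x + ε ^ 2 * q := by
  refine ⟨(1 / 2) * (C.pairing x ((N.map ψ (N.map ψ' φ) - N.map ψ' (N.map ψ φ)) x) (φ' x)
    + C.pairing x ((N.map φ (N.map φ' ψ) - N.map φ' (N.map φ ψ)) x) (ψ' x)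
    + ∑ i, η i * (C.pairing x (N.map (e i) ψ x) (ψ' x) * C.pairing x (N.map (e i) φ x) (φ' x))),
    fun ε => ?_⟩
  have hK : ∑ i, η i * C.pairing x ((D.addTensor N ε).cov (e i) ψ x) (ψ' x)
        * C.pairing x ((D.addTensor N ε).cov (e i) φ x) (φ' x)
      = ∑ i, η i * C.pairing x (D.cov (e i) ψ x) (ψ' x) * C.pairing x (D.cov (e i) φ x) (φ' x)
      + ε * ∑ i, η i * (C.pairing x (N.map (e i) ψ x) (ψ' x) * C.pairing x (D.cov (e i) φ x) (φ' x)
        + C.pairing x (D.cov (e i) ψ x) (ψ' x) * C.pairing x (N.map (e i) φ x) (φ' x))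
      + ε ^ 2 * ∑ i, η i *
        (C.pairing x (N.map (e i) ψ x) (ψ' x) * C.pairing x (N.map (e i) φ x) (φ' x)) := by
    rw [Finset.mul_sum, Finset.mul_sum, ← Finset.sum_add_distrib, ← Finset.sum_add_distrib]
    refine Finset.sum_congr rfl fun i _ => ?_
    simp only [addTensor_cov, sec_add_apply, sec_smul_apply, map_add, map_smul,
      LinearMap.add_apply, LinearMap.smul_apply, smul_eq_mul]
    ring
  simp only [curv, curvLin]
  rw [pairing_kVec_kVec _ h hm, pairing_kVec_kVec _ h hm, hK, curv₀_addTensor, curv₀_addTensor]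
  ring

lemma exists_ric_addTensor {x : M} (h : IsOrthoFrame (C.pairing x) η (fun i => e i x))
    (hm : m = Module.finrank ℝ F) (φ ψ : Sec I F E) :
    ∃ q : ℝ, ∀ ε : ℝ, (D.addTensor N ε).ric x (φ x) (ψ x)
      = D.ric x (φ x) (ψ x) + ε * ∑ i, η i * D.curvLin N η e (e i) φ (e i) ψ x + ε ^ 2 * q := by
  choose q hq using fun i => D.exists_curv_addTensor N h hm (e i) φ (e i) ψ
  refine ⟨∑ i, η i * q i, fun ε => ?_⟩
  rw [ric_eq_sum _ h hm, ric_eq_sum _ h hm, Finset.mul_sum, Finset.mul_sum,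
    ← Finset.sum_add_distrib, ← Finset.sum_add_distrib]
  refine Finset.sum_congr rfl fun i _ => ?_
  rw [hq]
  ring

/-- The linear part of the Ricci tensor of `∇ + ε n`. -/
def ricLin (x : M) (u v : E x) : ℝ :=
  ((D.addTensor N 1).ric x u v - (D.addTensor N (-1)).ric x u v) / 2

/-- The Ricci tensor is a polynomial of degree two in `ε`, so its coefficients are determined by the
values at `0`, `1` and `-1`. Half the difference of the values at `±1` is thus exactly the linear
coefficient; in this form it is visibly continuous and independent of the frame. -/
lemma ric_addTensor {x : M} (h : IsOrthoFrame (C.pairing x) η (fun i => e i x))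
    (hm : m = Module.finrank ℝ F) (ε : ℝ) (φ ψ : Sec I F E) :
    (D.addTensor N ε).ric x (φ x) (ψ x)
      = D.ric x (φ x) (ψ x) + ε * D.ricLin N x (φ x) (ψ x)
        + ε ^ 2 * ((D.addTensor N 1).ric x (φ x) (ψ x) - D.ricLin N x (φ x) (ψ x)
          - D.ric x (φ x) (ψ x)) := by
  obtain ⟨q, hq⟩ := D.exists_ric_addTensor N h hm φ ψ
  simp only [ricLin, hq]
  ring

lemma ricLin_eq {x : M} (h : IsOrthoFrame (C.pairing x) η (fun i => e i x))
    (hm : m = Module.finrank ℝ F) (φ ψ : Sec I F E) :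
    D.ricLin N x (φ x) (ψ x) = ∑ i, η i * D.curvLin N η e (e i) φ (e i) ψ x := by
  obtain ⟨q, hq⟩ := D.exists_ric_addTensor N h hm φ ψ
  simp only [ricLin, hq]
  ring

/-- The linear part of the scalar curvature of `∇ + ε n`. -/
def scalarLin (V : GeneralizedMetric C) (x : M) : ℝ :=
  ((D.addTensor N 1).scalar V.G x - (D.addTensor N (-1)).scalar V.G x) / 2

lemma continuous_scalarLin (V : GeneralizedMetric C) : Continuous (D.scalarLin N V) :=
  (((D.addTensor N 1).continuous_scalar_G V).sub
    ((D.addTensor N (-1)).continuous_scalar_G V)).div_const 2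

lemma scalarLin_eq {V : GeneralizedMetric C} {x₀ : M} (f : AdaptedFrame V x₀) {x : M}
    (hx : x ∈ f.dom) : D.scalarLin N V x = ∑ i, D.ricLin N x (f.e i x) (f.e i x) := by
  rw [scalarLin, scalar_G_eq_frame _ f hx, scalar_G_eq_frame _ f hx, ← Finset.sum_sub_distrib,
    Finset.sum_div]
  rfl

end Connection

end ConnectionVariation


/-! ### The index computation for the linearised scalar curvature. -/

section FrameAlgebra

variable {m : ℕ}

/-- The index identity behind the first variation of the scalar curvature. -/
lemma variation_sum_identity (η : Fin m → ℝ) (hη : ∀ i, η i * η i = 1)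
    (Γ B N : Fin m → Fin m → Fin m → ℝ) (P : Fin m → Fin m → ℝ)
    (hΓ : ∀ k i j, Γ k i j = -Γ k j i) (hN : ∀ k i j, N k i j = -N k j i)
    (hB : ∀ i j k, B i j k = -B j i k) :
    ∑ a, ∑ b, η b * ((1 / 2) *
        ((P a b + P b a + ∑ c, η c * (-(N a a c * Γ b b c) - Γ a a c * N b b c + N b a c * Γ a b c
          + Γ b a c * N a b c - B b a c * N c a b))
        + (P b a + P a b + ∑ c, η c * (-(N b b c * Γ a a c) - Γ b b c * N a a c
          + N a b c * Γ b a c + Γ a b c * N b a c - B a b c * N c b a))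
        + ∑ c, η c * (N c b a * Γ c a b + Γ c b a * N c a b)))
      = ∑ k, η k * (∑ a, (1 + η a * η k) * P a k
          - ∑ c, η c * (∑ a, (1 + η a * η c) * N a a c) * Γ k k c)
        + ∑ a, ∑ b, ∑ c, (η a * (η b - η c) * N a a c * Γ b b c
          + (η a + η b) * η c * N b a c * Γ a b c
          - (1 / 2) * (η a + η b) * η c * (B b a c + Γ c a b) * N c a b) := by
  -- Here `P a b` plays the role of the derivative of `N a a b` along the frame vector `b`; these
  -- are the only derivatives of `N` that occur, and `η² = 1` matches their weights with those in
  -- the divergence.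
  have hP : ∑ k, η k * ∑ a, (1 + η a * η k) * P a k = ∑ a, ∑ b, (η a + η b) * P a b := by
    rw [Finset.sum_comm]
    refine Finset.sum_congr rfl fun k _ => ?_
    rw [Finset.mul_sum]
    refine Finset.sum_congr rfl fun a _ => ?_
    linear_combination η a * P a k * hη k
  have hY : ∑ k, η k * ∑ c, η c * (∑ a, (1 + η a * η c) * N a a c) * Γ k k c
      = ∑ a, ∑ b, ∑ c, η b * (η c + η a) * N a a c * Γ b b c := by
    rw [Finset.sum_comm]
    refine Finset.sum_congr rfl fun k _ => ?_
    rw [Finset.mul_sum, Finset.sum_comm]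
    refine Finset.sum_congr rfl fun c _ => ?_
    rw [Finset.mul_sum, Finset.sum_mul, Finset.mul_sum]
    refine Finset.sum_congr rfl fun a _ => ?_
    linear_combination η k * η a * N a a c * Γ k k c * hη c
  have hswap : ∀ G : Fin m → Fin m → Fin m → ℝ,
      ∑ a, ∑ b, ∑ c, G a b c = ∑ a, ∑ b, ∑ c, G b a c := fun G => Finset.sum_comm
  have hLP : ∑ a, ∑ b, η b * (P a b + P b a) = ∑ a, ∑ b, (η a + η b) * P a b := by
    have h1 : ∑ a, ∑ b, η b * P b a = ∑ a, ∑ b, η a * P a b := Finset.sum_comm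
    simp only [mul_add, add_mul, Finset.sum_add_distrib, h1]
    ring
  have hL : ∑ a, ∑ b, η b * ((1 / 2) *
        ((P a b + P b a + ∑ c, η c * (-(N a a c * Γ b b c) - Γ a a c * N b b c + N b a c * Γ a b c
          + Γ b a c * N a b c - B b a c * N c a b))
        + (P b a + P a b + ∑ c, η c * (-(N b b c * Γ a a c) - Γ b b c * N a a c
          + N a b c * Γ b a c + Γ a b c * N b a c - B a b c * N c b a))
        + ∑ c, η c * (N c b a * Γ c a b + Γ c b a * N c a b)))
      = ∑ a, ∑ b, η b * (P a b + P b a) + ∑ a, ∑ b, ∑ c, η b * η c *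
        (-(N a a c * Γ b b c) - Γ a a c * N b b c + N b a c * Γ a b c
          + Γ b a c * N a b c - B b a c * N c a b - N c a b * Γ c a b) := by
    rw [← Finset.sum_add_distrib]
    refine Finset.sum_congr rfl fun a _ => ?_
    rw [← Finset.sum_add_distrib]
    refine Finset.sum_congr rfl fun b _ => ?_
    have h : ∀ s t u w p : ℝ, s + t + u = 2 * w → η b * ((1 / 2) * ((p + s) + (p + t) + u))
        = η b * p + η b * w := by
      intro s t u w p hw
      linear_combination (1 / 2) * η b * hw
    simp only [add_comm (P b a) (P a b)]
    rw [h _ _ _ (∑ c, η c * (-(N a a c * Γ b b c) - Γ a a c * N b b c + N b a c * Γ a b c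
          + Γ b a c * N a b c - B b a c * N c a b - N c a b * Γ c a b))]
    · congr 1
      rw [Finset.mul_sum]
      exact Finset.sum_congr rfl fun c _ => by ring
    · rw [← Finset.sum_add_distrib, ← Finset.sum_add_distrib, Finset.mul_sum]
      refine Finset.sum_congr rfl fun c _ => ?_
      rw [hB a b c, hN c b a, hΓ c b a]
      ring
  rw [hL, hLP]
  simp only [mul_sub, Finset.sum_sub_distrib] at hP hY ⊢
  rw [hP, hY]
  have key : ∑ a, ∑ b, ∑ c, η b * η c *
        (-(N a a c * Γ b b c) - Γ a a c * N b b c + N b a c * Γ a b c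
          + Γ b a c * N a b c - B b a c * N c a b - N c a b * Γ c a b)
      = -∑ a, ∑ b, ∑ c, η b * (η c + η a) * N a a c * Γ b b c
        + ∑ a, ∑ b, ∑ c, (η a * (η b - η c) * N a a c * Γ b b c
          + (η a + η b) * η c * N b a c * Γ a b c
          - (1 / 2) * (η a + η b) * η c * (B b a c + Γ c a b) * N c a b) := by
    rw [← sub_eq_zero, ← Finset.sum_neg_distrib]
    simp only [← Finset.sum_neg_distrib, ← Finset.sum_add_distrib, ← Finset.sum_sub_distrib]
    -- The two sides differ by `G a b c - G b a c`, which sums to zero.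
    let G : Fin m → Fin m → Fin m → ℝ := fun a b c =>
      η a * η c * N a a c * Γ b b c - η a * η c * N b a c * Γ a b c
      + (1 / 2) * η a * η c * (B b a c + Γ c a b) * N c a b
    have h0 : ∑ a, ∑ b, ∑ c, (G a b c - G b a c) = 0 := by
      simp only [Finset.sum_sub_distrib]
      rw [hswap G, sub_self]
    rw [← h0]
    refine Finset.sum_congr rfl fun a _ => Finset.sum_congr rfl fun b _ =>
      Finset.sum_congr rfl fun c _ => ?_
    simp only [G]
    rw [hB a b c, hN c b a, hΓ c b a]
    ring
  simp only [mul_sub, sub_mul, Finset.sum_sub_distrib] at key ⊢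
  rw [key]
  ring

end FrameAlgebra


/-! ### The contraction of the variation, and the linearised curvature as a divergence. -/

section Contraction

variable {n : ℕ} {H : Type*} [TopologicalSpace H]
  {I : ModelWithCorners ℝ (EuclideanSpace ℝ (Fin n)) H}
  {M : Type*} [TopologicalSpace M] [ChartedSpace H M] [IsManifold I ∞ M]
  {F : Type*} [NormedAddCommGroup F] [NormedSpace ℝ F]
  {E : M → Type*} [TopologicalSpace (TotalSpace F E)] [∀ x, AddCommGroup (E x)]
  [∀ x, Module ℝ (E x)] [∀ x, TopologicalSpace (E x)] [FiberBundle F E] [VectorBundle ℝ F E]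

variable [FiniteDimensional ℝ F] [ContMDiffVectorBundle ∞ F E I] [T2Space M] [SigmaCompactSpace M]
  {C : CourantAlgebroid I F E}

lemma AdaptedFrame.card {V : GeneralizedMetric C} {x₀ : M} (f : AdaptedFrame V x₀) (x : M) :
    f.m = Module.finrank ℝ (E x) :=
  f.card_eq.trans (GeneralizedMetric.finrank_fiber x).symm

namespace CovTensor

variable (N : CovTensor C) (V : GeneralizedMetric C)

/-- The tensor `n`, evaluated on vectors of the fibre over `x` and paired with a vector. -/
def form (x : M) (w : E x) : E x →ₗ[ℝ] E x →ₗ[ℝ] ℝ :=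
  LinearMap.mk₂ ℝ (fun a b => C.pairing x (N.map (ext I F x a) (ext I F x b) x) w)
    (fun _ _ _ => by simp only [map_add, LinearMap.add_apply, sec_add_apply])
    (fun _ _ _ => by simp only [map_smul, LinearMap.smul_apply, sec_smul_apply])
    (fun _ _ _ => by simp only [map_add, LinearMap.add_apply, sec_add_apply])
    (fun _ _ _ => by simp only [map_smul, LinearMap.smul_apply, sec_smul_apply])

lemma form_apply (ψ φ : Sec I F E) (x : M) (w : E x) :
    N.form x w (ψ x) (φ x) = C.pairing x (N.map ψ φ x) w := by
  simp only [form, LinearMap.mk₂_apply]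
  rw [N.congr_left _ (ext_apply x (ψ x)), N.congr_right _ (ext_apply x (φ x))]

/-- The vector `∑ₐ (n(eₐ, eₐ) + ηₐ 𝒢 n(eₐ, eₐ))`. -/
def frameContraction {x₀ : M} (f : AdaptedFrame V x₀) (x : M) : E x :=
  ∑ a, (N.map (f.e a) (f.e a) x + f.η a • V.invol x (N.map (f.e a) (f.e a) x))

variable {V}

/-- Both terms are metric traces and do not refer to the frame; this is why the contractions formed
in different adapted frames agree. -/
lemma pairing_frameContraction {x₀ : M} (f : AdaptedFrame V x₀) {x : M} (hx : x ∈ f.dom)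
    (w : E x) : haveI : FiniteDimensional ℝ (E x) := VectorBundle.finiteDimensional ℝ F E x
      C.pairing x (N.frameContraction V f x) w
      = metricTrace (V.G x) (fun u v => N.form x w u v)
        + metricTrace (C.pairing x) (fun u v => N.form x (V.invol x w) u v) := by
  have : FiniteDimensional ℝ (E x) := VectorBundle.finiteDimensional ℝ F E x
  rw [V.metricTrace_G (f.ortho x hx) f.card_eq, (f.ortho x hx).metricTrace_eq (f.card x)
    (C.pairing_nondegenerate x) (C.pairing_symm x), ← Finset.sum_add_distrib,
    frameContraction, map_sum, LinearMap.sum_apply]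
  refine Finset.sum_congr rfl fun a _ => ?_
  rw [f.invol_apply hx, map_smul, form_apply, form_apply, map_add, map_smul, LinearMap.add_apply,
    LinearMap.smul_apply, V.pairing_invol, smul_eq_mul, smul_eq_mul, ← mul_assoc,
    (f.ortho x hx).mul_self, one_mul]

lemma frameContraction_eq {x₀ x₁ : M} (f : AdaptedFrame V x₀) (g : AdaptedFrame V x₁) {x : M}
    (hx : x ∈ f.dom) (hx' : x ∈ g.dom) :
    N.frameContraction V f x = N.frameContraction V g x :=
  C.ext_pairing fun w => by
    rw [N.pairing_frameContraction f hx, N.pairing_frameContraction g hx']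

lemma pairing_frameContraction_frame {x₀ : M} (f : AdaptedFrame V x₀) {x : M} (hx : x ∈ f.dom)
    (k : Fin f.m) : C.pairing x (N.frameContraction V f x) (f.e k x)
      = ∑ a, (1 + f.η a * f.η k) * N.comp f.e x a a k := by
  rw [frameContraction, map_sum, LinearMap.sum_apply]
  refine Finset.sum_congr rfl fun a _ => ?_
  rw [map_add, map_smul, LinearMap.add_apply, LinearMap.smul_apply, V.pairing_invol,
    f.invol_apply hx, map_smul, comp, smul_eq_mul, smul_eq_mul]
  ring

lemma exists_section_frameContraction {x₀ : M} (f : AdaptedFrame V x₀) :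
    ∃ Z : Sec I F E, ∀ x ∈ f.dom, Z x = N.frameContraction V f x := by
  refine ⟨∑ k, fsmul (∑ a, (f.η k * (1 + f.η a * f.η k)) •
    C.pair (N.map (f.e a) (f.e a)) (f.e k)) (f.e k), fun x hx => ?_⟩
  have : FiniteDimensional ℝ (E x) := VectorBundle.finiteDimensional ℝ F E x
  rw [sec_sum_apply, ← (f.ortho x hx).sum_coord (f.card x) (N.frameContraction V f x)]
  refine Finset.sum_congr rfl fun k _ => ?_
  rw [fsmul_apply, N.pairing_frameContraction_frame f hx, Finset.mul_sum]
  congr 1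
  have : ∀ s : Finset (Fin f.m), (∑ a ∈ s, (f.η k * (1 + f.η a * f.η k)) •
      C.pair (N.map (f.e a) (f.e a)) (f.e k)) x
      = ∑ a ∈ s, f.η k * ((1 + f.η a * f.η k) * N.comp f.e x a a k) := by
    intro s
    induction s using Finset.induction_on with
    | empty => rfl
    | insert a s ha ih =>
      rw [Finset.sum_insert ha, Finset.sum_insert ha, ← ih, ← mul_assoc]
      rfl
  exact this _

variable (V)

/-- The section `Y` with `⟨Y, v⟩ = Tr_G n(·, ·, v) + Tr_g n(·, ·, 𝒢 v)`. -/
def contraction : Sec I F E where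
  toFun x := N.frameContraction V (Classical.choice (nonempty_adaptedFrame V x)) x
  contMDiff_toFun x₀ := by
    obtain ⟨f⟩ := nonempty_adaptedFrame V x₀
    obtain ⟨Z, hZ⟩ := N.exists_section_frameContraction f
    -- The frame chosen at each point is uncontrolled, but by independence of the frame the section
    -- agrees near `x₀` with the one built from the single frame `f`.
    refine (Z.contMDiff x₀).congr_of_eventuallyEq ?_
    filter_upwards [f.dom_mem_nhds] with x hx
    rw [hZ x hx, N.frameContraction_eq f _ hx (AdaptedFrame.mem_dom _)]

variable {V}

lemma contraction_apply {x₀ : M} (f : AdaptedFrame V x₀) {x : M} (hx : x ∈ f.dom) :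
    N.contraction V x = N.frameContraction V f x :=
  N.frameContraction_eq _ f (AdaptedFrame.mem_dom _) hx

lemma contraction_eq_zero {x : M} (h : ∀ ψ φ, N.map ψ φ x = 0) : N.contraction V x = 0 := by
  change N.frameContraction V _ x = 0
  unfold frameContraction
  refine Finset.sum_eq_zero fun a _ => ?_
  rw [h, map_zero, smul_zero, add_zero]

end CovTensor

/-- The components of a connection with respect to sections `e`. -/
def Connection.comp (D : Connection C) {m : ℕ} (e : Fin m → Sec I F E) (x : M)
    (k i j : Fin m) : ℝ := C.pairing x (D.cov (e k) (e i) x) (e j x)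

/-- The components of the bracket with respect to sections `e`. -/
def CourantAlgebroid.bracketComp (C : CourantAlgebroid I F E) {m : ℕ} (e : Fin m → Sec I F E)
    (x : M) (k i j : Fin m) : ℝ := C.pairing x (C.bracket (e k) (e i) x) (e j x)

namespace AdaptedFrame

variable {V : GeneralizedMetric C} {x₀ : M} (f : AdaptedFrame V x₀) {x : M} (hx : x ∈ f.dom)

include hx

/-- The frame is orthonormal on an open set, so its pairings are locally constant. The
skew-symmetries of the connection and bracket coefficients below all come from this. -/
lemma act_pairing_eq_zero (v : E x) (i j : Fin f.m) :
    C.act x v (fun z => C.pairing z (f.e i z) (f.e j z)) = 0 := by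
  rw [← C.act_const x v (if i = j then f.η i else 0)]
  refine C.act_congr v ?_
  filter_upwards [f.isOpen_dom.mem_nhds hx] with z hz using (f.ortho z hz).ortho i j

lemma comp_skew (D : Connection C) (k i j : Fin f.m) :
    D.comp f.e x k i j = -D.comp f.e x k j i := by
  have h := D.act_pairing (f.e k) (f.e i) (f.e j) x
  rw [f.act_pairing_eq_zero hx, C.pairing_symm x (f.e i x)] at h
  simp only [Connection.comp]
  linarith

lemma bracketComp_skew (k i j : Fin f.m) :
    C.bracketComp f.e x k i j = -C.bracketComp f.e x k j i := by
  have h := C.act_pairing (f.e k) (f.e i) (f.e j) x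
  rw [f.act_pairing_eq_zero hx, C.pairing_symm x (f.e i x)] at h
  simp only [CourantAlgebroid.bracketComp]
  linarith

lemma bracketComp_skew_left (k i j : Fin f.m) :
    C.bracketComp f.e x k i j = -C.bracketComp f.e x i k j := by
  have h := C.bracket_add_swap (f.e k) (f.e i) (f.e j) x
  rw [f.act_pairing_eq_zero hx] at h
  simp only [CourantAlgebroid.bracketComp]
  linarith

lemma pairing_eq (u v : E x) :
    C.pairing x u v = ∑ i, f.η i * C.pairing x u (f.e i x) * C.pairing x v (f.e i x) :=
  haveI : FiniteDimensional ℝ (E x) := VectorBundle.finiteDimensional ℝ F E x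
  (f.ortho x hx).pairing_eq (f.card x) u v

/-- Metric compatibility of `D` moves the derivatives of `N (e a, e a)` and `N (e b, e a)` onto
frame components, and skewness of `N` moves it off the covariant derivatives of the frame. The
bracket term is expanded in its first slot by tensoriality. -/
lemma curvLin₀_eq (D : Connection C) (N : CovTensor C) (a b : Fin f.m) :
    D.curvLin₀ N (f.e b) (f.e a) (f.e b) (f.e a) x
      = C.act x (f.e b x) (fun z => N.comp f.e z a a b)
        + C.act x (f.e a x) (fun z => N.comp f.e z b b a)
        + ∑ c, f.η c * (-(N.comp f.e x a a c * D.comp f.e x b b c)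
          - D.comp f.e x a a c * N.comp f.e x b b c + N.comp f.e x b a c * D.comp f.e x a b c
          + D.comp f.e x b a c * N.comp f.e x a b c
          - C.bracketComp f.e x b a c * N.comp f.e x c a b) := by
  have : FiniteDimensional ℝ (E x) := VectorBundle.finiteDimensional ℝ F E x
  have h1 := D.act_pairing (f.e b) (N.map (f.e a) (f.e a)) (f.e b) x
  have h3 := D.act_pairing (f.e a) (N.map (f.e b) (f.e a)) (f.e b) x
  have h3' : C.act x (f.e a x) (fun z => C.pairing z (N.map (f.e b) (f.e a) z) (f.e b z))
      = -C.act x (f.e a x) (fun z => N.comp f.e z b b a) := by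
    have h := C.act_const_mul (f.e a x) (f := fun z => N.comp f.e z b b a)
      (C.pairing_mdifferentiableAt (N.map (f.e b) (f.e b)) (f.e a) x) (-1)
    rw [← neg_one_mul, ← h]
    refine C.act_congr _ (Filter.Eventually.of_forall fun z => ?_)
    change _ = -1 * N.comp f.e z b b a
    rw [neg_one_mul]
    exact N.comp_skew f.e z b a b
  have h2 := N.skew (f.e b) (D.cov (f.e a) (f.e a)) (f.e b) x
  have h4 := N.skew (f.e a) (D.cov (f.e b) (f.e a)) (f.e b) x
  have h5 : C.pairing x (N.map (C.bracket (f.e b) (f.e a)) (f.e a) x) (f.e b x)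
      = ∑ c, f.η c * C.bracketComp f.e x b a c * N.comp f.e x c a b := by
    rw [N.congr_left (ψ' := ∑ c, (f.η c * C.bracketComp f.e x b a c) • f.e c)]
    · rw [map_sum, LinearMap.sum_apply, sec_sum_apply, map_sum, LinearMap.sum_apply]
      refine Finset.sum_congr rfl fun c _ => ?_
      rw [map_smul, LinearMap.smul_apply, sec_smul_apply, map_smul, LinearMap.smul_apply]
      rfl
    · rw [sec_sum_apply]
      exact ((f.ortho x hx).sum_coord (f.card x) _).symm
  rw [f.pairing_eq hx (N.map (f.e a) (f.e a) x)] at h1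
  rw [f.pairing_eq hx (N.map (f.e b) (f.e a) x), h3'] at h3
  rw [f.pairing_eq hx (D.cov (f.e a) (f.e a) x)] at h2
  rw [f.pairing_eq hx (D.cov (f.e b) (f.e a) x)] at h4
  simp only [Connection.curvLin₀, sec_sub_apply, sec_add_apply, map_sub, map_add,
    LinearMap.sub_apply, LinearMap.add_apply]
  rw [h5]
  have h6 : ∑ c, f.η c * (-(N.comp f.e x a a c * D.comp f.e x b b c)
          - D.comp f.e x a a c * N.comp f.e x b b c + N.comp f.e x b a c * D.comp f.e x a b c
          + D.comp f.e x b a c * N.comp f.e x a b c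
          - C.bracketComp f.e x b a c * N.comp f.e x c a b)
      = -∑ c, f.η c * N.comp f.e x a a c * D.comp f.e x b b c
        - ∑ c, f.η c * D.comp f.e x a a c * N.comp f.e x b b c
        + ∑ c, f.η c * N.comp f.e x b a c * D.comp f.e x a b c
        + ∑ c, f.η c * D.comp f.e x b a c * N.comp f.e x a b c
        - ∑ c, f.η c * C.bracketComp f.e x b a c * N.comp f.e x c a b := by
    rw [← Finset.sum_neg_distrib, ← Finset.sum_sub_distrib, ← Finset.sum_add_distrib,
      ← Finset.sum_add_distrib, ← Finset.sum_sub_distrib]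
    exact Finset.sum_congr rfl fun c _ => by ring
  rw [h6]
  simp only [Connection.comp, CovTensor.comp] at *
  linarith

lemma div_contraction_eq (D : Connection C) (N : CovTensor C) :
    D.div (N.contraction V) x
      = ∑ k, f.η k * (∑ a, (1 + f.η a * f.η k)
            * C.act x (f.e k x) (fun z => N.comp f.e z a a k)
          - ∑ c, f.η c * (∑ a, (1 + f.η a * f.η c) * N.comp f.e x a a c)
            * D.comp f.e x k k c) := by
  have : FiniteDimensional ℝ (E x) := VectorBundle.finiteDimensional ℝ F E x
  rw [D.div_eq_sum (f.ortho x hx) f.card_eq]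
  refine Finset.sum_congr rfl fun k _ => ?_
  congr 1
  have h := D.act_pairing (f.e k) (N.contraction V) (f.e k) x
  rw [f.pairing_eq hx (N.contraction V x)] at h
  have h1 : C.act x (f.e k x) (fun z => C.pairing z (N.contraction V z) (f.e k z))
      = ∑ a, (1 + f.η a * f.η k) * C.act x (f.e k x) (fun z => N.comp f.e z a a k) := by
    have hmd : ∀ a, MDifferentiableAt I 𝓘(ℝ, ℝ) (fun z => N.comp f.e z a a k) x := fun a =>
      C.pairing_mdifferentiableAt _ _ _
    rw [← Finset.sum_congr rfl fun a _ => C.act_const_mul (f.e k x) (hmd a) _, ← C.act_sum]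
    · refine C.act_congr _ ?_
      filter_upwards [f.isOpen_dom.mem_nhds hx] with z hz
      rw [N.contraction_apply f hz, N.pairing_frameContraction_frame f hz]
    · exact fun a _ => (hmd a).const_smul (1 + f.η a * f.η k)
  have h2 : ∀ c, C.pairing x (N.contraction V x) (f.e c x)
      = ∑ a, (1 + f.η a * f.η c) * N.comp f.e x a a c := fun c => by
    rw [N.contraction_apply f hx, N.pairing_frameContraction_frame f hx]
  rw [h1] at h
  simp only [h2] at h
  simp only [Connection.comp] at *
  linarith

/-- The linear part of the scalar curvature is a divergence up to an algebraic term. -/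
lemma scalarLin_eq_div_add (D : Connection C) (N : CovTensor C) :
    D.scalarLin N V x = D.div (N.contraction V) x
      + ∑ a, ∑ b, ∑ c, (f.η a * (f.η b - f.η c) * N.comp f.e x a a c * D.comp f.e x b b c
          + (f.η a + f.η b) * f.η c * N.comp f.e x b a c * D.comp f.e x a b c
          - (1 / 2) * (f.η a + f.η b) * f.η c
            * (C.bracketComp f.e x b a c + D.comp f.e x c a b) * N.comp f.e x c a b) := by
  rw [f.div_contraction_eq hx, ← variation_sum_identity f.η (f.ortho x hx).mul_self
    (D.comp f.e x) (C.bracketComp f.e x) (N.comp f.e x)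
    (fun a k => C.act x (f.e k x) (fun z => N.comp f.e z a a k))
    (f.comp_skew hx D) (N.comp_skew f.e x) (f.bracketComp_skew_left hx),
    D.scalarLin_eq N f hx]
  refine Finset.sum_congr rfl fun a _ => ?_
  rw [D.ricLin_eq N (f.ortho x hx) f.card_eq]
  refine Finset.sum_congr rfl fun b _ => ?_
  rw [Connection.curvLin, f.curvLin₀_eq hx, f.curvLin₀_eq hx]
  rfl

end AdaptedFrame

end Contraction



/-! ### First-order expansions that are locally uniform in the point. -/

section Jets

variable {M : Type*} [TopologicalSpace M]

/-- `F ε x = F₀ x + ε F₁ x + O(ε²)` uniformly for `x` near `x₀`, with continuous coefficients. -/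
structure HasJet (F : ℝ → M → ℝ) (F₀ F₁ : M → ℝ) (x₀ : M) : Prop where
  zero : ContinuousAt F₀ x₀
  one : ContinuousAt F₁ x₀
  isBigO : (fun p : ℝ × M => F p.1 p.2 - F₀ p.2 - p.1 * F₁ p.2)
    =O[𝓝 0 ×ˢ 𝓝 x₀] (fun p : ℝ × M => p.1 ^ 2)

namespace HasJet

variable {F G : ℝ → M → ℝ} {F₀ F₁ G₀ G₁ : M → ℝ} {x₀ : M}

lemma isBigO_one_of_continuousAt (h : ContinuousAt F₀ x₀) :
    (fun p : ℝ × M => F₀ p.2) =O[𝓝 0 ×ˢ 𝓝 x₀] (fun _ => (1 : ℝ)) :=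
  (h.tendsto.comp Filter.tendsto_snd).isBigO_one ℝ

lemma isBigO_fst : (fun p : ℝ × M => p.1) =O[𝓝 0 ×ˢ 𝓝 x₀] (fun _ => (1 : ℝ)) :=
  (Filter.tendsto_fst (f := 𝓝 (0 : ℝ)) (g := 𝓝 x₀)).isBigO_one ℝ

lemma isBigO_sq : (fun p : ℝ × M => p.1 ^ 2) =O[𝓝 0 ×ˢ 𝓝 x₀] (fun _ => (1 : ℝ)) := by
  simpa using (isBigO_fst (x₀ := x₀)).pow 2

lemma of_continuousAt (h : ContinuousAt F₀ x₀) : HasJet (fun _ => F₀) F₀ (fun _ => 0) x₀ :=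
  ⟨h, continuousAt_const, by simpa using Asymptotics.isBigO_zero _ _⟩

lemma add (hF : HasJet F F₀ F₁ x₀) (hG : HasJet G G₀ G₁ x₀) :
    HasJet (fun ε x => F ε x + G ε x) (fun x => F₀ x + G₀ x) (fun x => F₁ x + G₁ x) x₀ :=
  ⟨hF.zero.add hG.zero, hF.one.add hG.one,
    (hF.isBigO.add hG.isBigO).congr_left fun p => by ring⟩

lemma mul (hF : HasJet F F₀ F₁ x₀) (hG : HasJet G G₀ G₁ x₀) :
    HasJet (fun ε x => F ε x * G ε x) (fun x => F₀ x * G₀ x)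
      (fun x => F₀ x * G₁ x + F₁ x * G₀ x) x₀ := by
  refine ⟨hF.zero.mul hG.zero, (hF.zero.mul hG.one).add (hF.one.mul hG.zero), ?_⟩
  have a0 := isBigO_one_of_continuousAt hF.zero
  have a1 := isBigO_one_of_continuousAt hF.one
  have b0 := isBigO_one_of_continuousAt hG.zero
  have b1 := isBigO_one_of_continuousAt hG.one
  have hfst := isBigO_fst (x₀ := x₀)
  have r := hF.isBigO
  have s := hG.isBigO
  have t1 := (Asymptotics.isBigO_refl (fun p : ℝ × M => p.1 ^ 2) (𝓝 0 ×ˢ 𝓝 x₀)).mul (a1.mul b1)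
  have g1 := (b0.add ((hfst.mul b1).congr_right fun _ => one_mul _)).add (s.trans isBigO_sq)
  have t2 := r.mul g1
  have f1 := a0.add ((hfst.mul a1).congr_right fun _ => one_mul _)
  have t3 := f1.mul s
  have e1 : ∀ p : ℝ × M, p.1 ^ 2 * (1 * 1) = p.1 ^ 2 := fun p => by ring
  have e2 : ∀ p : ℝ × M, p.1 ^ 2 * 1 = p.1 ^ 2 := fun p => by ring
  have e3 : ∀ p : ℝ × M, 1 * p.1 ^ 2 = p.1 ^ 2 := fun p => by ring
  refine (((t1.congr_right e1).add (t2.congr_right e2)).add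
    (t3.congr_right e3)).congr_left fun p => ?_
  ring

lemma congr (hF : HasJet F F₀ F₁ x₀) (h : ∀ᶠ p in 𝓝 (0 : ℝ) ×ˢ 𝓝 x₀, G p.1 p.2 = F p.1 p.2)
    (h₀ : ∀ᶠ x in 𝓝 x₀, G₀ x = F₀ x) (h₁ : ∀ᶠ x in 𝓝 x₀, G₁ x = F₁ x) : HasJet G G₀ G₁ x₀ := by
  refine ⟨hF.zero.congr (h₀.mono fun x hx => hx.symm), hF.one.congr (h₁.mono fun x hx => hx.symm),
    hF.isBigO.congr' ?_ Filter.EventuallyEq.rfl⟩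
  filter_upwards [h, Filter.tendsto_snd.eventually h₀, Filter.tendsto_snd.eventually h₁]
    with p hp h0 h1
  rw [hp, h0, h1]

lemma sum {ι : Type*} (s : Finset ι) {F : ι → ℝ → M → ℝ} {F₀ F₁ : ι → M → ℝ}
    (h : ∀ i ∈ s, HasJet (F i) (F₀ i) (F₁ i) x₀) :
    HasJet (fun ε x => ∑ i ∈ s, F i ε x) (fun x => ∑ i ∈ s, F₀ i x) (fun x => ∑ i ∈ s, F₁ i x)
      x₀ := by
  classical
  induction s using Finset.induction_on with
  | empty => simpa using of_continuousAt (continuousAt_const (x := x₀) (y := (0 : ℝ)))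
  | insert a s ha ih =>
    simp only [Finset.sum_insert ha]
    exact (h a (Finset.mem_insert_self a s)).add
      (ih fun i hi => h i (Finset.mem_insert_of_mem hi))

lemma exp {f : M → ℝ} (hf : ContinuousAt f x₀) :
    HasJet (fun ε x => Real.exp (ε * f x)) (fun _ => 1) f x₀ := by
  refine ⟨continuousAt_const, hf, ?_⟩
  have ht : Filter.Tendsto (fun p : ℝ × M => p.1 * f p.2) (𝓝 0 ×ˢ 𝓝 x₀) (𝓝 0) := by
    simpa using (Filter.tendsto_fst (f := 𝓝 (0 : ℝ)) (g := 𝓝 x₀)).mul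
      (hf.tendsto.comp Filter.tendsto_snd)
  have h1 : (fun p : ℝ × M => Real.exp (p.1 * f p.2) - 1 - p.1 * f p.2)
      =O[𝓝 0 ×ˢ 𝓝 x₀] (fun p : ℝ × M => (p.1 * f p.2) ^ 2) := by
    refine Asymptotics.IsBigO.of_bound 1 ?_
    filter_upwards [ht.eventually (Metric.closedBall_mem_nhds (0 : ℝ) one_pos)] with p hp
    rw [one_mul, Real.norm_eq_abs, Real.norm_eq_abs, abs_of_nonneg (sq_nonneg (p.1 * f p.2))]
    refine Real.abs_exp_sub_one_sub_id_le ?_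
    simpa using hp
  refine h1.trans ?_
  have := (Asymptotics.isBigO_refl (fun p : ℝ × M => p.1 ^ 2) (𝓝 0 ×ˢ 𝓝 x₀)).mul
    ((isBigO_one_of_continuousAt hf).pow 2)
  exact this.congr (fun p => by ring) (fun p => by ring)

lemma quadratic {F₂ : M → ℝ} (h₀ : ContinuousAt F₀ x₀) (h₁ : ContinuousAt F₁ x₀)
    (h₂ : ContinuousAt F₂ x₀) :
    HasJet (fun ε x => F₀ x + ε * F₁ x + ε ^ 2 * F₂ x) F₀ F₁ x₀ := by
  refine ⟨h₀, h₁, ?_⟩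
  have := (Asymptotics.isBigO_refl (fun p : ℝ × M => p.1 ^ 2) (𝓝 0 ×ˢ 𝓝 x₀)).mul
    (isBigO_one_of_continuousAt h₂)
  exact this.congr (fun p => by ring) (fun p => by ring)

/-- Jets are uniform on compact sets. -/
lemma exists_uniform_bound {K : Set M} (hK : IsCompact K) (h : ∀ x, HasJet F F₀ F₁ x) :
    ∃ c : ℝ, 0 ≤ c ∧ ∀ᶠ ε in 𝓝 (0 : ℝ), ∀ x ∈ K, |F ε x - F₀ x - ε * F₁ x| ≤ c * ε ^ 2 := by
  refine hK.induction_on (p := fun K => ∃ c : ℝ, 0 ≤ c ∧ ∀ᶠ ε in 𝓝 (0 : ℝ), ∀ x ∈ K,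
    |F ε x - F₀ x - ε * F₁ x| ≤ c * ε ^ 2) ⟨0, le_rfl, by simp⟩ (fun s t hst ht => ?_)
    (fun s t hs ht => ?_) (fun x _ => ?_)
  · obtain ⟨c, hc, H⟩ := ht
    exact ⟨c, hc, H.mono fun ε hε x hx => hε x (hst hx)⟩
  · obtain ⟨c, hc, H⟩ := hs
    obtain ⟨d, hd, H'⟩ := ht
    refine ⟨max c d, hc.trans (le_max_left _ _), ?_⟩
    filter_upwards [H, H'] with ε h1 h2 x hx
    rcases hx with hx | hx
    · exact (h1 x hx).trans (mul_le_mul_of_nonneg_right (le_max_left _ _) (sq_nonneg ε))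
    · exact (h2 x hx).trans (mul_le_mul_of_nonneg_right (le_max_right _ _) (sq_nonneg ε))
  · obtain ⟨c, hc, H⟩ := (h x).isBigO.exists_nonneg
    have H' := H.bound
    rw [Filter.eventually_prod_iff] at H'
    obtain ⟨pa, ha, pb, hb, hab⟩ := H'
    refine ⟨{y | pb y}, mem_nhdsWithin_of_mem_nhds hb, c, hc, ?_⟩
    filter_upwards [ha] with ε hε y hy
    simpa [abs_of_nonneg (sq_nonneg ε)] using hab hε hy

/-- The jet of the solution of a fixed point equation that is linear with small coefficients. -/
lemma of_fixedPoint {m : ℕ} {B : Fin m → Fin m → ℝ → M → ℝ} {Θ : Fin m → Fin m → M → ℝ}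
    {η : Fin m → ℝ} (hη : ∀ i, η i = 1 ∨ η i = -1) (hΘ : ∀ i j, ContinuousAt (Θ i j) x₀)
    (h : ∀ᶠ p in 𝓝 (0 : ℝ) ×ˢ 𝓝 x₀, ∀ i j, B i j p.1 p.2 = (if i = j then η j else 0)
      + p.1 * (η j * Θ i j p.2 - ∑ k, Θ k j p.2 * B i k p.1 p.2)) (i j : Fin m) :
    HasJet (B i j) (fun _ => if i = j then η j else 0) (fun x => (η j - η i) * Θ i j x) x₀ := by
  have hT : ∀ i j, (fun p : ℝ × M => Θ i j p.2) =O[𝓝 0 ×ˢ 𝓝 x₀] (fun _ => (1 : ℝ)) := fun i j =>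
    isBigO_one_of_continuousAt (hΘ i j)
  -- A priori bound: the equation bounds the row sum `S` of absolute values by a constant plus a
  -- small multiple of `S`, so that `S` can be absorbed.
  have hB : ∀ i j, (fun p : ℝ × M => B i j p.1 p.2) =O[𝓝 0 ×ˢ 𝓝 x₀] (fun _ => (1 : ℝ)) := by
    obtain ⟨c, hc, hbd⟩ : ∃ c : ℝ, 0 ≤ c ∧ ∀ᶠ p in 𝓝 (0 : ℝ) ×ˢ 𝓝 x₀, ∀ i j,
        |Θ i j p.2| ≤ c := by
      choose c hc using fun i j => (hT i j).bound
      refine ⟨∑ i, ∑ j, |c i j|, by positivity, ?_⟩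
      rw [Filter.eventually_all]
      intro i
      rw [Filter.eventually_all]
      intro j
      filter_upwards [hc i j] with p hp
      rw [norm_one, mul_one, Real.norm_eq_abs] at hp
      refine hp.trans ((le_abs_self _).trans ?_)
      refine (Finset.single_le_sum (f := fun j => |c i j|) (fun j _ => abs_nonneg _)
        (Finset.mem_univ j)).trans ?_
      exact Finset.single_le_sum (f := fun i => ∑ j, |c i j|)
        (fun i _ => Finset.sum_nonneg fun j _ => abs_nonneg _) (Finset.mem_univ i)
    -- The factor `m + 1` makes both `|ε| c` and `m |ε| c` at most `1/2`, which leads to `S ≤ 4 m`.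
    have hsmall : ∀ᶠ p : ℝ × M in 𝓝 (0 : ℝ) ×ˢ 𝓝 x₀, |p.1| * ((m + 1) * c) < 1 / 2 := by
      have : Filter.Tendsto (fun p : ℝ × M => |p.1| * ((m + 1) * c)) (𝓝 0 ×ˢ 𝓝 x₀) (𝓝 0) := by
        simpa using ((Filter.tendsto_fst (f := 𝓝 (0 : ℝ)) (g := 𝓝 x₀)).abs).mul_const
          (((m : ℝ) + 1) * c)
      exact this.eventually (gt_mem_nhds (by norm_num))
    intro i j
    refine Asymptotics.IsBigO.of_bound (4 * m) ?_
    filter_upwards [h, hbd, hsmall] with p hp hc' hs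
    set S := ∑ k, |B i k p.1 p.2| with hS
    have hS0 : 0 ≤ S := Finset.sum_nonneg fun _ _ => abs_nonneg _
    have hk : ∀ k, |B i k p.1 p.2| ≤ 1 + |p.1| * (c + c * S) := fun k => by
      have h1 : |∑ l, Θ l k p.2 * B i l p.1 p.2| ≤ c * S := by
        rw [hS, Finset.mul_sum]
        refine (Finset.abs_sum_le_sum_abs _ _).trans (Finset.sum_le_sum fun l _ => ?_)
        rw [abs_mul]
        exact mul_le_mul_of_nonneg_right (hc' l k) (abs_nonneg _)
      have habs : |η k| = 1 := by rcases hη k with h | h <;> simp [h]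
      have h2 : |η k * Θ i k p.2| ≤ c := by rw [abs_mul, habs, one_mul]; exact hc' i k
      have h3 : |if i = k then η k else 0| ≤ 1 := by
        split_ifs
        · exact habs.le
        · simp
      rw [hp i k]
      refine (abs_add_le _ _).trans (add_le_add h3 ?_)
      rw [abs_mul]
      exact mul_le_mul_of_nonneg_left ((abs_sub _ _).trans (add_le_add h2 h1)) (abs_nonneg _)
    have hsum : S ≤ m * (1 + |p.1| * (c + c * S)) := by
      have := Finset.sum_le_sum fun k (_ : k ∈ Finset.univ) => hk k
      simpa [hS, mul_add] using this
    have hm : (0 : ℝ) ≤ m := Nat.cast_nonneg m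
    have hq : 0 ≤ |p.1| * c := mul_nonneg (abs_nonneg _) hc
    have e1 : |p.1| * c ≤ 1 / 2 := by nlinarith
    have e2 : m * (|p.1| * c) ≤ 1 / 2 := by nlinarith
    have hfin : S ≤ 4 * m := by nlinarith [mul_le_mul_of_nonneg_right e2 hS0]
    rw [norm_one, mul_one, Real.norm_eq_abs]
    exact (Finset.single_le_sum (f := fun k => |B i k p.1 p.2|) (fun _ _ => abs_nonneg _)
      (Finset.mem_univ j)).trans hfin
  have hfst := Asymptotics.isBigO_refl (fun p : ℝ × M => p.1) (𝓝 0 ×ˢ 𝓝 x₀)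
  -- With `B` bounded, the equation shows that `B` is its value at `ε = 0` up to `O(ε)`;
  -- substituting this back on the right-hand side gives the expansion up to `O(ε²)`.
  have h1 : ∀ i j, (fun p : ℝ × M => B i j p.1 p.2 - if i = j then η j else 0)
      =O[𝓝 0 ×ˢ 𝓝 x₀] (fun p => p.1) := by
    intro i j
    have h2 : (fun p : ℝ × M => p.1 * (η j * Θ i j p.2 - ∑ k, Θ k j p.2 * B i k p.1 p.2))
        =O[𝓝 0 ×ˢ 𝓝 x₀] (fun p => p.1) := by
      refine (hfst.mul (((hT i j).const_mul_left (η j)).sub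
        (Asymptotics.IsBigO.fun_sum (s := Finset.univ) fun k _ =>
          ((hT k j).mul (hB i k)).congr_right fun _ => one_mul _))).congr_right fun p => mul_one _
    refine h2.congr' ?_ Filter.EventuallyEq.rfl
    filter_upwards [h] with p hp
    rw [hp i j, add_sub_cancel_left]
  refine ⟨continuousAt_const, (hΘ i j).const_mul _, ?_⟩
  have h3 : (fun p : ℝ × M => -(p.1 * ∑ k, Θ k j p.2 * (B i k p.1 p.2 - if i = k then η k else 0)))
      =O[𝓝 0 ×ˢ 𝓝 x₀] (fun p => p.1 ^ 2) := by
    refine ((hfst.mul (Asymptotics.IsBigO.fun_sum (s := Finset.univ) fun k _ =>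
      ((hT k j).mul (h1 i k)).congr_right fun _ => one_mul _)).congr_right
        fun p => (sq p.1).symm).neg_left
  refine h3.congr' ?_ Filter.EventuallyEq.rfl
  filter_upwards [h] with p hp
  rw [hp i j]
  simp only [mul_sub, Finset.sum_sub_distrib, mul_ite, mul_zero, Finset.sum_ite_eq,
    Finset.mem_univ, if_true]
  ring

end HasJet

end Jets



/-! ### The first variation of the action. -/

section FirstVariation

variable {n : ℕ} {H : Type*} [TopologicalSpace H]
  {I : ModelWithCorners ℝ (EuclideanSpace ℝ (Fin n)) H}
  {M : Type*} [TopologicalSpace M] [ChartedSpace H M] [IsManifold I ∞ M]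
  {F : Type*} [NormedAddCommGroup F] [NormedSpace ℝ F]
  {E : M → Type*} [TopologicalSpace (TotalSpace F E)] [∀ x, AddCommGroup (E x)]
  [∀ x, Module ℝ (E x)] [∀ x, TopologicalSpace (E x)] [FiberBundle F E] [VectorBundle ℝ F E]


variable [FiniteDimensional ℝ F] [ContMDiffVectorBundle ∞ F E I] [T2Space M] [SigmaCompactSpace M]
  {C : CourantAlgebroid I F E}


namespace Connection

lemma ext_cov {D D' : Connection C} (h : D.cov = D'.cov) : D = D' := by
  cases D
  cases D'
  cases h
  rfl

/-- The difference of two connections. -/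
def diff (D' D : Connection C) : CovTensor C where
  map := D'.cov - D.cov
  fsmul_left f ψ ψ' := by
    ext x
    simp only [LinearMap.sub_apply, D.cov_fsmul_left, D'.cov_fsmul_left, sec_sub_apply,
      fsmul_apply, smul_sub]
  fsmul_right f ψ ψ' := by
    ext x
    simp only [LinearMap.sub_apply, D.cov_fsmul_right, D'.cov_fsmul_right, sec_sub_apply,
      fsmul_apply, smul_sub]
    abel
  skew ψ ψ' ψ'' x := by
    have h := (D.cov_pairing ψ ψ' ψ'' x).symm.trans (D'.cov_pairing ψ ψ' ψ'' x)
    simp only [LinearMap.sub_apply, sec_sub_apply, map_sub]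
    linarith

end Connection

namespace GeneralizedMetric

variable {V V' : GeneralizedMetric C} {x₀ : M} (f : AdaptedFrame V x₀) {x : M}

/-- The matrix of the infinitesimal rotation of an adapted frame towards the graph of `φ`. -/
def mixing (φ : E x →ₗ[ℝ] E x) (k j : Fin f.m) : ℝ :=
  -((1 + f.η j) / 2 * C.pairing x (φ (f.e j x)) (f.e k x)
    + (1 + f.η k) / 2 * C.pairing x (φ (f.e k x)) (f.e j x))

/-- The corrected frame vectors lie in the graph for `η j = 1` and in its orthogonal complement for
`η j = -1`, exactly and not just to first order: on `V₊` the correction is `φ`, on `V₋` it is minus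
the adjoint of `φ`. -/
lemma invol_graph (hx : x ∈ f.dom) {φ : E x →ₗ[ℝ] E x}
    (hφ : ∀ v ∈ V.plus x, φ v ∈ V.minus x) {ε : ℝ}
    (hV' : V'.plus x = (V.plus x).map (LinearMap.id + ε • φ)) (j : Fin f.m) :
    V'.invol x (f.e j x + ε • ∑ k, mixing f φ k j • f.e k x)
      = f.η j • (f.e j x + ε • ∑ k, mixing f φ k j • f.e k x) := by
  have hfd : FiniteDimensional ℝ (E x) := VectorBundle.finiteDimensional ℝ F E x
  have h := f.ortho x hx
  rcases h.sign j with hj | hj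
  · have hp := f.mem_plus x hx j hj
    have hs : ∑ k, mixing f φ k j • f.e k x = φ (f.e j x) := by
      rw [← h.sum_coord (f.card x) (φ (f.e j x))]
      refine Finset.sum_congr rfl fun k _ => ?_
      congr 1
      simp only [mixing, hj]
      rcases h.sign k with hk | hk
      · rw [V.pairing_minus_plus (hφ _ hp) (f.mem_plus x hx k hk),
          V.pairing_minus_plus (hφ _ (f.mem_plus x hx k hk)) hp]
        ring
      · rw [hk]
        ring
    rw [hs, hj, one_smul]
    refine V'.invol_of_mem_plus ?_
    rw [hV']
    exact ⟨f.e j x, hp, rfl⟩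
  · have hm := f.mem_minus x hx j hj
    rw [hj, neg_one_smul]
    refine V'.invol_of_mem_minus ?_
    intro w hw
    rw [hV'] at hw
    obtain ⟨u, hu, rfl⟩ := hw
    change C.pairing x (u + ε • φ u) _ = 0
    have h1 : C.pairing x u (∑ k, mixing f φ k j • f.e k x) = -C.pairing x (φ u) (f.e j x) := by
      have hφu : φ u = ∑ k, (f.η k * C.pairing x u (f.e k x)) • φ (f.e k x) := by
        conv_lhs => rw [← h.sum_coord (f.card x) u]
        rw [map_sum]
        exact Finset.sum_congr rfl fun k _ => map_smul _ _ _
      rw [hφu, map_sum, map_sum, LinearMap.sum_apply, ← Finset.sum_neg_distrib]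
      refine Finset.sum_congr rfl fun k _ => ?_
      rw [map_smul, map_smul, LinearMap.smul_apply, smul_eq_mul, smul_eq_mul]
      simp only [mixing, hj]
      rcases h.sign k with hk | hk
      · rw [hk]
        ring
      · rw [V.pairing_plus_minus hu (f.mem_minus x hx k hk)]
        ring
    have h2 : C.pairing x (φ u) (∑ k, mixing f φ k j • f.e k x) = 0 := by
      rw [map_sum]
      refine Finset.sum_eq_zero fun k _ => ?_
      rw [map_smul, smul_eq_mul]
      rcases h.sign k with hk | hk
      · rw [V.pairing_minus_plus (hφ u hu) (f.mem_plus x hx k hk), mul_zero]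
      · simp only [mixing, hj, hk]
        ring
    simp only [map_add, map_smul, LinearMap.add_apply, LinearMap.smul_apply, smul_eq_mul]
    rw [h1, h2, V.pairing_plus_minus hu hm]
    ring

/-- The components of the varied involution in the fixed frame satisfy a fixed point equation with
small coefficients. This avoids inverting the change of frame; `HasJet.of_fixedPoint` then supplies
the expansion. -/
lemma involComp_eq (hx : x ∈ f.dom) {φ : E x →ₗ[ℝ] E x}
    (hφ : ∀ v ∈ V.plus x, φ v ∈ V.minus x) {ε : ℝ}
    (hV' : V'.plus x = (V.plus x).map (LinearMap.id + ε • φ)) (i j : Fin f.m) :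
    f.η i * C.pairing x (f.e i x) (V'.invol x (f.e j x)) = (if i = j then f.η j else 0)
      + ε * (f.η j * mixing f φ i j
        - ∑ k, mixing f φ k j * (f.η i * C.pairing x (f.e i x) (V'.invol x (f.e k x)))) := by
  have h := congrArg (fun w => f.η i * C.pairing x (f.e i x) w) (invol_graph f hx hφ hV' j)
  have ho := f.ortho x hx
  simp only [map_add, map_smul, map_sum, smul_eq_mul, ho.ortho, mul_ite, mul_zero,
    Finset.sum_ite_eq, Finset.mem_univ, if_true] at h
  have e1 : ∑ k, mixing f φ k j * (f.η i * C.pairing x (f.e i x) (V'.invol x (f.e k x)))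
      = f.η i * ∑ k, mixing f φ k j * C.pairing x (f.e i x) (V'.invol x (f.e k x)) := by
    rw [Finset.mul_sum]
    exact Finset.sum_congr rfl fun k _ => by ring
  rw [e1]
  have hi := ho.mul_self i
  split_ifs at h ⊢ with hij
  · subst hij
    linear_combination h + (f.η i + ε * f.η i * mixing f φ i i) * hi
  · linear_combination h + (ε * f.η j * mixing f φ i j) * hi

end GeneralizedMetric

namespace Connection

variable (D : Connection C)

/-- The frame is adapted to `V` while the trace is taken for `V'`. Along a variation each summand
becomes a product of a factor depending only on the metric and a factor depending only on the
connection. -/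
lemma scalar_G_eq_involComp (V' : GeneralizedMetric C) {V : GeneralizedMetric C} {x₀ : M}
    (f : AdaptedFrame V x₀) {x : M} (hx : x ∈ f.dom) :
    D.scalar V'.G x = ∑ i, ∑ k, f.η i * (f.η k * C.pairing x (f.e k x) (V'.invol x (f.e i x)))
      * D.ric x (f.e i x) (f.e k x) := by
  have hfd : FiniteDimensional ℝ (E x) := VectorBundle.finiteDimensional ℝ F E x
  have ho := f.ortho x hx
  rw [D.scalar_G_eq V' ho f.card_eq]
  refine Finset.sum_congr rfl fun i _ => ?_
  rw [← D.ricForm_apply]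
  conv_lhs => rw [← ho.sum_coord (f.card x) (V'.invol x (f.e i x))]
  rw [map_sum, Finset.mul_sum]
  refine Finset.sum_congr rfl fun k _ => ?_
  rw [map_smul, smul_eq_mul, C.pairing_symm x _ (f.e k x), D.ricForm_apply]
  ring

end Connection

namespace Variation

variable {V : GeneralizedMetric C} {Ω : VolumeForm I M} {D : Connection C} {K : Set M}
  (v : Variation V Ω D K)

/-- The direction of the variation of the connection. -/
def tensor : CovTensor C := (v.conn 1).diff D

lemma pairing_tensor (ψ ψ' ψ'' : Sec I F E) (x : M) :
    C.pairing x (v.tensor.map ψ ψ' x) (ψ'' x) = v.N x (ψ x) (ψ' x) (ψ'' x) := by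
  change C.pairing x ((v.conn 1).cov ψ ψ' x - D.cov ψ ψ' x) (ψ'' x) = _
  rw [map_sub, LinearMap.sub_apply, v.conn_eq]
  ring

lemma conn_eq_addTensor (ε : ℝ) : v.conn ε = D.addTensor v.tensor ε := by
  refine Connection.ext_cov ?_
  ext ψ ψ' x
  refine C.ext_pairing fun w => ?_
  rw [← ext_apply (I := I) (F := F) x w, v.conn_eq, Connection.addTensor_cov, sec_add_apply,
    sec_smul_apply, map_add, map_smul, LinearMap.add_apply, LinearMap.smul_apply, smul_eq_mul,
    pairing_tensor]

/-- The bilinear form whose trace is the first variation of the scalar curvature with respect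
to the generalized metric. -/
def metricForm (x : M) : E x →ₗ[ℝ] E x →ₗ[ℝ] ℝ :=
  (4 : ℝ) • (D.ricForm x).compl₂ (v.φ x ∘ₗ V.projPlus x)

/-- The first variation of the scalar curvature with respect to the generalized metric. -/
def metricPart (x : M) : ℝ :=
  haveI : FiniteDimensional ℝ (E x) := VectorBundle.finiteDimensional ℝ F E x
  metricTrace (C.pairing x) (fun u w => v.metricForm x u w)

lemma metricPart_eq {x₀ : M} (f : AdaptedFrame V x₀) {x : M} (hx : x ∈ f.dom) :
    v.metricPart x = ∑ i, f.η i * (4 * D.ric x (f.e i x) (v.φ x (V.projPlus x (f.e i x)))) :=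
  haveI : FiniteDimensional ℝ (E x) := VectorBundle.finiteDimensional ℝ F E x
  (f.ortho x hx).metricTrace_eq (f.card x) (C.pairing_nondegenerate x) (C.pairing_symm x) _

lemma projPlus_frame {x₀ : M} (f : AdaptedFrame V x₀) {x : M} (hx : x ∈ f.dom) (i : Fin f.m) :
    V.projPlus x (f.e i x) = ((1 + f.η i) / 2) • f.e i x := by
  rcases (f.ortho x hx).sign i with hi | hi
  · rw [V.projPlus_of_mem_plus (f.mem_plus x hx i hi), hi]
    norm_num
  · rw [V.projPlus_of_mem_minus (f.mem_minus x hx i hi), hi]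
    norm_num

lemma continuous_metricPart : Continuous v.metricPart := by
  rw [continuous_iff_continuousAt]
  intro x₀
  obtain ⟨f⟩ := nonempty_adaptedFrame V x₀
  choose s hs using fun i => v.φ_smooth (f.e i)
  have : Continuous (fun x => ∑ i, f.η i * (4 * (((1 + f.η i) / 2)
      * D.ric x (f.e i x) (s i x)))) :=
    continuous_finsetSum _ fun i _ => ((continuous_const.mul
      (D.continuous_ric V (f.e i) (s i))).const_mul 4).const_mul _
  refine this.continuousAt.congr ?_
  filter_upwards [f.dom_mem_nhds] with x hx
  rw [v.metricPart_eq f hx]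
  refine Finset.sum_congr rfl fun i _ => ?_
  rw [projPlus_frame f hx, map_smul, ← D.ricForm_apply x _ (_ • _), map_smul, hs,
    D.ricForm_apply, smul_eq_mul]

/-- The right-hand side is the trace of the Ricci tensor against the first-order change of the
involution. That change is `2 φ` on `V₊`, and `V₋` contributes the same amount by symmetry of the
Ricci tensor, which accounts for the factor `4` in `metricForm`. The proof averages the sum with its
transpose. -/
lemma metricPart_eq_mixing {x₀ : M} (f : AdaptedFrame V x₀) {x : M} (hx : x ∈ f.dom) :
    v.metricPart x = ∑ i, ∑ k, f.η i * ((f.η i - f.η k) * GeneralizedMetric.mixing f (v.φ x) k i)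
      * D.ric x (f.e i x) (f.e k x) := by
  have hfd : FiniteDimensional ℝ (E x) := VectorBundle.finiteDimensional ℝ F E x
  have ho := f.ortho x hx
  have h1 : v.metricPart x = ∑ i, ∑ k, (2 * f.η i * (1 + f.η i) * f.η k
      * C.pairing x (v.φ x (f.e i x)) (f.e k x)) * D.ric x (f.e i x) (f.e k x) := by
    rw [v.metricPart_eq f hx]
    refine Finset.sum_congr rfl fun i _ => ?_
    rw [projPlus_frame f hx, map_smul, ← D.ricForm_apply x _ (_ • _), map_smul, smul_eq_mul]
    conv_lhs => rw [← ho.sum_coord (f.card x) (v.φ x (f.e i x))]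
    rw [map_sum, Finset.mul_sum, Finset.mul_sum, Finset.mul_sum]
    refine Finset.sum_congr rfl fun k _ => ?_
    rw [map_smul, smul_eq_mul, D.ricForm_apply]
    ring
  have h2 : v.metricPart x = ∑ i, ∑ k, (2 * f.η k * (1 + f.η k) * f.η i
      * C.pairing x (v.φ x (f.e k x)) (f.e i x)) * D.ric x (f.e i x) (f.e k x) := by
    rw [h1, Finset.sum_comm]
    refine Finset.sum_congr rfl fun i _ => Finset.sum_congr rfl fun k _ => ?_
    rw [D.ric_symm V x (f.e k x)]
  have h3 : v.metricPart x = 1 / 2 * (v.metricPart x + v.metricPart x) := by ring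
  rw [h3]
  nth_rewrite 1 [h1]
  rw [h2, ← Finset.sum_add_distrib, Finset.mul_sum]
  refine Finset.sum_congr rfl fun i _ => ?_
  rw [← Finset.sum_add_distrib, Finset.mul_sum]
  refine Finset.sum_congr rfl fun k _ => ?_
  simp only [GeneralizedMetric.mixing]
  rcases ho.sign i with hi | hi <;> rcases ho.sign k with hk | hk
  · have e1 := V.pairing_minus_plus (v.φ_mem x _ (f.mem_plus x hx i hi)) (f.mem_plus x hx k hk)
    have e2 := V.pairing_minus_plus (v.φ_mem x _ (f.mem_plus x hx k hk)) (f.mem_plus x hx i hi)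
    rw [hi, hk, e1, e2]
    ring
  all_goals
    rw [hi, hk]
    ring

/-- The scalar curvature along a variation. -/
def scalarAlong (ε : ℝ) (x : M) : ℝ := (v.conn ε).scalar (v.metric ε).G x

/-- The product rule applied to `scalar_G_eq_involComp`: the jets of the involution give the metric
part, those of the Ricci components give the linearised scalar curvature. -/
lemma hasJet_scalarAlong (x₀ : M) : HasJet v.scalarAlong (D.scalar V.G)
    (fun x => v.metricPart x + D.scalarLin v.tensor V x) x₀ := by
  obtain ⟨f⟩ := nonempty_adaptedFrame V x₀
  choose s hs using fun i => v.φ_smooth (f.e i)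
  have hB : ∀ i j, HasJet
      (fun ε x => f.η i * C.pairing x (f.e i x) ((v.metric ε).invol x (f.e j x)))
      (fun _ => if i = j then f.η j else 0)
      (fun x => (f.η j - f.η i) * GeneralizedMetric.mixing f (v.φ x) i j) x₀ := by
    intro i j
    refine HasJet.of_fixedPoint (Θ := fun i j x => GeneralizedMetric.mixing f (v.φ x) i j)
      (B := fun i j ε x => f.η i * C.pairing x (f.e i x) ((v.metric ε).invol x (f.e j x)))
      (f.ortho x₀ f.mem_dom).sign (fun i j => ?_) ?_ i j
    · simp only [GeneralizedMetric.mixing, hs]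
      exact (((C.pairing_continuous (s j) (f.e i)).const_mul _).add
        ((C.pairing_continuous (s i) (f.e j)).const_mul _)).neg.continuousAt
    · filter_upwards [Filter.tendsto_fst.eventually v.metric_eq,
        Filter.tendsto_snd.eventually f.dom_mem_nhds] with p hp hx i j
      exact GeneralizedMetric.involComp_eq f hx (v.φ_mem p.2) (hp p.2) i j
  have hric : ∀ i k, HasJet
      (fun ε x => (D.addTensor v.tensor ε).ric x (f.e i x) (f.e k x))
      (fun x => D.ric x (f.e i x) (f.e k x))
      (fun x => D.ricLin v.tensor x (f.e i x) (f.e k x)) x₀ := by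
    intro i k
    have c0 := (D.continuous_ric V (f.e i) (f.e k))
    have c1 := ((D.addTensor v.tensor 1).continuous_ric V (f.e i) (f.e k))
    have c2 := ((D.addTensor v.tensor (-1)).continuous_ric V (f.e i) (f.e k))
    have c3 : Continuous (fun x => D.ricLin v.tensor x (f.e i x) (f.e k x)) :=
      (c1.sub c2).div_const 2
    refine (HasJet.quadratic c0.continuousAt c3.continuousAt
      ((c1.sub c3).sub c0).continuousAt).congr ?_ (.of_forall fun _ => rfl) (.of_forall fun _ => rfl)
    filter_upwards [Filter.tendsto_snd.eventually f.dom_mem_nhds] with p hx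
    exact D.ric_addTensor v.tensor (f.ortho p.2 hx) f.card_eq p.1 (f.e i) (f.e k)
  have hsum := HasJet.sum (x₀ := x₀) Finset.univ fun i (_ : i ∈ Finset.univ) =>
    HasJet.sum Finset.univ fun k (_ : k ∈ Finset.univ) =>
      ((HasJet.of_continuousAt (continuousAt_const (y := f.η i))).mul (hB k i)).mul (hric i k)
  refine hsum.congr ?_ ?_ ?_
  · filter_upwards [Filter.tendsto_snd.eventually f.dom_mem_nhds] with p hx
    rw [scalarAlong, conn_eq_addTensor, Connection.scalar_G_eq_involComp _ _ f hx]
  · filter_upwards [f.dom_mem_nhds] with x hx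
    rw [D.scalar_G_eq_frame f hx]
    simp only [mul_ite, ite_mul, mul_zero, zero_mul, Finset.sum_ite_eq', Finset.mem_univ, if_true]
    exact Finset.sum_congr rfl fun i _ => by rw [(f.ortho x hx).mul_self, one_mul]
  · filter_upwards [f.dom_mem_nhds] with x hx
    rw [v.metricPart_eq_mixing f hx, D.scalarLin_eq _ f hx, add_comm, ← Finset.sum_add_distrib]
    refine Finset.sum_congr rfl fun i _ => ?_
    simp only [mul_ite, ite_mul, mul_zero, zero_mul, ite_self, add_zero, Finset.sum_add_distrib,
      Finset.sum_ite_eq', Finset.mem_univ, if_true]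
    rw [(f.ortho x hx).mul_self, one_mul]

/-- The first variation of the Lagrangian. -/
def lagrangianVariation (x : M) : ℝ :=
  v.metricPart x + D.scalarLin v.tensor V x + v.f x * (D.scalar V.G x + canonicalScalar C x)

lemma continuous_lagrangianVariation : Continuous v.lagrangianVariation :=
  (v.continuous_metricPart.add (D.continuous_scalarLin _ V)).add
    (v.f_smooth.continuous.mul ((D.continuous_scalar_G V).add (continuous_canonicalScalar V)))

lemma action_eq_volInt (o : VolumeForm I M) (ε : ℝ) :
    action o K (v.metric ε) (v.vol ε) (v.conn ε)
      = volInt o Ω K (fun x => Real.exp (ε * v.f x) * (v.scalarAlong ε x + canonicalScalar C x)) := by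
  unfold action volInt
  congr 1
  funext x
  rw [v.vol_eq, smul_smul, mul_comm]
  rfl

/-- The first variation of the action. -/
lemma hasDerivAt_action (o : VolumeForm I M) (hK : IsCompact K) :
    HasDerivAt (fun ε => action o K (v.metric ε) (v.vol ε) (v.conn ε))
      (volInt o Ω K v.lagrangianVariation) 0 := by
  have hjet : ∀ x, HasJet
      (fun ε x => Real.exp (ε * v.f x) * (v.scalarAlong ε x + canonicalScalar C x))
      (fun x => D.scalar V.G x + canonicalScalar C x) v.lagrangianVariation x := fun x =>
    ((HasJet.exp v.f_smooth.continuous.continuousAt).mul ((v.hasJet_scalarAlong x).add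
      (HasJet.of_continuousAt (continuous_canonicalScalar V).continuousAt))).congr
      (.of_forall fun _ => rfl) (.of_forall fun y => (one_mul _).symm)
      (.of_forall fun y => by
        rw [lagrangianVariation]
        ring)
  obtain ⟨c, hc, hbd⟩ := HasJet.exists_uniform_bound hK hjet
  obtain ⟨B, hB, hvol⟩ := exists_volInt_bound o Ω hK
  have c0 : Continuous (fun x => D.scalar V.G x + canonicalScalar C x) :=
    (D.continuous_scalar_G V).add (continuous_canonicalScalar V)
  have cl : ∀ ε : ℝ, Continuous (fun x => ε * v.lagrangianVariation x) := fun ε =>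
    continuous_const.mul v.continuous_lagrangianVariation
  have cε : ∀ ε, Continuous
      (fun x => Real.exp (ε * v.f x) * (v.scalarAlong ε x + canonicalScalar C x)) := fun ε =>
    (Real.continuous_exp.comp (continuous_const.mul v.f_smooth.continuous)).mul
      (((v.conn ε).continuous_scalar_G (v.metric ε)).add (continuous_canonicalScalar V))
  have c1 : ∀ ε, Continuous (fun x => Real.exp (ε * v.f x)
      * (v.scalarAlong ε x + canonicalScalar C x) - (D.scalar V.G x + canonicalScalar C x)
        - ε * v.lagrangianVariation x) := fun ε => ((cε ε).sub c0).sub (cl ε)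
  have c2 : ∀ ε : ℝ, Continuous (fun x => D.scalar V.G x + canonicalScalar C x
      + ε * v.lagrangianVariation x) := fun ε => c0.add (cl ε)
  -- At `ε = 0` the uniform estimate has right-hand side zero, so the integrand of the varied fields
  -- is the original one on `K`.
  have hzero : action o K (v.metric 0) (v.vol 0) (v.conn 0)
      = volInt o Ω K (fun x => D.scalar V.G x + canonicalScalar C x) := by
    rw [v.action_eq_volInt o]
    refine volInt_congr o Ω hK fun x hx => ?_
    have := hbd.self_of_nhds x hx
    rw [zero_mul (v.lagrangianVariation x), sub_zero, zero_pow two_ne_zero, mul_zero] at this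
    exact sub_eq_zero.1 (abs_eq_zero.1 (le_antisymm this (abs_nonneg _)))
  have key : ∀ᶠ ε in 𝓝 (0 : ℝ), |action o K (v.metric ε) (v.vol ε) (v.conn ε)
      - action o K (v.metric 0) (v.vol 0) (v.conn 0) - ε * volInt o Ω K v.lagrangianVariation|
        ≤ B * c * ε ^ 2 := by
    filter_upwards [hbd] with ε hε
    have := hvol _ (c * ε ^ 2) (by positivity) hε
    have hdec : volInt o Ω K
        (fun x => Real.exp (ε * v.f x) * (v.scalarAlong ε x + canonicalScalar C x))
        = volInt o Ω K (fun x => (Real.exp (ε * v.f x)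
            * (v.scalarAlong ε x + canonicalScalar C x)
            - (D.scalar V.G x + canonicalScalar C x) - ε * v.lagrangianVariation x))
          + (volInt o Ω K (fun x => D.scalar V.G x + canonicalScalar C x)
            + ε * volInt o Ω K v.lagrangianVariation) := by
      rw [← volInt_const_mul o Ω hK, ← volInt_add o Ω hK c0 (cl ε),
        ← volInt_add o Ω hK (c1 ε) (c2 ε)]
      refine volInt_congr o Ω hK fun x _ => ?_
      ring
    rw [hzero, v.action_eq_volInt o, hdec]
    calc _ = _ := by congr 1; ring
      _ ≤ _ := this
      _ = _ := by ring
  rw [hasDerivAt_iff_isLittleO]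
  have hO : (fun ε : ℝ => action o K (v.metric ε) (v.vol ε) (v.conn ε)
      - action o K (v.metric 0) (v.vol 0) (v.conn 0) - (ε - 0) • volInt o Ω K v.lagrangianVariation)
        =O[𝓝 0] (fun ε : ℝ => ε ^ 2) := by
    refine Asymptotics.IsBigO.of_bound (B * c) ?_
    filter_upwards [key] with ε hε
    rw [sub_zero, smul_eq_mul, Real.norm_eq_abs, Real.norm_eq_abs, abs_of_nonneg (sq_nonneg ε)]
    exact hε
  refine hO.trans_isLittleO ?_
  simpa using Asymptotics.isLittleO_pow_id (𝕜 := ℝ) one_lt_two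

lemma firstVariationVanishes_iff (o : VolumeForm I M) (hK : IsCompact K) :
    FirstVariationVanishes o v ↔ volInt o Ω K v.lagrangianVariation = 0 := by
  refine ⟨fun h => (v.hasDerivAt_action o hK).unique h, fun h => ?_⟩
  have := v.hasDerivAt_action o hK
  rwa [h] at this

end Variation

end FirstVariation



/-! ### Solving the equation of motion of the connection in a frame. -/

section ConnectionAlgebra

variable {m : ℕ} {η : Fin m → ℝ} {δ : Fin m → ℝ} {Γ B : Fin m → Fin m → Fin m → ℝ}

variable (η δ Γ B) in
/-- The coefficients of the first variation of the action with respect to the connection, in an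
orthonormal frame. -/
def variationCoeff (k i j : Fin m) : ℝ :=
  (if k = i then (η i + η j) * δ j + η i * ∑ a, (η a - η j) * Γ a a j else 0)
    + (η i + η k) * η j * Γ i k j - 1 / 2 * (η i + η j) * η k * (B j i k + Γ k i j)

lemma eq_neg_of_sign_ne (hη : ∀ i, η i = 1 ∨ η i = -1) {i j : Fin m} (h : η i ≠ η j) :
    η i = -η j := by
  rcases hη i with h1 | h1 <;> rcases hη j with h2 | h2 <;> rw [h1, h2] at h ⊢ <;>
    first | exact absurd rfl h | norm_num

lemma sign_eq_of_ne (hη : ∀ i, η i = 1 ∨ η i = -1) {i j k : Fin m} (h : η i ≠ η j)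
    (h' : η j ≠ η k) : η i = η k := by
  rw [eq_neg_of_sign_ne hη h, eq_neg_of_sign_ne hη h', neg_neg]

lemma exists_ne_of_card_ne_one {σ : ℝ} (h : (Finset.univ.filter fun i => η i = σ).card ≠ 1)
    {j : Fin m} (hj : η j = σ) : ∃ i, i ≠ j ∧ η i = σ := by
  by_contra! hcon
  refine h (Finset.card_eq_one.2 ⟨j, ?_⟩)
  ext i
  simp only [Finset.mem_filter, Finset.mem_univ, true_and, Finset.mem_singleton]
  exact ⟨fun hi => by_contra fun hne => hcon i hne hi, fun hi => hi ▸ hj⟩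

/-- Each entry of the block equals the sum `S` of the block, so `r S = S` where `r` is its size, and
`r ≠ 1`. -/
lemma eq_zero_of_diagonal {σ : ℝ} (h : (Finset.univ.filter fun i => η i = σ).card ≠ 1)
    {S : ℝ} {g : Fin m → ℝ} (hg : ∀ i, η i = σ → g i = S)
    (hS : ∑ i, (if η i = σ then g i else 0) = S) : S = 0 := by
  rw [Finset.sum_congr rfl fun i _ => show (if η i = σ then g i else 0)
    = if η i = σ then S else 0 by split_ifs with hi; exacts [hg i hi, rfl],
    ← Finset.sum_filter, Finset.sum_const, nsmul_eq_mul] at hS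
  have h1 : (((Finset.univ.filter fun i => η i = σ).card : ℝ) - 1) * S = 0 := by linarith
  rcases mul_eq_zero.1 h1 with h2 | h2
  · exact absurd (by exact_mod_cast sub_eq_zero.1 h2) h
  · exact h2

lemma sum_trace_eq_zero (hmix : ∀ k i j, η i ≠ η j → Γ k i j = 0) (j : Fin m) :
    ∑ a, (η a - η j) * Γ a a j = 0 := by
  refine Finset.sum_eq_zero fun a _ => ?_
  by_cases h : η a = η j
  · rw [h, sub_self, zero_mul]
  · rw [hmix a a j h, mul_zero]

/-- When `i` and `k` have sign `σ` and `j` the opposite one, every term carrying `η i + η j` or `η k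
+ η j` drops out. What remains says that `Γ i k j` vanishes for `i ≠ k` and equals the block trace
for `i = k`; `eq_zero_of_diagonal` kills the trace. Since there are only two signs, `k` agrees with
one of `i`, `j` in every mixed component, and skewness covers both cases. -/
lemma mixed_eq_zero_of_variationCoeff (hη : ∀ i, η i = 1 ∨ η i = -1)
    (hpos : (Finset.univ.filter fun i => η i = 1).card ≠ 1)
    (hneg : (Finset.univ.filter fun i => η i = -1).card ≠ 1)
    (hΓ : ∀ k i j, Γ k i j = -Γ k j i)
    (h : ∀ k i j, variationCoeff η δ Γ B k i j = variationCoeff η δ Γ B k j i)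
    (k i j : Fin m) (hij : η i ≠ η j) : Γ k i j = 0 := by
  have main : ∀ σ : ℝ, (σ = 1 ∨ σ = -1) → (Finset.univ.filter fun i => η i = σ).card ≠ 1 →
      ∀ i k j, η i = σ → η k = σ → η j = -σ → Γ i k j = 0 := by
    intro σ hσ hc i k j hi hk hj
    have hσ2 : σ * σ = 1 := by rcases hσ with rfl | rfl <;> norm_num
    have hσ0 : σ ≠ -σ := by rcases hσ with rfl | rfl <;> norm_num
    have hS : ∑ a, (η a - η j) * Γ a a j = 2 * σ * ∑ a, if η a = σ then Γ a a j else 0 := by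
      rw [Finset.mul_sum]
      refine Finset.sum_congr rfl fun a _ => ?_
      split_ifs with ha
      · rw [ha, hj]
        ring
      · have : η a = -σ := by
          rcases hη a with h1 | h1 <;> rcases hσ with rfl | rfl <;>
            first | exact absurd h1 ha | linarith
        rw [this, hj]
        ring
    have hdiag : ∀ i k, η i = σ → η k = σ →
        Γ i k j = if k = i then ∑ a, (if η a = σ then Γ a a j else 0) else 0 := by
      intro i k hi hk
      have hkj : k ≠ j := fun e => hσ0 (by rw [← hj, ← e, hk])
      have h1 := h k i j
      simp only [variationCoeff, hS, if_neg hkj] at h1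
      rw [hi, hk, hj] at h1
      by_cases hki : k = i
      · rw [if_pos hki] at h1 ⊢
        linear_combination (-1 / 2) * h1
          + (∑ a, (if η a = σ then Γ a a j else 0) - Γ i k j) * hσ2
      · rw [if_neg hki] at h1 ⊢
        linear_combination (-1 / 2) * h1 - Γ i k j * hσ2
    have hz : ∑ a, (if η a = σ then Γ a a j else 0) = 0 :=
      eq_zero_of_diagonal hc (g := fun a => Γ a a j)
        (fun a ha => by rw [hdiag a a ha ha, if_pos rfl]) rfl
    rw [hdiag i k hi hk, hz, ite_self]
  have cases : ∀ k i j, η k = η i → η i ≠ η j → Γ k i j = 0 := by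
    intro k i j hk hij
    refine main (η i) (hη i) ?_ k i j hk rfl ?_
    · rcases hη i with h1 | h1 <;> rw [h1] <;> assumption
    · exact eq_neg_of_sign_ne hη (Ne.symm hij)
  by_cases hki : η k = η i
  · exact cases k i j hki hij
  · have hkj : η k = η j := sign_eq_of_ne hη hki hij
    rw [hΓ, cases k j i hkj (Ne.symm hij), neg_zero]

/-- The algebraic content of the equation of motion of the connection. -/
lemma variationCoeff_symm_iff (hη : ∀ i, η i = 1 ∨ η i = -1)
    (hpos : (Finset.univ.filter fun i => η i = 1).card ≠ 1)
    (hneg : (Finset.univ.filter fun i => η i = -1).card ≠ 1)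
    (hΓ : ∀ k i j, Γ k i j = -Γ k j i) (hB : ∀ k i j, B k i j = -B k j i)
    (hB' : ∀ k i j, B k i j = -B i k j) :
    (∀ k i j, variationCoeff η δ Γ B k i j = variationCoeff η δ Γ B k j i) ↔
      (∀ k i j, η i ≠ η j → Γ k i j = 0) ∧
      (∀ i j k, Γ i j k - Γ j i k - B i j k + Γ k i j = 0) ∧ ∀ j, δ j = 0 := by
  constructor
  · intro h
    have hmix := mixed_eq_zero_of_variationCoeff hη hpos hneg hΓ h
    have htr := sum_trace_eq_zero hmix
    -- With three equal signs the symmetry equation expresses the torsion through the divergence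
    -- defect `δ`.
    have hsame : ∀ i j k, η i = η j → η k = η j → Γ j i k - Γ i j k - B j i k + Γ k j i
        = -η j * ((if k = i then δ j else 0) - if k = j then δ i else 0) := by
      intro i j k hi hk
      have hj2 : η j * η j = 1 := by rcases hη j with h1 | h1 <;> rw [h1] <;> norm_num
      have h1 := h k i j
      simp only [variationCoeff, htr] at h1
      rw [hi, hk] at h1
      have e1 := hB' i j k
      have e2 := hΓ k i j
      have e3 := hΓ i j k
      have e4 := hΓ j i k
      split_ifs at h1 ⊢ <;>
      linear_combination (1 / 2) * h1 + (Γ j k i - Γ i k j + 1 / 2 * (B j i k + Γ k i j)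
        - 1 / 2 * (B i j k + Γ k j i)) * hj2 + e4 - e3 - 1 / 2 * e1 + (1 / 2) * e2
    -- Repeat an index `i ≠ j` of the same sign: the torsion side vanishes by skewness while `δ j`
    -- survives on the other side. A block of size one would offer no such `i`.
    have hδ : ∀ j, δ j = 0 := by
      intro j
      obtain ⟨i, hij, hi⟩ : ∃ i, i ≠ j ∧ η i = η j := by
        refine exists_ne_of_card_ne_one ?_ rfl
        rcases hη j with h1 | h1 <;> rw [h1] <;> assumption
      have h1 := hsame i j i hi hi
      rw [if_pos rfl, if_neg hij] at h1
      have e1 := hΓ j i i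
      have e2 := hB j i i
      have e3 : -η j * δ j = 0 := by linarith
      rcases mul_eq_zero.1 e3 with h2 | h2
      · rcases hη j with h3 | h3 <;> rw [h3] at h2 <;> norm_num at h2
      · exact h2
    -- If `k` has the opposite sign, only the last term of `variationCoeff` contributes, and the
    -- torsion reduces to `Γ k i j - B i j k` because the mixed coefficients are zero.
    have hopp : ∀ i j k, η i = η j → Γ i j k - Γ j i k - B i j k + Γ k i j = 0 := by
      intro i j k hi
      by_cases hk : η k = η i
      · have := hsame j i k hi.symm hk
        simpa only [hδ, ite_self, sub_self, mul_zero] using this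
      · have hk' : η k = -η i := eq_neg_of_sign_ne hη hk
        have hj2 : η i * η i = 1 := by rcases hη i with h1 | h1 <;> rw [h1] <;> norm_num
        have h1 := h k j i
        have hki : k ≠ i := fun e => hk (e ▸ rfl)
        have hkj : k ≠ j := fun e => hk (e ▸ hi.symm)
        simp only [variationCoeff, if_neg hki, if_neg hkj, ← hi, hk'] at h1
        have e1 := hB' i j k
        have e2 := hΓ k i j
        rw [hmix i j k (fun e => hk (e.symm.trans hi.symm)), hmix j i k (fun e => hk e.symm)]
        linear_combination (-1 / 2) * h1
          + (1 / 2 * (B i j k + Γ k j i - B j i k - Γ k i j)) * hj2 - 1 / 2 * e1 + 1 / 2 * e2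
    -- Two of three signs always agree, and the torsion is totally skew in its indices, so the case
    -- of two equal leading signs is enough.
    refine ⟨hmix, fun i j k => ?_, hδ⟩
    by_cases hij : η i = η j
    · exact hopp i j k hij
    · by_cases hjk : η j = η k
      · have := hopp j k i hjk
        linarith [hΓ i j k, hΓ j i k, hΓ k i j, hB i j k, hB' i j k, hB j k i, hB' j k i,
          hΓ j k i, hΓ k j i, hΓ i k j, hB' i k j, hB k i j, hB j i k, hB' j i k]
      · have hik : η i = η k := sign_eq_of_ne hη hij hjk
        have := hopp i k j hik
        linarith [hΓ i j k, hΓ j i k, hΓ k i j, hB i j k, hΓ j k i, hΓ k j i, hΓ i k j]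
  · rintro ⟨hmix, hT, hδ⟩ k i j
    have htr := sum_trace_eq_zero hmix
    simp only [variationCoeff, htr, hδ, mul_zero, add_zero, ite_self, zero_add]
    by_cases hij : η i = η j
    · have hj2 : η j * η j = 1 := by rcases hη j with h1 | h1 <;> rw [h1] <;> norm_num
      have t := hT j i k
      have e1 := hB' i j k
      have e2 := hΓ k i j
      have e3 := hΓ i j k
      have e4 := hΓ j i k
      by_cases hk : η k = η j
      · rw [hij, hk]
        linear_combination (2 * Γ i k j - 2 * Γ j k i - (B j i k + Γ k i j)
          + (B i j k + Γ k j i)) * hj2 + 2 * t + (-2) * e4 + 2 * e3 + e1 + (-1) * e2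
      · have hk' : η k = -η j := eq_neg_of_sign_ne hη hk
        rw [hmix i j k (fun e => hk e.symm), hmix j i k (fun e => hk (e.symm.trans hij))] at t
        rw [hij, hk']
        linear_combination (η j * η j) * (-2 * t - e1 + e2)
    · have hs : η i + η j = 0 := by rw [eq_neg_of_sign_ne hη hij, neg_add_cancel]
      have hs' : η j + η i = 0 := by linarith
      rw [hs, hs']
      by_cases hk : η k = η i
      · rw [hmix i k j (fun e => hij (hk.symm.trans e)), show η j + η k = 0 by rw [hk, hs']]
        ring
      · have : η k = η j := sign_eq_of_ne hη hk hij
        rw [hmix j k i (fun e => hij (e.symm.trans this)), show η i + η k = 0 by rw [this, hs]]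
        ring

end ConnectionAlgebra



/-! ### Collecting the coefficients of the variation. -/

section ConnectionAlgebra

/-- Only relabelling of summation indices. It reads the algebraic remainder, together with the
divergence defect of the contraction, as a linear functional of `N`. -/
lemma sum_variationCoeff_mul {m : ℕ} (η δ : Fin m → ℝ) (Γ B N : Fin m → Fin m → Fin m → ℝ) :
    ∑ k, ∑ i, ∑ j, variationCoeff η δ Γ B k i j * N k i j
      = ∑ a, ∑ c, (η a + η c) * δ c * N a a c
        + ∑ a, ∑ b, ∑ c, (η a * (η b - η c) * N a a c * Γ b b c
          + (η a + η b) * η c * N b a c * Γ a b c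
          - (1 / 2) * (η a + η b) * η c * (B b a c + Γ c a b) * N c a b) := by
  have e1 : ∑ k, ∑ i, ∑ j, (if k = i then (η i + η j) * δ j
        + η i * ∑ a, (η a - η j) * Γ a a j else 0) * N k i j
      = ∑ a, ∑ c, (η a + η c) * δ c * N a a c
        + ∑ a, ∑ b, ∑ c, η a * (η b - η c) * N a a c * Γ b b c := by
    rw [← Finset.sum_add_distrib]
    refine Finset.sum_congr rfl fun k _ => ?_
    rw [Finset.sum_eq_single k]
    · rw [Finset.sum_comm, ← Finset.sum_add_distrib]
      refine Finset.sum_congr rfl fun j _ => ?_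
      rw [if_pos rfl, add_mul, Finset.mul_sum, Finset.sum_mul]
      congr 1
      exact Finset.sum_congr rfl fun a _ => by ring
    · intro i _ hi
      simp only [if_neg (Ne.symm hi), zero_mul, Finset.sum_const_zero]
    · simp
  have e2 : ∑ k, ∑ i, ∑ j, (η i + η k) * η j * Γ i k j * N k i j
      = ∑ a, ∑ b, ∑ c, (η a + η b) * η c * N b a c * Γ a b c := by
    rw [Finset.sum_comm]
    exact Finset.sum_congr rfl fun a _ => Finset.sum_congr rfl fun b _ =>
      Finset.sum_congr rfl fun c _ => by ring
  have e3 : ∑ k, ∑ i, ∑ j, 1 / 2 * (η i + η j) * η k * (B j i k + Γ k i j) * N k i j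
      = ∑ a, ∑ b, ∑ c, (1 / 2) * (η a + η b) * η c * (B b a c + Γ c a b) * N c a b := by
    rw [Finset.sum_comm]
    exact Finset.sum_congr rfl fun a _ => Finset.sum_comm
  simp only [variationCoeff, add_mul _ _ (N _ _ _), sub_mul _ _ (N _ _ _),
    Finset.sum_add_distrib, Finset.sum_sub_distrib]
  rw [e1, e2, e3]
  ring

end ConnectionAlgebra

/-! ### Additivity and Leibniz rule for the divergence of a volume form. -/

section VolumeDivergence

variable {n : ℕ} {H : Type*} [TopologicalSpace H]
  {I : ModelWithCorners ℝ (EuclideanSpace ℝ (Fin n)) H}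
  {M : Type*} [TopologicalSpace M] [ChartedSpace H M] [IsManifold I ∞ M]
  [T2Space M] [SigmaCompactSpace M] (Ω : VolumeForm I M)

lemma volumeDiv_add {X Y : ∀ x : M, TangentSpace I x}
    (hX : ContMDiff I I.tangent ∞ (fun x => (⟨x, X x⟩ : TangentBundle I M)))
    (hY : ContMDiff I I.tangent ∞ (fun x => (⟨x, Y x⟩ : TangentBundle I M))) (z : M) :
    volumeDiv I Ω (fun x => X x + Y x) z = volumeDiv I Ω X z + volumeDiv I Ω Y z := by
  have h := volumeDiv_sum Ω Finset.univ (X := ![X, Y]) (by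
    intro i
    fin_cases i
    exacts [hX, hY]) z
  simpa only [Fin.sum_univ_two, Matrix.cons_val_zero, Matrix.cons_val_one] using h

/-- The derivative term is the same as in `Connection.div_fsmul`, so the difference of the two
divergences is tensorial. -/
lemma volumeDiv_fsmul (f : C^∞⟮I, M; ℝ⟯) {X : ∀ x : M, TangentSpace I x}
    (hX : ContMDiff I I.tangent ∞ (fun x => (⟨x, X x⟩ : TangentBundle I M))) (z : M) :
    volumeDiv I Ω (fun x => f x • X x) z
      = f z * volumeDiv I Ω X z + dirDeriv (I := I) f z (X z) := by
  have hz : z ∈ (chartAt H z).source := mem_chart_source H z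
  refine mul_right_cancel₀ (coef_ne_zero Ω hz) ?_
  refine (volumeDiv_mul_coef Ω hz (f.contMDiff.smul_section hX z)).trans ?_
  rw [add_mul, mul_assoc, volumeDiv_mul_coef Ω hz (hX z)]
  have hf : MDifferentiableAt I 𝓘(ℝ, ℝ) f z := f.contMDiff.mdifferentiable (by simp) z
  have hj : ∀ j, dirDeriv (I := I) (fun w => coordComp I z j w (f w • X w) * coef Ω z w) z
      (coordField I z j z) = f z * dirDeriv (I := I)
        (fun w => coordComp I z j w (X w) * coef Ω z w) z (coordField I z j z)
        + coordComp I z j z (X z) * coef Ω z z * dirDeriv (I := I) f z (coordField I z j z) := by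
    intro j
    have h := dirDeriv_mul (g := fun w => coordComp I z j w (X w) * coef Ω z w) hf
      (((contMDiffAt_coordComp hz j (hX z)).mul
        (contMDiffAt_coef Ω hz)).mdifferentiableAt (by simp)) (coordField I z j z)
    refine Eq.trans (congrArg (fun g : M → ℝ => dirDeriv (I := I) g z (coordField I z j z)) ?_) h
    funext w
    rw [map_smul, smul_eq_mul, mul_assoc]
  have hXz : dirDeriv (I := I) f z (X z)
      = ∑ j, coordComp I z j z (X z) * dirDeriv (I := I) f z (coordField I z j z) := by
    conv_lhs => rw [← sum_coordComp_smul hz (X z)]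
    simp only [dirDeriv, map_sum, map_smul]
    rfl
  refine (Finset.sum_congr rfl fun j _ => hj j).trans ?_
  rw [Finset.sum_add_distrib, ← Finset.mul_sum, hXz, Finset.sum_mul]
  congr 1
  exact Finset.sum_congr rfl fun j _ => by ring

end VolumeDivergence

/-! ### The divergence defect and the reduced first variation. -/

section ConnectionEquation

variable {n : ℕ} {H : Type*} [TopologicalSpace H]
  {I : ModelWithCorners ℝ (EuclideanSpace ℝ (Fin n)) H}
  {M : Type*} [TopologicalSpace M] [ChartedSpace H M] [IsManifold I ∞ M]
  {F : Type*} [NormedAddCommGroup F] [NormedSpace ℝ F]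
  {E : M → Type*} [TopologicalSpace (TotalSpace F E)] [∀ x, AddCommGroup (E x)]
  [∀ x, Module ℝ (E x)] [∀ x, TopologicalSpace (E x)] [FiberBundle F E] [VectorBundle ℝ F E]


variable [FiniteDimensional ℝ F] [ContMDiffVectorBundle ∞ F E I] [T2Space M] [SigmaCompactSpace M]
  {C : CourantAlgebroid I F E}


namespace AdaptedFrame

variable {V : GeneralizedMetric C} {x₀ : M} (f : AdaptedFrame V x₀) {x : M}

lemma sum_coord (hx : x ∈ f.dom) (v : E x) :
    ∑ i, (f.η i * C.pairing x v (f.e i x)) • f.e i x = v :=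
  haveI : FiniteDimensional ℝ (E x) := VectorBundle.finiteDimensional ℝ F E x
  (f.ortho x hx).sum_coord (f.card x) v

/-- Expansion of an expression that is tensorial at a point in an adapted frame. -/
lemma tensorial_eq_sum (hx : x ∈ f.dom) {A : Sec I F E → ℝ}
    (hadd : ∀ ψ ψ', A (ψ + ψ') = A ψ + A ψ') (hsmul : ∀ h ψ, A (fsmul h ψ) = h x * A ψ)
    (ψ : Sec I F E) : A ψ = ∑ i, f.η i * C.pairing x (ψ x) (f.e i x) * A (f.e i) := by
  have h1 : A ψ = A (∑ i, fsmul (constFun (f.η i * C.pairing x (ψ x) (f.e i x))) (f.e i)) := by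
    refine tensorial_congr (x := x) hadd hsmul ?_
    rw [sec_sum_apply, ← f.sum_coord hx (ψ x)]
    refine Finset.sum_congr rfl fun i _ => ?_
    rw [f.sum_coord hx]
    rfl
  have h0 : A 0 = 0 := by simpa using hadd 0 0
  have hs : ∀ (s : Finset (Fin f.m)) (g : Fin f.m → Sec I F E), A (∑ i ∈ s, g i) = ∑ i ∈ s, A (g i) := by
    intro s g
    classical
    induction s using Finset.induction_on with
    | empty => simpa using h0
    | insert a s ha ih => rw [Finset.sum_insert ha, Finset.sum_insert ha, hadd, ih]
  rw [h1, hs]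
  exact Finset.sum_congr rfl fun i _ => hsmul _ _

end AdaptedFrame

namespace Connection

variable (D : Connection C) (Ω : VolumeForm I M)

/-- The difference of the divergence of a connection and that of a volume form. -/
def divDefect (ψ : Sec I F E) (x : M) : ℝ :=
  D.div ψ x - volumeDiv I Ω (fun z => C.anchor z (ψ z)) x

lemma div_add (ψ ψ' : Sec I F E) (x : M) : D.div (ψ + ψ') x = D.div ψ x + D.div ψ' x := by
  rw [div, div, div, ← map_add]
  congr 1
  ext v
  exact D.covAt_add ψ ψ' x v

lemma div_fsmul (V : GeneralizedMetric C) (h : C^∞⟮I, M; ℝ⟯) (ψ : Sec I F E) (x : M) :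
    D.div (fsmul h ψ) x = h x * D.div ψ x + C.act x (ψ x) h := by
  obtain ⟨f⟩ := nonempty_adaptedFrame V x
  have ho := f.ortho x f.mem_dom
  rw [D.div_eq_sum ho f.card_eq, D.div_eq_sum ho f.card_eq, Finset.mul_sum]
  have hact : C.act x (ψ x) h
      = ∑ i, f.η i * C.pairing x (ψ x) (f.e i x) * C.act x (f.e i x) h := by
    conv_lhs => rw [← f.sum_coord f.mem_dom (ψ x)]
    exact (map_sum (C.actForm x h) _ _).trans
      (Finset.sum_congr rfl fun i _ => map_smul (C.actForm x h) _ _)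
  rw [hact, ← Finset.sum_add_distrib]
  refine Finset.sum_congr rfl fun i _ => ?_
  rw [D.cov_fsmul, sec_add_apply, fsmul_apply, fsmul_apply, map_add, map_smul, map_smul,
    LinearMap.add_apply, LinearMap.smul_apply, LinearMap.smul_apply, smul_eq_mul, smul_eq_mul,
    CourantAlgebroid.actFun_apply]
  ring

lemma divDefect_add (ψ ψ' : Sec I F E) (x : M) :
    D.divDefect Ω (ψ + ψ') x = D.divDefect Ω ψ x + D.divDefect Ω ψ' x := by
  have h := volumeDiv_add Ω (C.anchor_smooth ψ) (C.anchor_smooth ψ') x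
  have h' : (fun z => C.anchor z ((ψ + ψ') z))
      = fun z => C.anchor z (ψ z) + C.anchor z (ψ' z) := by
    funext z
    exact map_add _ _ _
  rw [divDefect, divDefect, divDefect, div_add, h', h]
  ring

lemma divDefect_fsmul (V : GeneralizedMetric C) (h : C^∞⟮I, M; ℝ⟯) (ψ : Sec I F E) (x : M) :
    D.divDefect Ω (fsmul h ψ) x = h x * D.divDefect Ω ψ x := by
  have h1 := volumeDiv_fsmul Ω h (C.anchor_smooth ψ) x
  have h' : (fun z => C.anchor z (fsmul h ψ z)) = fun z => h z • C.anchor z (ψ z) := by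
    funext z
    exact map_smul _ _ _
  rw [divDefect, divDefect, D.div_fsmul V, h', h1, CourantAlgebroid.act]
  ring

lemma divDefect_eq_sum {V : GeneralizedMetric C} {x₀ : M} (f : AdaptedFrame V x₀) {x : M}
    (hx : x ∈ f.dom) (ψ : Sec I F E) : D.divDefect Ω ψ x
      = ∑ i, f.η i * C.pairing x (ψ x) (f.e i x) * D.divDefect Ω (f.e i) x :=
  f.tensorial_eq_sum hx (A := fun ψ => D.divDefect Ω ψ x) (fun ψ ψ' => D.divDefect_add Ω ψ ψ' x)
    (fun h ψ => D.divDefect_fsmul Ω V h ψ x) ψ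

/-- The first variation of the scalar curvature with respect to the connection, up to a
divergence. -/
def reducedVariation (N : CovTensor C) (V : GeneralizedMetric C) (x : M) : ℝ :=
  D.scalarLin N V x - volumeDiv I Ω (fun z => C.anchor z (N.contraction V z)) x

lemma continuous_reducedVariation (N : CovTensor C) (V : GeneralizedMetric C) :
    Continuous (D.reducedVariation Ω N V) :=
  (D.continuous_scalarLin N V).sub (continuous_volumeDiv Ω (C.anchor_smooth _))

/-- After removal of the exact divergence no derivative of `N` is left: `Div_∇` of the contraction
has been traded for the tensorial defect. -/
lemma reducedVariation_eq (N : CovTensor C) {V : GeneralizedMetric C} {x₀ : M}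
    (f : AdaptedFrame V x₀) {x : M} (hx : x ∈ f.dom) :
    D.reducedVariation Ω N V x = ∑ k, ∑ i, ∑ j,
      variationCoeff f.η (fun j => D.divDefect Ω (f.e j) x) (D.comp f.e x)
        (C.bracketComp f.e x) k i j * N.comp f.e x k i j := by
  have h1 : D.reducedVariation Ω N V x = D.divDefect Ω (N.contraction V) x
      + ∑ a, ∑ b, ∑ c, (f.η a * (f.η b - f.η c) * N.comp f.e x a a c * D.comp f.e x b b c
          + (f.η a + f.η b) * f.η c * N.comp f.e x b a c * D.comp f.e x a b c
          - (1 / 2) * (f.η a + f.η b) * f.η c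
            * (C.bracketComp f.e x b a c + D.comp f.e x c a b) * N.comp f.e x c a b) := by
    rw [reducedVariation, f.scalarLin_eq_div_add hx, divDefect]
    ring
  have h2 : D.divDefect Ω (N.contraction V) x = ∑ a, ∑ c, (f.η a + f.η c)
      * D.divDefect Ω (f.e c) x * N.comp f.e x a a c := by
    rw [D.divDefect_eq_sum Ω f hx, Finset.sum_comm]
    refine Finset.sum_congr rfl fun c _ => ?_
    rw [N.contraction_apply f hx, N.pairing_frameContraction_frame f hx, Finset.mul_sum,
      Finset.sum_mul]
    refine Finset.sum_congr rfl fun a _ => ?_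
    linear_combination f.η a * N.comp f.e x a a c * D.divDefect Ω (f.e c) x
      * (f.ortho x hx).mul_self c
  rw [h1, h2, sum_variationCoeff_mul]

end Connection

end ConnectionEquation



/-! ### Signature and the number of frame signs. -/

section Signature

variable {W : Type*} [AddCommGroup W] [Module ℝ W] [FiniteDimensional ℝ W]
  {g : LinearMap.BilinForm ℝ W} {m : ℕ} {η : Fin m → ℝ} {b : Fin m → W}

/-- Through this diagonal form the hypotheses `p ≠ 1` and `q ≠ 1` become conditions on the numbers
of positive and negative signs in a frame. -/
lemma IsOrthoFrame.equivalent_weightedSumSquares (h : IsOrthoFrame g η b)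
    (hm : m = Module.finrank ℝ W) (hsymm : ∀ u v, g u v = g v u) :
    QuadraticMap.Equivalent g.toQuadraticMap (QuadraticMap.weightedSumSquares ℝ η) := by
  classical
  let v : Module.Basis (Fin m) ℝ W :=
    basisOfLinearIndependentOfCardEqFinrank' b h.linearIndependent (by simpa using hm)
  have hv : ∀ i, v i = b i := fun i => by
    simp only [v, coe_basisOfLinearIndependentOfCardEqFinrank']
  have hassoc : QuadraticMap.associated (R := ℝ) g.toQuadraticMap = g :=
    QuadraticMap.associated_left_inverse ℝ hsymm
  have horth : (QuadraticMap.associated (R := ℝ) g.toQuadraticMap).IsOrthoᵢ v := by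
    rw [hassoc]
    intro i j hij
    change g (v i) (v j) = 0
    rw [hv, hv, h.ortho, if_neg hij]
  have h1 := QuadraticMap.basisRepr_eq_of_iIsOrtho g.toQuadraticMap v horth
  have h2 : (fun i => g.toQuadraticMap (v i)) = η := by
    funext i
    rw [LinearMap.BilinMap.toQuadraticMap_apply, hv, h.ortho, if_pos rfl]
  rw [h2] at h1
  rw [← h1]
  exact ⟨g.toQuadraticMap.isometryEquivBasisRepr v⟩

lemma IsOrthoFrame.card_pos_eq (h : IsOrthoFrame g η b) (hm : m = Module.finrank ℝ W)
    (hsymm : ∀ u v, g u v = g v u) :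
    (Finset.univ.filter fun i => η i = 1).card = sigPos g.toQuadraticMap := by
  rw [QuadraticForm.sigPos_of_equiv_weightedSumSquares
    (h.equivalent_weightedSumSquares hm hsymm), ← Set.ncard_coe_finset]
  congr 1
  ext i
  simp only [Finset.coe_filter, Finset.mem_univ, true_and, mem_ofPred_eq]
  rcases h.sign i with h1 | h1 <;> rw [h1] <;> norm_num

lemma IsOrthoFrame.card_neg_eq (h : IsOrthoFrame g η b) (hm : m = Module.finrank ℝ W)
    (hsymm : ∀ u v, g u v = g v u) :
    (Finset.univ.filter fun i => η i = -1).card = sigNeg g.toQuadraticMap := by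
  rw [QuadraticForm.sigNeg_of_equiv_weightedSumSquares
    (h.equivalent_weightedSumSquares hm hsymm), ← Set.ncard_coe_finset]
  congr 1
  ext i
  simp only [Finset.coe_filter, Finset.mem_univ, true_and, mem_ofPred_eq]
  rcases h.sign i with h1 | h1 <;> rw [h1] <;> norm_num

end Signature

/-! ### The equation of motion of the connection. -/

section LeviCivita

variable {n : ℕ} {H : Type*} [TopologicalSpace H]
  {I : ModelWithCorners ℝ (EuclideanSpace ℝ (Fin n)) H}
  {M : Type*} [TopologicalSpace M] [ChartedSpace H M] [IsManifold I ∞ M]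
  {F : Type*} [NormedAddCommGroup F] [NormedSpace ℝ F]
  {E : M → Type*} [TopologicalSpace (TotalSpace F E)] [∀ x, AddCommGroup (E x)]
  [∀ x, Module ℝ (E x)] [∀ x, TopologicalSpace (E x)] [FiberBundle F E] [VectorBundle ℝ F E]


variable [FiniteDimensional ℝ F] [ContMDiffVectorBundle ∞ F E I] [T2Space M] [SigmaCompactSpace M]
  {C : CourantAlgebroid I F E}


/-- The tensor `s ⊗ (t ∧ u)`. -/
def CovTensor.wedge (s t u : Sec I F E) : CovTensor C where
  map := LinearMap.mk₂ ℝ (fun ψ ψ' => fsmul (C.pair s ψ)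
      (fsmul (C.pair t ψ') u - fsmul (C.pair u ψ') t))
    (fun _ _ _ => by
      ext x
      simp only [fsmul_apply, CourantAlgebroid.pair_apply, sec_add_apply, map_add, add_smul])
    (fun _ _ _ => by
      ext x
      simp only [fsmul_apply, CourantAlgebroid.pair_apply, sec_smul_apply, map_smul, smul_eq_mul,
        mul_smul])
    (fun _ _ _ => by
      ext x
      simp only [fsmul_apply, CourantAlgebroid.pair_apply, sec_add_apply, sec_sub_apply, map_add,
        add_smul, ← smul_add]
      congr 1
      abel)
    (fun _ _ _ => by
      ext x
      simp only [fsmul_apply, CourantAlgebroid.pair_apply, sec_smul_apply, sec_sub_apply, map_smul,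
        smul_eq_mul, mul_smul, ← smul_sub]
      rw [smul_comm])
  fsmul_left f ψ ψ' := by
    ext x
    simp only [LinearMap.mk₂_apply, fsmul_apply, CourantAlgebroid.pair_apply, map_smul,
      smul_eq_mul, mul_smul]
  fsmul_right f ψ ψ' := by
    ext x
    simp only [LinearMap.mk₂_apply, fsmul_apply, CourantAlgebroid.pair_apply, map_smul,
      sec_sub_apply, smul_eq_mul, mul_smul, ← smul_sub]
    rw [smul_comm]
  skew ψ ψ' ψ'' x := by
    simp only [LinearMap.mk₂_apply, fsmul_apply, CourantAlgebroid.pair_apply, map_smul, map_sub,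
      sec_sub_apply, smul_eq_mul, LinearMap.smul_apply, LinearMap.sub_apply]
    rw [C.pairing_symm x (ψ' x) (u x), C.pairing_symm x (ψ' x) (t x)]
    ring

lemma CovTensor.wedge_comp {V : GeneralizedMetric C} {x₀ : M} (f : AdaptedFrame V x₀) {x : M}
    (hx : x ∈ f.dom) (k i j a b c : Fin f.m) :
    (CovTensor.wedge (C := C) (f.e k) (f.e i) (f.e j)).comp f.e x a b c
      = (if k = a then f.η k else 0) * ((if i = b then f.η i else 0) * (if j = c then f.η j else 0)
        - (if j = b then f.η j else 0) * (if i = c then f.η i else 0)) := by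
  have ho := (f.ortho x hx).ortho
  simp only [comp, wedge, LinearMap.mk₂_apply, fsmul_apply, CourantAlgebroid.pair_apply, map_smul,
    map_sub, sec_sub_apply, smul_eq_mul, LinearMap.smul_apply, LinearMap.sub_apply, ho]

namespace Connection

variable (D : Connection C) (V : GeneralizedMetric C) (Ω : VolumeForm I M)

lemma torsion_frame {m : ℕ} (e : Fin m → Sec I F E) (i j k : Fin m) (x : M) :
    D.torsion (e i) (e j) (e k) x = D.comp e x i j k - D.comp e x j i k
      - C.bracketComp e x i j k + D.comp e x k i j := by
  simp only [torsion, sec_sub_apply, map_sub, LinearMap.sub_apply]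
  rfl

/-- Torsion is function-linear in all three slots; in the first one the term `⟨∇_ψ'' ψ, ψ'⟩` cancels
the gradient term of the left Leibniz rule of the bracket. Frame components therefore suffice. -/
lemma torsion_eq_zero {V : GeneralizedMetric C} {x₀ : M} (f : AdaptedFrame V x₀) {x : M}
    (hx : x ∈ f.dom) (h : ∀ i j k, D.torsion (f.e i) (f.e j) (f.e k) x = 0)
    (ψ ψ' ψ'' : Sec I F E) : D.torsion ψ ψ' ψ'' x = 0 := by
  have h3 : ∀ i j, D.torsion (f.e i) (f.e j) ψ'' x = 0 := fun i j => by
    rw [f.tensorial_eq_sum hx (A := fun ψ'' => D.torsion (f.e i) (f.e j) ψ'' x)]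
    · exact Finset.sum_eq_zero fun k _ => by rw [h, mul_zero]
    · intro a b
      simp only [torsion, sec_add_apply, map_add, LinearMap.add_apply]
      ring
    · intro g a
      simp only [torsion, fsmul_apply, map_smul, LinearMap.smul_apply, D.cov_fsmul_left,
        smul_eq_mul]
      ring
  have h2 : ∀ i, D.torsion (f.e i) ψ' ψ'' x = 0 := fun i => by
    rw [f.tensorial_eq_sum hx (A := fun ψ' => D.torsion (f.e i) ψ' ψ'' x)]
    · exact Finset.sum_eq_zero fun k _ => by rw [h3, mul_zero]
    · intro a b
      simp only [torsion, sec_add_apply, sec_sub_apply, map_add, map_sub, LinearMap.add_apply,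
        LinearMap.sub_apply]
      ring
    · intro g a
      simp only [torsion, fsmul_apply, sec_sub_apply, map_sub, map_smul, LinearMap.sub_apply,
        D.cov_fsmul, D.cov_fsmul_left, C.bracket_fsmul_right, sec_add_apply, map_add,
        LinearMap.add_apply, LinearMap.smul_apply, smul_eq_mul]
      ring
  rw [f.tensorial_eq_sum hx (A := fun ψ => D.torsion ψ ψ' ψ'' x)]
  · exact Finset.sum_eq_zero fun k _ => by rw [h2, mul_zero]
  · intro a b
    simp only [torsion, sec_add_apply, sec_sub_apply, map_add, map_sub, LinearMap.add_apply,
      LinearMap.sub_apply]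
    ring
  · intro g a
    simp only [torsion, fsmul_apply, sec_sub_apply, map_sub, map_smul, LinearMap.sub_apply,
      D.cov_fsmul, D.cov_fsmul_left, C.bracket_fsmul_left, sec_add_apply, map_add,
      LinearMap.add_apply, LinearMap.smul_apply, smul_eq_mul, CourantAlgebroid.actFun_apply]
    ring

variable {V D} in
-- Compatibility speaks about sections lying in `V₊` everywhere, whereas frame sections do so only
-- locally. The frame is cut off by a function equal to one near `x`, whose derivative does not
-- contribute.
lemma IsMetricCompatible.comp_eq_zero (h : D.IsMetricCompatible V) {x₀ : M}
    (f : AdaptedFrame V x₀) {x : M} (hx : x ∈ f.dom) {k i j : Fin f.m} (hij : f.η i ≠ f.η j) :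
    D.comp f.e x k i j = 0 := by
  have ho := f.ortho x hx
  obtain ⟨χ, -, hχU, hχ1, -⟩ := exists_cutoff I (f.isOpen_dom.mem_nhds hx)
  have main : ∀ i j, f.η i = 1 → f.η j = -1 → D.comp f.e x k i j = 0 := by
    intro i j hi hj
    have hmem : ∀ z, fsmul χ (f.e i) z ∈ V.plus z := by
      intro z
      by_cases hz : z ∈ tsupport χ
      · exact Submodule.smul_mem _ _ (f.mem_plus z (hχU hz) i hi)
      · rw [fsmul_apply, image_eq_zero_of_notMem_tsupport hz, zero_smul]
        exact Submodule.zero_mem _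
    have h1 := V.pairing_plus_minus (h (f.e k) _ hmem x) (f.mem_minus x hx j hj)
    have hact : C.act x (f.e k x) χ = 0 := by
      rw [← C.act_const x (f.e k x) 1]
      exact C.act_congr _ hχ1
    rw [D.cov_fsmul, sec_add_apply, fsmul_apply, fsmul_apply, hχ1.self_of_nhds,
      CourantAlgebroid.actFun_apply, hact, zero_smul, one_smul, add_zero] at h1
    exact h1
  rcases ho.sign i with hi | hi <;> rcases ho.sign j with hj | hj
  · exact absurd (hi.trans hj.symm) hij
  · exact main i j hi hj
  · rw [f.comp_skew hx, main j i hj hi, neg_zero]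
  · exact absurd (hi.trans hj.symm) hij

/-- The pairing of `ψ'` with a frame section of `V₋` vanishes near `x`, so metricity moves the
derivative onto that frame section, whose derivative has no component in `V₊`. -/
lemma isMetricCompatible_of_comp_eq_zero (h : ∀ (x : M) (f : AdaptedFrame V x) (k i j : Fin f.m),
    f.η i ≠ f.η j → D.comp f.e x k i j = 0) : D.IsMetricCompatible V := by
  intro ψ ψ' hψ' x
  obtain ⟨f⟩ := nonempty_adaptedFrame V x
  have hx := f.mem_dom
  have ho := f.ortho x hx
  have hcov : ∀ i j, f.η i ≠ f.η j → C.pairing x (D.cov ψ (f.e i) x) (f.e j x) = 0 := by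
    intro i j hij
    rw [f.tensorial_eq_sum hx (A := fun ψ => C.pairing x (D.cov ψ (f.e i) x) (f.e j x))]
    · exact Finset.sum_eq_zero fun k _ => mul_eq_zero_of_right _ (h x f k i j hij)
    · intro a b
      simp only [map_add, LinearMap.add_apply, sec_add_apply]
    · intro g a
      simp only [D.cov_fsmul_left, fsmul_apply, map_smul, LinearMap.smul_apply, smul_eq_mul]
  have horth : ∀ j, f.η j = -1 → C.pairing x (D.cov ψ ψ' x) (f.e j x) = 0 := by
    intro j hj
    have h1 := D.act_pairing ψ ψ' (f.e j) x
    have h2 : C.act x (ψ x) (fun z => C.pairing z (ψ' z) (f.e j z)) = 0 := by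
      rw [← C.act_const x (ψ x) 0]
      refine C.act_congr _ ?_
      filter_upwards [f.dom_mem_nhds] with z hz
        using V.pairing_plus_minus (hψ' z) (f.mem_minus z hz j hj)
    have h3 : C.pairing x (ψ' x) (D.cov ψ (f.e j) x) = 0 := by
      rw [f.pairing_eq hx]
      refine Finset.sum_eq_zero fun i _ => ?_
      rcases ho.sign i with hi | hi
      · rw [hcov j i (by rw [hi, hj]; norm_num), mul_zero]
      · rw [V.pairing_plus_minus (hψ' x) (f.mem_minus x hx i hi), mul_zero, zero_mul]
    linarith
  rw [← f.sum_coord hx (D.cov ψ ψ' x)]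
  refine Submodule.sum_mem _ fun i _ => ?_
  rcases ho.sign i with hi | hi
  · exact Submodule.smul_mem _ _ (f.mem_plus x hx i hi)
  · rw [horth i hi, mul_zero, zero_smul]
    exact Submodule.zero_mem _

/-- The equation of motion of the connection. -/
lemma reducedVariation_eq_zero_iff {p q : ℕ} (hsign : C.HasSignature p q) (hp : p ≠ 1)
    (hq : q ≠ 1) : (∀ (N : CovTensor C) (x : M), D.reducedVariation Ω N V x = 0) ↔
      D.IsLeviCivita V ∧ D.HasVolumeDiv Ω := by
  have halg : ∀ (x : M) (f : AdaptedFrame V x), _ := fun x f =>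
    haveI : FiniteDimensional ℝ (E x) := VectorBundle.finiteDimensional ℝ F E x
    variationCoeff_symm_iff (δ := fun j => D.divDefect Ω (f.e j) x) (Γ := D.comp f.e x)
      (B := C.bracketComp f.e x) (f.ortho x f.mem_dom).sign
      (by rw [(f.ortho x f.mem_dom).card_pos_eq (f.card x) (C.pairing_symm x), (hsign x).1]
          exact hp)
      (by rw [(f.ortho x f.mem_dom).card_neg_eq (f.card x) (C.pairing_symm x), (hsign x).2]
          exact hq)
      (f.comp_skew f.mem_dom D) (f.bracketComp_skew f.mem_dom) (f.bracketComp_skew_left f.mem_dom)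
  constructor
  · intro h
    have hsymm : ∀ (x : M) (f : AdaptedFrame V x), _ := fun x f => (halg x f).1 (by
      intro k i j
      -- Testing with `e k ⊗ (e i ∧ e j)` isolates the skew part of the coefficient in its last two
      -- indices.
      have h1 := h (CovTensor.wedge (f.e k) (f.e i) (f.e j)) x
      rw [D.reducedVariation_eq Ω _ f f.mem_dom] at h1
      simp only [CovTensor.wedge_comp f f.mem_dom] at h1
      have h2 : ∀ X : Fin f.m → Fin f.m → Fin f.m → ℝ, ∑ a, ∑ b, ∑ c, X a b c
          * ((if k = a then f.η k else 0) * ((if i = b then f.η i else 0)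
            * (if j = c then f.η j else 0) - (if j = b then f.η j else 0)
            * (if i = c then f.η i else 0))) = f.η k * f.η i * f.η j * (X k i j - X k j i) := by
        intro X
        simp only [mul_sub, mul_ite, ite_mul, mul_zero, zero_mul, Finset.sum_sub_distrib,
          Finset.sum_ite_eq, Finset.mem_univ, if_true]
        ring
      rw [h2] at h1
      have ho := f.ortho x f.mem_dom
      have h3 := (mul_eq_zero.1 h1).resolve_left
        (mul_ne_zero (mul_ne_zero (ho.ne_zero k) (ho.ne_zero i)) (ho.ne_zero j))
      exact sub_eq_zero.1 h3)
    refine ⟨⟨D.isMetricCompatible_of_comp_eq_zero V fun x f => (hsymm x f).1,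
      fun ψ ψ' ψ'' x => ?_⟩, fun ψ x => ?_⟩
    · obtain ⟨f⟩ := nonempty_adaptedFrame V x
      exact D.torsion_eq_zero f f.mem_dom (fun i j k => by
        rw [torsion_frame]
        exact (hsymm x f).2.1 i j k) ψ ψ' ψ''
    · obtain ⟨f⟩ := nonempty_adaptedFrame V x
      have h1 := D.divDefect_eq_sum Ω f f.mem_dom ψ
      rw [Finset.sum_eq_zero fun i _ => by rw [(hsymm x f).2.2 i, mul_zero]] at h1
      exact sub_eq_zero.1 h1
  · rintro ⟨⟨hm, ht⟩, hv⟩ N x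
    obtain ⟨f⟩ := nonempty_adaptedFrame V x
    have hx := f.mem_dom
    have hs := (halg x f).2 ⟨fun k i j hij => hm.comp_eq_zero f hx hij, fun i j k => by
      rw [← torsion_frame]
      exact ht _ _ _ x, fun j => sub_eq_zero.2 (hv _ x)⟩
    rw [D.reducedVariation_eq Ω N f hx]
    refine Finset.sum_eq_zero fun k _ => ?_
    -- Coefficients symmetric in the last two indices, contracted with the skew components of `N`,
    -- sum to zero.
    have h1 : ∀ X : Fin f.m → Fin f.m → ℝ, (∀ i j, X i j = -X j i) → ∑ i, ∑ j, X i j = 0 := by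
      intro X hX
      have h2 : ∑ i, ∑ j, X i j = -∑ i, ∑ j, X i j := by
        conv_lhs => rw [Finset.sum_comm]
        rw [← Finset.sum_neg_distrib]
        refine Finset.sum_congr rfl fun i _ => ?_
        rw [← Finset.sum_neg_distrib]
        exact Finset.sum_congr rfl fun j _ => hX j i
      linarith
    refine h1 _ fun i j => ?_
    rw [hs k i j, N.comp_skew f.e x k i j]
    ring

/-- This holds for the reduced variation and not for `scalarLin`, which differentiates `N`; it is
what makes the fundamental lemma applicable. -/
lemma reducedVariation_fmul (N : CovTensor C) (h : C^∞⟮I, M; ℝ⟯) (x : M) :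
    D.reducedVariation Ω (N.fmul h) V x = h x * D.reducedVariation Ω N V x := by
  obtain ⟨f⟩ := nonempty_adaptedFrame V x
  rw [D.reducedVariation_eq Ω _ f f.mem_dom, D.reducedVariation_eq Ω _ f f.mem_dom]
  simp only [Finset.mul_sum, CovTensor.fmul_comp]
  exact Finset.sum_congr rfl fun k _ => Finset.sum_congr rfl fun i _ =>
    Finset.sum_congr rfl fun j _ => by ring

/-- The contraction of `N` vanishes wherever `N` does, so its divergence integrates to zero over
`K`. -/
lemma volInt_scalarLin (o : VolumeForm I M) {K : Set M} (hK : IsCompact K) (N : CovTensor C)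
    (h0 : ∀ x, x ∉ K ∨ x ∈ I.boundary M → ∀ ψ φ, N.map ψ φ x = 0) :
    volInt o Ω K (D.scalarLin N V) = volInt o Ω K (D.reducedVariation Ω N V) := by
  have h1 := volInt_volumeDiv Ω o hK (C.anchor_smooth (N.contraction V)) fun x hx => by
    rw [N.contraction_eq_zero (h0 x hx), map_zero]
  have h2 := volInt_add o Ω hK (D.continuous_reducedVariation Ω N V)
    (continuous_volumeDiv Ω (C.anchor_smooth (N.contraction V)))
  rw [h1, add_zero] at h2
  rw [← h2]
  refine volInt_congr o Ω hK fun x _ => ?_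
  rw [reducedVariation, sub_add_cancel]

end Connection

end LeviCivita



/-! ### Construction of enough variations. -/

section TestVariations

variable {n : ℕ} {H : Type*} [TopologicalSpace H]
  {I : ModelWithCorners ℝ (EuclideanSpace ℝ (Fin n)) H}
  {M : Type*} [TopologicalSpace M] [ChartedSpace H M] [IsManifold I ∞ M]
  {F : Type*} [NormedAddCommGroup F] [NormedSpace ℝ F]
  {E : M → Type*} [TopologicalSpace (TotalSpace F E)] [∀ x, AddCommGroup (E x)]
  [∀ x, Module ℝ (E x)] [∀ x, TopologicalSpace (E x)] [FiberBundle F E] [VectorBundle ℝ F E]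


variable [FiniteDimensional ℝ F] [ContMDiffVectorBundle ∞ F E I] [T2Space M] [SigmaCompactSpace M]
  {C : CourantAlgebroid I F E}


namespace GeneralizedMetric

variable (V : GeneralizedMetric C)

/-- The graph of a map `V₊ → E` on which the pairing is positive. -/
def graph (φ : ∀ x, E x →ₗ[ℝ] E x) (hφ : ∀ ψ : Sec I F E, ∃ ψ' : Sec I F E, ∀ x, φ x (ψ x) = ψ' x)
    (hpos : ∀ x, ∀ v ∈ V.plus x, v ≠ 0 → 0 < C.pairing x (v + φ x v) (v + φ x v)) :
    GeneralizedMetric C where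
  plus x := (V.plus x).map (LinearMap.id + φ x)
  smooth x₀ := by
    obtain ⟨k, s, hs⟩ := V.smooth x₀
    choose t ht using fun i => hφ (s i)
    refine ⟨k, fun i => s i + t i, ?_⟩
    filter_upwards [hs] with x hx
    have heq : (fun i => (s i + t i) x) = (LinearMap.id + φ x : E x →ₗ[ℝ] E x) ∘ fun i => s i x := by
      funext i
      rw [sec_add_apply, ← ht]
      rfl
    rw [heq]
    refine ⟨?_, ?_⟩
    · refine hx.1.map (f := (LinearMap.id + φ x : E x →ₗ[ℝ] E x)) ?_
      rw [hx.2, Submodule.disjoint_def]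
      intro v hv h0
      by_contra hne
      have h1 := hpos x v hv hne
      rw [show v + φ x v = 0 from h0] at h1
      simp at h1
    · rw [range_comp, Submodule.span_image, hx.2]
  pos x w hw h0 := by
    obtain ⟨v, hv, rfl⟩ := hw
    refine hpos x v hv fun h => h0 ?_
    rw [h, map_zero]
  maximal x W hW hle := by
    have hfd : FiniteDimensional ℝ (E x) := VectorBundle.finiteDimensional ℝ F E x
    refine (Submodule.eq_of_le_of_finrank_le hle ?_).symm
    -- A positive subspace meets `V₋` trivially, so its dimension is at most that of `V₊`, which is
    -- also the dimension of the graph.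
    have hdisj : W ⊓ V.minus x = ⊥ := by
      rw [Submodule.eq_bot_iff]
      rintro v ⟨hv, hv'⟩
      by_contra hne
      exact absurd (hW v hv hne) (V.pairing_nonpos_of_mem_minus hv').not_gt
    have h1 := Submodule.finrank_add_finrank_le_of_disjoint (disjoint_iff.2 hdisj)
    have h2 := Submodule.finrank_add_eq_of_isCompl (V.isCompl x)
    have h3 : Module.finrank ℝ ((V.plus x).map (LinearMap.id + φ x))
        = Module.finrank ℝ (V.plus x) := by
      rw [← LinearMap.range_domRestrict]
      refine LinearMap.finrank_range_of_inj (LinearMap.ker_eq_bot.1 (LinearMap.ker_eq_bot'.2 ?_))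
      rintro ⟨v, hv⟩ h0
      rw [Submodule.mk_eq_zero]
      by_contra hne
      have h1 := hpos x v hv hne
      rw [show v + φ x v = 0 from h0] at h1
      simp at h1
    omega

lemma pairing_sq_le {x : M} {u v : E x} (hu : u ∈ V.plus x) (hv : v ∈ V.plus x) :
    C.pairing x u v ^ 2 ≤ C.pairing x u u * C.pairing x v v := by
  have hnn : ∀ w ∈ V.plus x, 0 ≤ C.pairing x w w := fun w hw => by
    by_cases h : w = 0
    · simp [h]
    · exact (V.pos x w hw h).le
  have h : ∀ r : ℝ, 0 ≤ C.pairing x v v * (r * r) + 2 * C.pairing x u v * r + C.pairing x u u := by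
    intro r
    have h1 := hnn (u + r • v) (Submodule.add_mem _ hu (Submodule.smul_mem _ r hv))
    simp only [map_add, map_smul, LinearMap.add_apply, LinearMap.smul_apply, smul_eq_mul] at h1
    rw [C.pairing_symm x v u] at h1
    linarith
  have := discrim_le_zero h
  rw [discrim] at this
  linarith

end GeneralizedMetric

namespace VolumeForm

/-- The volume form `exp(g) Ω`. -/
def expMul (Ω : VolumeForm I M) (g : C^∞⟮I, M; ℝ⟯) : VolumeForm I M where
  form x := Real.exp (g x) • Ω.form x
  smooth X := (Real.contDiff_exp.contMDiff.comp g.contMDiff).mul (Ω.smooth X)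
  ne_zero x := smul_ne_zero (Real.exp_ne_zero _) (Ω.ne_zero x)

end VolumeForm

/-- The trilinear form `⟨n(u, v), w⟩`. -/
def CovTensor.triForm (N : CovTensor C) (x : M) : E x →ₗ[ℝ] E x →ₗ[ℝ] E x →ₗ[ℝ] ℝ :=
  LinearMap.mk₂ ℝ (fun u v => C.pairing x (N.map (ext I F x u) (ext I F x v) x))
    (fun _ _ _ => by simp only [map_add, LinearMap.add_apply, sec_add_apply])
    (fun _ _ _ => by simp only [map_smul, LinearMap.smul_apply, sec_smul_apply])
    (fun _ _ _ => by simp only [map_add, sec_add_apply])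
    (fun _ _ _ => by simp only [map_smul, sec_smul_apply])

lemma CovTensor.triForm_apply (N : CovTensor C) (ψ ψ' ψ'' : Sec I F E) (x : M) :
    N.triForm x (ψ x) (ψ' x) (ψ'' x) = C.pairing x (N.map ψ ψ' x) (ψ'' x) := by
  simp only [triForm, LinearMap.mk₂_apply]
  rw [N.congr_left _ (ext_apply x (ψ x)), N.congr_right _ (ext_apply x (ψ' x))]

namespace Variation

variable (V : GeneralizedMetric C) (Ω : VolumeForm I M) (D : Connection C) (K : Set M)

/-- The variation of the volume form in the direction `f`. -/
def ofFunction (f : C^∞⟮I, M; ℝ⟯) (hf : ∀ x, x ∉ K ∨ x ∈ I.boundary M → f x = 0) :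
    Variation V Ω D K where
  φ := 0
  φ_smooth _ := ⟨0, fun _ => rfl⟩
  φ_mem x _ _ := (V.minus x).zero_mem
  φ_zero _ _ := rfl
  f := f
  f_smooth := f.contMDiff
  f_zero := hf
  N := 0
  N_smooth _ _ _ := contMDiff_const
  N_skew x u v w := neg_zero.symm
  N_zero _ _ := rfl
  metric _ := V
  metric_eq := .of_forall fun ε x => by simp
  vol ε := Ω.expMul (constFun ε * f)
  vol_eq _ _ := rfl
  conn _ := D
  conn_eq ε ψ ψ' ψ'' x := by simp

/-- The variation of the connection in the direction `N`. -/
def ofTensor (N : CovTensor C) (hN : ∀ x, x ∉ K ∨ x ∈ I.boundary M → ∀ ψ φ, N.map ψ φ x = 0) :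
    Variation V Ω D K where
  φ := 0
  φ_smooth _ := ⟨0, fun _ => rfl⟩
  φ_mem x _ _ := (V.minus x).zero_mem
  φ_zero _ _ := rfl
  f := 0
  f_smooth := contMDiff_const
  f_zero _ _ := rfl
  N := N.triForm
  N_smooth ψ ψ' ψ'' := by
    simp only [CovTensor.triForm_apply]
    exact C.pairing_smooth _ _
  N_skew x u v w := by
    have h := N.skew (ext I F x u) (ext I F x v) (ext I F x w) x
    simp only [CovTensor.triForm, LinearMap.mk₂_apply]
    rw [ext_apply, ext_apply, C.pairing_symm x v] at h
    linarith
  N_zero x hx := by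
    ext u v w
    simp only [CovTensor.triForm, LinearMap.mk₂_apply, hN x hx, map_zero]
    rfl
  metric _ := V
  metric_eq := .of_forall fun ε x => by simp
  vol _ := Ω
  vol_eq _ _ := by simp
  conn ε := D.addTensor N ε
  conn_eq ε ψ ψ' ψ'' x := by
    rw [CovTensor.triForm_apply, Connection.addTensor_cov, sec_add_apply, sec_smul_apply, map_add,
      map_smul, LinearMap.add_apply, LinearMap.smul_apply, smul_eq_mul]

lemma ofTensor_tensor (N : CovTensor C)
    (hN : ∀ x, x ∉ K ∨ x ∈ I.boundary M → ∀ ψ φ, N.map ψ φ x = 0) :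
    (ofTensor V Ω D K N hN).tensor = N := by
  have h : ∀ N N' : CovTensor C, N.map = N'.map → N = N' := by
    rintro ⟨⟩ ⟨⟩ h
    cases h
    rfl
  refine h _ _ ?_
  change D.cov + (1 : ℝ) • N.map - D.cov = N.map
  rw [one_smul, add_sub_cancel_left]

variable {K}

/-- The square of a graph vector is `⟨v, v⟩ + ε² ⟨s, v⟩² ⟨t, t⟩`. By Cauchy–Schwarz on `V₊` it is at
least `(1 - ε² c) ⟨v, v⟩`, where `c` bounds `|⟨s, s⟩ ⟨t, t⟩|` on `K`; off `K` nothing changes. Hence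
one `ε` serves all points. -/
lemma eventually_graph_pos (hK : IsCompact K) {s t : Sec I F E} (hs : ∀ x, s x ∈ V.plus x)
    (ht : ∀ x, t x ∈ V.minus x) (ht0 : ∀ x, x ∉ K → t x = 0) :
    ∀ᶠ ε in 𝓝 (0 : ℝ), ∀ x, ∀ v ∈ V.plus x, v ≠ 0 →
      0 < C.pairing x (v + ε • C.pairing x (s x) v • t x) (v + ε • C.pairing x (s x) v • t x) := by
  obtain ⟨c, hc⟩ := hK.exists_bound_of_continuousOn
    ((C.pairing_continuous s s).mul (C.pairing_continuous t t)).continuousOn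
  have hsmall : ∀ᶠ ε in 𝓝 (0 : ℝ), ε ^ 2 * c < 1 := by
    have : Filter.Tendsto (fun ε : ℝ => ε ^ 2 * c) (𝓝 0) (𝓝 (0 ^ 2 * c)) :=
      ((continuous_pow 2).mul continuous_const).tendsto 0
    rw [zero_pow two_ne_zero, zero_mul] at this
    exact this.eventually (gt_mem_nhds one_pos)
  filter_upwards [hsmall] with ε hε x v hv hne
  have hvv := V.pos x v hv hne
  have hexp : C.pairing x (v + ε • C.pairing x (s x) v • t x) (v + ε • C.pairing x (s x) v • t x)
      = C.pairing x v v + ε ^ 2 * (C.pairing x (s x) v ^ 2 * C.pairing x (t x) (t x)) := by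
    have h1 := V.pairing_plus_minus hv (ht x)
    have h2 := V.pairing_minus_plus (ht x) hv
    simp only [map_add, map_smul, LinearMap.add_apply, LinearMap.smul_apply, smul_eq_mul, h1, h2]
    ring
  rw [hexp]
  by_cases hx : x ∈ K
  · have h1 := hc x hx
    rw [Real.norm_eq_abs] at h1
    have h2 := V.pairing_sq_le (hs x) hv
    have h3 := V.pairing_nonpos_of_mem_minus (ht x)
    have h4 : C.pairing x (s x) (s x) * C.pairing x v v * C.pairing x (t x) (t x)
        ≤ C.pairing x (s x) v ^ 2 * C.pairing x (t x) (t x) := mul_le_mul_of_nonpos_right h2 h3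
    have h5 : -c * C.pairing x v v
        ≤ C.pairing x (s x) (s x) * C.pairing x (t x) (t x) * C.pairing x v v :=
      mul_le_mul_of_nonneg_right (neg_le_of_abs_le h1) hvv.le
    have h6 : ε ^ 2 * (-c * C.pairing x v v)
        ≤ ε ^ 2 * (C.pairing x (s x) v ^ 2 * C.pairing x (t x) (t x)) :=
      mul_le_mul_of_nonneg_left (by linarith) (sq_nonneg ε)
    nlinarith [mul_pos (sub_pos.2 hε) hvv]
  · rw [ht0 x hx, map_zero, mul_zero, mul_zero, add_zero]
    exact hvv

open Classical in
/-- The variation of the generalized metric in the direction `⟨s, ·⟩ t`. -/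
def ofSections (hK : IsCompact K) (s t : Sec I F E) (hs : ∀ x, s x ∈ V.plus x)
    (ht : ∀ x, t x ∈ V.minus x) (ht0 : ∀ x, x ∉ K ∨ x ∈ I.boundary M → t x = 0) :
    Variation V Ω D K where
  φ x := (C.pairing x (s x)).smulRight (t x)
  φ_smooth ψ := ⟨fsmul (C.pair s ψ) t, fun _ => rfl⟩
  φ_mem x v _ := Submodule.smul_mem _ _ (ht x)
  φ_zero x hx := by
    rw [ht0 x hx]
    ext v
    simp
  f := 0
  f_smooth := contMDiff_const
  f_zero _ _ := rfl
  N := 0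
  N_smooth _ _ _ := contMDiff_const
  N_skew x u v w := neg_zero.symm
  N_zero _ _ := rfl
  -- For `ε` too large the graph may fail to be positive. Any generalised metric will do there,
  -- since `metric_eq` constrains only small `ε`.
  metric ε := if hpos : ∀ x, ∀ v ∈ V.plus x, v ≠ 0 →
      0 < C.pairing x (v + ε • C.pairing x (s x) v • t x) (v + ε • C.pairing x (s x) v • t x) then
    V.graph (fun x => ε • (C.pairing x (s x)).smulRight (t x))
      (fun ψ => ⟨ε • fsmul (C.pair s ψ) t, fun _ => rfl⟩)
      hpos
    else V
  metric_eq := by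
    filter_upwards [eventually_graph_pos V hK hs ht fun x hx => ht0 x (Or.inl hx)] with ε hε x
    rw [dif_pos hε]
    rfl
  vol _ := Ω
  vol_eq _ _ := by simp
  conn _ := D
  conn_eq ε ψ ψ' ψ'' x := by simp

lemma metricPart_ofSections (hK : IsCompact K) (s t : Sec I F E) (hs : ∀ x, s x ∈ V.plus x)
    (ht : ∀ x, t x ∈ V.minus x) (ht0 : ∀ x, x ∉ K ∨ x ∈ I.boundary M → t x = 0) (x : M) :
    (ofSections V Ω D hK s t hs ht ht0).metricPart x = 4 * D.ric x (s x) (t x) := by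
  obtain ⟨f⟩ := nonempty_adaptedFrame V x
  have hx := f.mem_dom
  rw [metricPart_eq _ f hx]
  have h1 : D.ric x (s x) (t x)
      = ∑ i, f.η i * C.pairing x (s x) (f.e i x) * D.ric x (f.e i x) (t x) := by
    rw [← D.ricForm_apply]
    conv_lhs => rw [← f.sum_coord hx (s x)]
    rw [map_sum, LinearMap.sum_apply]
    exact Finset.sum_congr rfl fun i _ => by
      rw [map_smul, LinearMap.smul_apply, smul_eq_mul, D.ricForm_apply]
  rw [h1, Finset.mul_sum]
  refine Finset.sum_congr rfl fun i _ => ?_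
  have h2 : C.pairing x (s x) (V.projPlus x (f.e i x)) = C.pairing x (s x) (f.e i x) := by
    rcases (f.ortho x hx).sign i with hi | hi
    · rw [V.projPlus_of_mem_plus (f.mem_plus x hx i hi)]
    · rw [V.projPlus_of_mem_minus (f.mem_minus x hx i hi), map_zero,
        V.pairing_plus_minus (hs x) (f.mem_minus x hx i hi)]
  change f.η i * (4 * D.ric x (f.e i x)
    (C.pairing x (s x) (V.projPlus x (f.e i x)) • t x)) = _
  rw [h2, ← D.ricForm_apply, map_smul, smul_eq_mul, D.ricForm_apply]
  ring

variable {V Ω D}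
variable (v : Variation V Ω D K)

lemma metricPart_eq_zero (h : v.φ = 0) (x : M) : v.metricPart x = 0 := by
  obtain ⟨f⟩ := nonempty_adaptedFrame V x
  rw [v.metricPart_eq f f.mem_dom]
  refine Finset.sum_eq_zero fun i _ => ?_
  rw [h, ← D.ricForm_apply]
  simp

lemma metricPart_eq_zero_of_isRicciCompatible (h : D.IsRicciCompatible V) (x : M) :
    v.metricPart x = 0 := by
  obtain ⟨f⟩ := nonempty_adaptedFrame V x
  rw [v.metricPart_eq f f.mem_dom]
  refine Finset.sum_eq_zero fun i _ => ?_
  rcases (f.ortho x f.mem_dom).sign i with hi | hi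
  · have hp := f.mem_plus x f.mem_dom i hi
    rw [V.projPlus_of_mem_plus hp, h x _ hp _ (v.φ_mem x _ hp), mul_zero, mul_zero]
  · rw [V.projPlus_of_mem_minus (f.mem_minus x f.mem_dom i hi), map_zero, ← D.ricForm_apply,
      map_zero, mul_zero, mul_zero]

lemma tensor_map_eq_zero {x : M} (h : v.N x = 0) (ψ φ : Sec I F E) : v.tensor.map ψ φ x = 0 := by
  refine C.ext_pairing fun w => ?_
  rw [← ext_apply (I := I) (F := F) x w, v.pairing_tensor, h, map_zero]
  rfl

lemma scalarLin_eq_zero (h : v.N = 0) (x : M) : D.scalarLin v.tensor V x = 0 := by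
  have h1 : ∀ ε, D.addTensor v.tensor ε = D := fun ε => Connection.ext_cov <| by
    ext ψ ψ' y
    rw [Connection.addTensor_cov, sec_add_apply, sec_smul_apply,
      v.tensor_map_eq_zero (congrFun h y), smul_zero, add_zero]
  rw [Connection.scalarLin, h1, h1, sub_self, zero_div]

end Variation

end TestVariations

/-! ### The three equations of motion and their combination. -/

section MainTheorem

variable {n : ℕ} {H : Type*} [TopologicalSpace H]
  {I : ModelWithCorners ℝ (EuclideanSpace ℝ (Fin n)) H}
  {M : Type*} [TopologicalSpace M] [ChartedSpace H M] [IsManifold I ∞ M]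
  {F : Type*} [NormedAddCommGroup F] [NormedSpace ℝ F]
  {E : M → Type*} [TopologicalSpace (TotalSpace F E)] [∀ x, AddCommGroup (E x)]
  [∀ x, Module ℝ (E x)] [∀ x, TopologicalSpace (E x)] [FiberBundle F E] [VectorBundle ℝ F E]


variable [FiniteDimensional ℝ F] [ContMDiffVectorBundle ∞ F E I] [T2Space M] [SigmaCompactSpace M]
  {C : CourantAlgebroid I F E}


variable (o : VolumeForm I M) (V : GeneralizedMetric C) (Ω : VolumeForm I M) (D : Connection C)

/-- Rank one directions `⟨s, ·⟩ g t`, with `s` in `V₊`, `t` in `V₋` and `g` a test function, have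
first variation `4 ∫ g Ric(s, t)`; the fundamental lemma gives `Ric(s, t) = 0` for global sections.
-/
lemma isExtremalMetric_iff : IsExtremalMetric o V Ω D ↔ D.IsRicciCompatible V := by
  constructor
  · intro h
    have key : ∀ s t : Sec I F E, (∀ x, s x ∈ V.plus x) → (∀ x, t x ∈ V.minus x) →
        ∀ x, D.ric x (s x) (t x) = 0 := by
      intro s t hs ht
      refine eq_zero_of_volInt Ω o (D.continuous_ric V s t) fun K hK g hg => ?_
      have ht0 : ∀ x, x ∉ K ∨ x ∈ I.boundary M → fsmul g t x = 0 := fun x hx => by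
        rw [fsmul_apply, hg x hx, zero_smul]
      let v := Variation.ofSections V Ω D hK s (fsmul g t) hs
        (fun x => Submodule.smul_mem _ _ (ht x)) ht0
      have h1 := (v.firstVariationVanishes_iff o hK).1 (h K hK v rfl rfl)
      have h2 : volInt o Ω K v.lagrangianVariation
          = 4 * volInt o Ω K (fun x => g x * D.ric x (s x) (t x)) := by
        rw [← volInt_const_mul o Ω hK]
        refine volInt_congr o Ω hK fun x _ => ?_
        have h3 : v.f x = 0 := rfl
        have h4 : v.metricPart x = 4 * D.ric x (s x) (fsmul g t x) :=
          Variation.metricPart_ofSections V Ω D hK s (fsmul g t) hs _ ht0 x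
        rw [Variation.lagrangianVariation, v.scalarLin_eq_zero rfl, h4, h3, fsmul_apply,
          ← D.ricForm_apply, map_smul, smul_eq_mul, D.ricForm_apply]
        ring
      rw [h2] at h1
      linarith
    intro x u hu v hv
    obtain ⟨f⟩ := nonempty_adaptedFrame V x
    have hx := f.mem_dom
    -- Cut-off frame sections lie in `V₊` or `V₋` everywhere and keep their values at `x`, so the
    -- statement for global sections reaches all vectors of the fibre.
    obtain ⟨χ, -, hχU, hχ1, -⟩ := exists_cutoff I f.dom_mem_nhds
    have hmem : ∀ (W : ∀ x, Submodule ℝ (E x)) (s : Sec I F E), (∀ z ∈ f.dom, s z ∈ W z) →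
        ∀ z, fsmul χ s z ∈ W z := by
      intro W s hs z
      by_cases hz : z ∈ tsupport χ
      · exact Submodule.smul_mem _ _ (hs z (hχU hz))
      · rw [fsmul_apply, image_eq_zero_of_notMem_tsupport hz, zero_smul]
        exact Submodule.zero_mem _
    have hχe : ∀ s : Sec I F E, fsmul χ s x = s x := fun s => by
      rw [fsmul_apply, hχ1.self_of_nhds, one_smul]
    have hframe : ∀ i j, f.η i = 1 → f.η j = -1 → D.ric x (f.e i x) (f.e j x) = 0 := by
      intro i j hi hj
      have := key (fsmul χ (f.e i)) (fsmul χ (f.e j))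
        (hmem V.plus _ fun z hz => f.mem_plus z hz i hi)
        (hmem V.minus _ fun z hz => f.mem_minus z hz j hj) x
      rwa [hχe, hχe] at this
    rw [← D.ricForm_apply, ← f.sum_coord hx u, ← f.sum_coord hx v,
      map_sum (D.ricForm x) _ Finset.univ, LinearMap.sum_apply]
    refine Finset.sum_eq_zero fun i _ => ?_
    rw [map_sum]
    refine Finset.sum_eq_zero fun j _ => ?_
    rw [map_smul, map_smul, LinearMap.smul_apply, D.ricForm_apply]
    rcases (f.ortho x hx).sign i with hi | hi
    · rcases (f.ortho x hx).sign j with hj | hj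
      · rw [V.pairing_minus_plus hv (f.mem_plus x hx j hj), mul_zero, zero_smul]
      · rw [hframe i j hi hj, smul_zero, smul_zero]
    · rw [V.pairing_plus_minus hu (f.mem_minus x hx i hi), mul_zero, zero_smul, smul_zero]
  · intro h K hK v hf hN
    rw [v.firstVariationVanishes_iff o hK, ← volInt_zero o Ω hK]
    refine volInt_congr o Ω hK fun x _ => ?_
    rw [Variation.lagrangianVariation, v.metricPart_eq_zero_of_isRicciCompatible h,
      v.scalarLin_eq_zero hN, hf, Pi.zero_apply, zero_mul, add_zero, add_zero]

lemma isExtremalVolume_iff : IsExtremalVolume o V Ω D ↔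
    ∀ x, D.scalar V.G x + canonicalScalar C x = 0 := by
  constructor
  · intro h
    refine eq_zero_of_volInt Ω o ((D.continuous_scalar_G V).add (continuous_canonicalScalar V))
      fun K hK g hg => ?_
    let v := Variation.ofFunction V Ω D K g hg
    have h1 := (v.firstVariationVanishes_iff o hK).1 (h K hK v rfl rfl)
    rw [← h1]
    refine volInt_congr o Ω hK fun x _ => ?_
    rw [Variation.lagrangianVariation, v.metricPart_eq_zero rfl, v.scalarLin_eq_zero rfl, zero_add,
      zero_add]
    rfl
  · intro h K hK v hφ hN
    rw [v.firstVariationVanishes_iff o hK, ← volInt_zero o Ω hK]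
    refine volInt_congr o Ω hK fun x _ => ?_
    rw [Variation.lagrangianVariation, v.metricPart_eq_zero hφ, v.scalarLin_eq_zero hN, h,
      mul_zero, add_zero, add_zero]

lemma Variation.volInt_scalarLin_tensor {V : GeneralizedMetric C} {Ω : VolumeForm I M}
    {D : Connection C} {K : Set M} (v : Variation V Ω D K) (hK : IsCompact K)
    (h : ∀ (N : CovTensor C) (x : M), D.reducedVariation Ω N V x = 0) :
    volInt o Ω K (D.scalarLin v.tensor V) = 0 := by
  rw [D.volInt_scalarLin V Ω o hK v.tensor fun x hx => v.tensor_map_eq_zero (v.N_zero x hx),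
    ← volInt_zero o Ω hK]
  exact volInt_congr o Ω hK fun x _ => h _ x

/-- Directions `g N` with a test function `g` reduce extremality to the pointwise vanishing of
`reducedVariation`, because that expression is linear over functions. -/
lemma isExtremalConnection_iff {p q : ℕ} (hsign : C.HasSignature p q) (hp : p ≠ 1)
    (hq : q ≠ 1) : IsExtremalConnection o V Ω D ↔ D.IsLeviCivita V ∧ D.HasVolumeDiv Ω := by
  rw [← D.reducedVariation_eq_zero_iff V Ω hsign hp hq]
  constructor
  · intro h N
    refine eq_zero_of_volInt Ω o (D.continuous_reducedVariation Ω N V) fun K hK g hg => ?_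
    have hN : ∀ x, x ∉ K ∨ x ∈ I.boundary M → ∀ ψ φ, (N.fmul g).map ψ φ x = 0 :=
      fun x hx ψ φ => by rw [N.fmul_map_apply, hg x hx, zero_smul]
    let v := Variation.ofTensor V Ω D K (N.fmul g) hN
    have h1 := (v.firstVariationVanishes_iff o hK).1 (h K hK v rfl rfl)
    have h2 : volInt o Ω K v.lagrangianVariation
        = volInt o Ω K (D.scalarLin (N.fmul g) V) := by
      refine volInt_congr o Ω hK fun x _ => ?_
      have h3 : v.f x = 0 := rfl
      rw [Variation.lagrangianVariation, v.metricPart_eq_zero rfl, h3, zero_mul, zero_add,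
        add_zero, Variation.ofTensor_tensor]
    rw [h2, D.volInt_scalarLin V Ω o hK _ hN] at h1
    rw [← h1]
    exact volInt_congr o Ω hK fun x _ => (D.reducedVariation_fmul V Ω N g x).symm
  · intro h K hK v hφ hf
    rw [v.firstVariationVanishes_iff o hK, ← v.volInt_scalarLin_tensor o hK h]
    refine volInt_congr o Ω hK fun x _ => ?_
    rw [Variation.lagrangianVariation, v.metricPart_eq_zero hφ, hf, Pi.zero_apply, zero_mul,
      zero_add, add_zero]

/-- Necessity comes from the three restricted classes of variations. Conversely, for a general
variation the three terms of `lagrangianVariation` vanish separately, two of them pointwise and the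
connection term after integration. -/
lemma isExtremal_iff {p q : ℕ} (hsign : C.HasSignature p q) (hp : p ≠ 1) (hq : q ≠ 1) :
    IsExtremal o V Ω D ↔ D.IsRicciCompatible V ∧
      (∀ x, D.scalar V.G x + canonicalScalar C x = 0) ∧
      (D.IsLeviCivita V ∧ D.HasVolumeDiv Ω) := by
  constructor
  · intro h
    exact ⟨(isExtremalMetric_iff o V Ω D).1 fun K hK v _ _ => h K hK v,
      (isExtremalVolume_iff o V Ω D).1 fun K hK v _ _ => h K hK v,
      (isExtremalConnection_iff o V Ω D hsign hp hq).1 fun K hK v _ _ => h K hK v⟩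
  · rintro ⟨h1, h2, h3⟩ K hK v
    rw [v.firstVariationVanishes_iff o hK, ← v.volInt_scalarLin_tensor o hK
      ((D.reducedVariation_eq_zero_iff V Ω hsign hp hq).2 h3)]
    refine volInt_congr o Ω hK fun x _ => ?_
    rw [Variation.lagrangianVariation, v.metricPart_eq_zero_of_isRicciCompatible h1, h2, mul_zero,
      zero_add, add_zero]

end MainTheorem

end Palatini

end

theorem theorem1 {n : ℕ} {H : Type*} [TopologicalSpace H]
    (I : ModelWithCorners ℝ (EuclideanSpace ℝ (Fin n)) H)
    {M : Type*} [TopologicalSpace M] [ChartedSpace H M] [IsManifold I ∞ M]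
    [T2Space M] [SigmaCompactSpace M]
    {F : Type*} [NormedAddCommGroup F] [NormedSpace ℝ F] [FiniteDimensional ℝ F]
    {E : M → Type*} [TopologicalSpace (Bundle.TotalSpace F E)] [∀ x, AddCommGroup (E x)]
    [∀ x, Module ℝ (E x)] [∀ x, TopologicalSpace (E x)] [FiberBundle F E] [VectorBundle ℝ F E]
    [ContMDiffVectorBundle ∞ F E I]
    (C : Palatini.CourantAlgebroid I F E) (p q : ℕ)
    (hsign : C.HasSignature p q)
    (hp : p ≠ 1) (hq : q ≠ 1) (o : Palatini.VolumeForm I M)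
    (V : Palatini.GeneralizedMetric C) (Ω : Palatini.VolumeForm I M)
    (D : Palatini.Connection C) :
    (Palatini.IsExtremal o V Ω D ↔
      D.IsRicciCompatible V ∧
      (∀ x, D.scalar V.G x + Palatini.canonicalScalar C x = 0) ∧
      (D.IsLeviCivita V ∧ D.HasVolumeDiv Ω)) ∧
    (Palatini.IsExtremalMetric o V Ω D ↔ D.IsRicciCompatible V) ∧
    (Palatini.IsExtremalVolume o V Ω D ↔
      ∀ x, D.scalar V.G x + Palatini.canonicalScalar C x = 0) ∧
    (Palatini.IsExtremalConnection o V Ω D ↔ D.IsLeviCivita V ∧ D.HasVolumeDiv Ω) :=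
  ⟨Palatini.isExtremal_iff o V Ω D hsign hp hq, Palatini.isExtremalMetric_iff o V Ω D,
    Palatini.isExtremalVolume_iff o V Ω D, Palatini.isExtremalConnection_iff o V Ω D hsign hp hq⟩
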